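/- Let $n\ge 1$, let $\Omega\subset\mathbb{R}^n$ be bounded and open, and let $\vec s=(s_1,\dots,s_n)$, $\vec p=(p_1,\dots,p_n)$ with $s_i\in(0,1)$, $p_i\in(1,\infty)$. Put $$\overline{\vec s}=\Big(\frac1n\sum_{i=1}^n\frac1{s_i}\Big)^{-1},\quad \overline{\vec s\vec p}=\Big(\frac1n\sum_{i=1}^n\frac1{s_ip_i}\Big)^{-1},\quad \vec p^{\,*}=\frac{n\,\overline{\vec s\vec p}/\overline{\vec s}}{n-\overline{\vec s\vec p}},$$ and assume $\overline{\vec s\vec p}<n$ and $p_{\max}:=\max_i p_i<\vec p^{\,*}$. Let $p_{\min}:=\min_i p_i$ and $f\in L^{(\vec p^{\,*})'}(\Omega)$, where $(\vec p^{\,*})'=\vec p^{\,*}/(\vec p^{\,*}-1)$. Write $D_i^hu(x)=u(x+he_i)-u(x)$. For $\vec\delta=(\delta_1,\dots,\delta_n)$ with all $\delta_i\ge 0$, let $W_0^{\vec s,\vec p,\vec\delta}(\Omega)$ be the set of functions $u$ on $\mathbb{R}^n$ such that $u=0$ a.e. outside $\Omega$ and, for every $i$, $u\in L^{p_i}(\mathbb{R}^n)$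 and $$\int_{\mathbb{R}^n}\int_{|h|\le\delta_i}\frac{|D_i^hu(x)|^{p_i}}{|h|^{1+s_ip_i}}\,dh\,dx<\infty\ \text{ if }\delta_i>0,\qquad \partial_iu\in L^{p_i}(\mathbb{R}^n)\text{ (weak derivative) if }\delta_i=0.$$ For $u,v\in W_0^{\vec s,\vec p,\vec\delta}(\Omega)$ let $\langle(-\widetilde\Delta_{\vec p})^{\vec s}_{\vec\delta}u,v\rangle=\sum_{i=1}^nA^i_{\delta_i}(u,v)$, where $$A^i_{\delta}(u,v)=\frac1{\delta^{p_i(1-s_i)}}\int_{\mathbb{R}^n}\int_{|h|\le\delta}\frac{|D_i^hu(x)|^{p_i-2}D_i^hu(x)\,D_i^hv(x)}{|h|^{1+s_ip_i}}\,dh\,dx\quad(\delta>0),$$ $$A^i_{0}(u,v)=\frac{2}{p_i(1-s_i)}\int_{\mathbb{R}^n}|\partial_iu|^{p_i-2}\partial_iu\,\partial_iv\,dx .$$ A function $u\in W_0^{\vec s,\vec p,\vec\delta}(\Omega)$ is a weak solution of $$(-\widetilde\Delta_{\vec p})^{\vec s}_{\vec\delta}u=f\ \text{ in }\Omega,\qquad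 u=0\ \text{ in }\mathbb{R}^n\setminus\Omega,\tag{$D_{\vec\delta}$}$$ if $\langle(-\widetilde\Delta_{\vec p})^{\vec s}_{\vec\delta}u,v\rangle=\int_\Omega fv\,dx$ for all $v\in W_0^{\vec s,\vec p,\vec\delta}(\Omega)$. Let $S\subseteq\{1,\dots,n\}$, and let $\vec\delta_k=(\delta_1^k,\dots,\delta_n^k)$, $k\in\mathbb{N}$, have positive entries, with $\delta_i^k\to0$ as $k\to\infty$ for $i\in S$ and $\delta_i^k=\delta_i$ independent of $k$ for $i\notin S$. Let $\vec\delta_0$ be the vector with entries $0$ for $i\in S$ and $\delta_i$ for $i\notin S$. For every $k$ let $u_k\in W_0^{\vec s,\vec p,\vec\delta_k}(\Omega)$ be a weak solution of $(D_{\vec\delta_k})$. Then the limiting mixed local/nonlocal problem $(D_{\vec\delta_0})$ has a weak solution $u_0\in W_0^{\vec s,\vec p,\vec\delta_0}(\Omega)$, it is unique (up to a.e. equality), and $u_k\to u_0$ in $L^{p_{\min}}(\Omega)$. -/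

import Mathlib

open MeasureTheory Filter Topology
open scoped ENNReal

noncomputable section

namespace Peridynamic

/-- Harmonic mean of the differentiability orders, `((1/n) ∑ 1/sᵢ)⁻¹`. -/
def meanS {n : ℕ} (s : Fin n → ℝ) : ℝ :=
  ((1 / (n : ℝ)) * ∑ i, 1 / s i)⁻¹

/-- Harmonic mean of the products `sᵢ pᵢ`, i.e. `((1/n) ∑ 1/(sᵢ pᵢ))⁻¹`. -/
def meanSP {n : ℕ} (s p : Fin n → ℝ) : ℝ :=
  ((1 / (n : ℝ)) * ∑ i, 1 / (s i * p i))⁻¹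

/-- The anisotropic critical Sobolev exponent. -/
def pStar {n : ℕ} (s p : Fin n → ℝ) : ℝ :=
  ((n : ℝ) * meanSP s p / meanS s) / ((n : ℝ) - meanSP s p)

/-- The increment `u(x + h eᵢ) - u(x)`. -/
def incr {n : ℕ} (i : Fin n) (u : EuclideanSpace ℝ (Fin n) → ℝ)
    (x : EuclideanSpace ℝ (Fin n)) (h : ℝ) : ℝ :=
  u (x + h • EuclideanSpace.single i (1 : ℝ)) - u x

/-- The truncated Gagliardo energy in the direction `eᵢ` with horizon `δ > 0`, with values in
`[0, ∞]`. -/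
def gagliardo {n : ℕ} (i : Fin n) (s p δ : ℝ) (u : EuclideanSpace ℝ (Fin n) → ℝ) : ℝ≥0∞ :=
  ∫⁻ x, ∫⁻ h in Set.Icc (-δ) δ, ENNReal.ofReal (|incr i u x h| ^ p / |h| ^ (1 + s * p))

/-- `g` is the weak partial derivative of `u` on the whole space in the direction `eᵢ`. -/
def HasWeakPartial {n : ℕ} (i : Fin n) (u g : EuclideanSpace ℝ (Fin n) → ℝ) : Prop :=
  LocallyIntegrable u volume ∧ LocallyIntegrable g volume ∧
    ∀ φ : EuclideanSpace ℝ (Fin n) → ℝ, ContDiff ℝ (⊤ : ℕ∞) φ → HasCompactSupport φ →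
      ∫ x, u x * fderiv ℝ φ x (EuclideanSpace.single i (1 : ℝ)) = - ∫ x, g x * φ x

open Classical in
/-- The weak partial derivative `∂ᵢ u` (unique almost everywhere), and `0` if there is none. -/
def weakPartial {n : ℕ} (i : Fin n) (u : EuclideanSpace ℝ (Fin n) → ℝ) :
    EuclideanSpace ℝ (Fin n) → ℝ :=
  if h : ∃ g, HasWeakPartial i u g then h.choose else 0

/-- Regularity in the direction `eᵢ`: `u ∈ L^p`, and the truncated Gagliardo energy is finite if
the horizon `δ` is positive, while `u` has a weak derivative `∂ᵢ u ∈ L^p` if `δ = 0`. -/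
def MemWi {n : ℕ} (i : Fin n) (s p δ : ℝ) (u : EuclideanSpace ℝ (Fin n) → ℝ) : Prop :=
  MemLp u (ENNReal.ofReal p) volume ∧
    if δ = 0 then ∃ g, HasWeakPartial i u g ∧ MemLp g (ENNReal.ofReal p) volume
    else gagliardo i s p δ u < ⊤

/-- The space of the functions on the whole space with the regularity `MemWi` in every direction
that vanish (almost everywhere) outside `Ω`. -/
def MemW0 {n : ℕ} (Ω : Set (EuclideanSpace ℝ (Fin n))) (s p δ : Fin n → ℝ)
    (u : EuclideanSpace ℝ (Fin n) → ℝ) : Prop :=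
  (∀ i, MemWi i (s i) (p i) (δ i) u) ∧ ∀ᵐ x ∂volume, x ∉ Ω → u x = 0

/-- The pairing `⟨(1/p) (Jⁱ_δ)'(u), v⟩` in the direction `eᵢ`: nonlocal with scaling
`δ ^ (-p (1 - s))` for `δ > 0`, and local with the constant `2 / (p (1 - s))` for `δ = 0`. -/
def formI {n : ℕ} (i : Fin n) (s p δ : ℝ) (u v : EuclideanSpace ℝ (Fin n) → ℝ) : ℝ :=
  if δ = 0 then
    2 / (p * (1 - s)) *
      ∫ x, |weakPartial i u x| ^ (p - 2) * weakPartial i u x * weakPartial i v x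
  else
    1 / δ ^ (p * (1 - s)) *
      ∫ x, ∫ h in Set.Icc (-δ) δ,
        |incr i u x h| ^ (p - 2) * incr i u x h * incr i v x h / |h| ^ (1 + s * p)

/-- The pairing of the anisotropic (peridynamic, or mixed local/nonlocal) operator applied to `u`
with `v`. A vanishing horizon stands for the local operator in that direction. -/
def form {n : ℕ} (s p δ : Fin n → ℝ) (u v : EuclideanSpace ℝ (Fin n) → ℝ) : ℝ :=
  ∑ i, formI i (s i) (p i) (δ i) u v

/-- `u` is a weak solution of the Dirichlet problem with right-hand side `f` in `Ω` and `u = 0`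
outside `Ω`. -/
def IsWeakSolution {n : ℕ} (Ω : Set (EuclideanSpace ℝ (Fin n))) (s p δ : Fin n → ℝ)
    (f u : EuclideanSpace ℝ (Fin n) → ℝ) : Prop :=
  MemW0 Ω s p δ u ∧ ∀ v, MemW0 Ω s p δ v → form s p δ u v = ∫ x in Ω, f x * v x

/-- The limiting horizons: `0` in the directions of `S`, and `δ` in the others. -/
def limitHorizon {n : ℕ} (S : Finset (Fin n)) (δ : Fin n → ℝ) : Fin n → ℝ :=
  fun i => if i ∈ S then 0 else δ i

end Peridynamic

end

noncomputable section

namespace Peridynamic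

/-! After division of the increments by the step, the form in the direction `eᵢ` becomes the pairing
∫ |Qu|^(p-2) Qu · Qv with respect to Lebesgue measure times `horizonMeasure`, a measure on the steps
whose mass 2/(p(1-s)) does not depend on δ. For δ = 0 it is a Dirac mass and Qu is the weak
derivative (`dirQuot`, `formI_eq_integral`). Local and nonlocal directions are thus governed by the
same pointwise inequalities for t ↦ |t|^(p-2) t, with constants independent of the measure.

Uniform bounds. Composing small steps into large ones shows that the scaled energy of horizon δ
controls the full Gagliardo energy and the `L^p` norm, uniformly for δ ≤ D
(`exists_energy_le_scaled`, `exists_halfEnergy_le_dirQuot`). The full energies control the critical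
norm by dyadic truncation (`exists_lintegral_rpow_le`). With κ = ∑ 1/(sᵢpᵢ) and τ = ∑ 1/sᵢ, testing
the equation with u gives M ≤ A M^(κ/τ) for the total energy M, and κ < τ bounds it
(`Admissible.exists_dirEnergy_le`).

Limit passage. Bounded energies give weak limits of the functions and of their quotients. The latter
are identified as the quotients of the limit if the horizon is fixed, and as its weak derivative,
after averaging over the steps, if the horizon vanishes (`tendsto_formI_of_fixed`,
`tendsto_formI_of_zero`). Hence form(w, u_k) converges for every test function w of the limit
problem, and monotonicity with Minty's device makes the weak limit u₀ a solution
(`Admissible.exists_limit_solution`). This also proves existence.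

Strong convergence. The monotonicity gap between u_k and u₀ tends to 0 and controls the energy of
u_k - u₀ up to a small multiple of bounded energies; the uniform Poincaré inequality turns this into
`L^p` convergence, without a compact embedding. The same gap estimate gives uniqueness. Limits are
taken along ultrafilters, and uniqueness makes them all agree. -/

/-! ### Pointwise inequalities for powers, by homogeneity and compactness. -/

/-- Two continuous positively `p`-homogeneous functions on a finite-dimensional space: if `F ≤ 0`
on the zero set of `H ≥ 0`, then `F` is dominated by `H` up to an arbitrarily small error. -/
lemma exists_le_mul_add_of_homogeneous {V : Type*} [NormedAddCommGroup V] [NormedSpace ℝ V]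
    [ProperSpace V] {p : ℝ} {F H : V → ℝ} (hF : Continuous F) (hH : Continuous H) (hp : 0 < p)
    (hFh : ∀ t : ℝ, 0 < t → ∀ x, F (t • x) = t ^ p * F x)
    (hHh : ∀ t : ℝ, 0 < t → ∀ x, H (t • x) = t ^ p * H x)
    (hH0 : ∀ x, 0 ≤ H x) (h0 : ∀ x, H x = 0 → F x ≤ 0) {ε : ℝ} (hε : 0 < ε) :
    ∃ C, 0 ≤ C ∧ ∀ x, F x ≤ C * H x + ε * ‖x‖ ^ p := by
  -- On this compact part of the sphere F is positive, so H has no zero and F / H is bounded;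
  -- elsewhere on the sphere the ε-term alone suffices.
  set K : Set V := Metric.sphere 0 1 ∩ {x | ε ≤ F x} with hK
  have hKc : IsCompact K := (isCompact_sphere 0 1).inter_right (isClosed_le continuous_const hF)
  have hne : ∀ x ∈ K, H x ≠ 0 := fun x hx h => by
    have := h0 x h
    have := hx.2
    simp only [Set.mem_ofPred_eq] at this
    linarith
  obtain ⟨M, hM⟩ := hKc.bddAbove_image (hF.continuousOn.div hH.continuousOn hne)
  have key : ∀ y, ‖y‖ = 1 → F y ≤ max M 0 * H y + ε := by
    intro y hy
    by_cases h : ε ≤ F y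
    · have hyK : y ∈ K := ⟨by simpa using hy, h⟩
      have h1 : F y / H y ≤ M := hM ⟨y, hyK, rfl⟩
      have hpos : 0 < H y := lt_of_le_of_ne (hH0 y) (hne y hyK).symm
      rw [div_le_iff₀ hpos] at h1
      have := mul_le_mul_of_nonneg_right (le_max_left M 0) hpos.le
      linarith
    · have := mul_nonneg (le_max_right M 0) (hH0 y)
      linarith
  refine ⟨max M 0, le_max_right _ _, fun x => ?_⟩
  rcases eq_or_ne x 0 with rfl | hx
  · have h2 := hFh 2 two_pos 0
    have h3 : (1 : ℝ) < 2 ^ p := Real.one_lt_rpow one_lt_two hp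
    rw [smul_zero] at h2
    have h4 : F 0 = 0 := by
      have : (2 ^ p - 1) * F 0 = 0 := by linarith
      rcases mul_eq_zero.1 this with h | h
      · linarith
      · exact h
    rw [h4, norm_zero, Real.zero_rpow hp.ne']
    have := mul_nonneg (le_max_right M 0) (hH0 (0 : V))
    linarith
  · have hx' : 0 < ‖x‖ := norm_pos_iff.2 hx
    have hy : ‖(‖x‖⁻¹ • x)‖ = 1 := by
      rw [norm_smul, norm_inv, norm_norm, inv_mul_cancel₀ hx'.ne']
    have hxy : ‖x‖ • (‖x‖⁻¹ • x) = x := by rw [smul_smul, mul_inv_cancel₀ hx'.ne', one_smul]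
    have h1 := key _ hy
    have h2 := hFh ‖x‖ hx' (‖x‖⁻¹ • x)
    have h3 := hHh ‖x‖ hx' (‖x‖⁻¹ • x)
    rw [hxy] at h2 h3
    have := mul_le_mul_of_nonneg_left h1 (Real.rpow_nonneg hx'.le p)
    rw [h2, h3]
    linarith

/-- The odd power `t ↦ |t| ^ (p - 2) t`. -/
def signedPow (p t : ℝ) : ℝ := |t| ^ (p - 2) * t

lemma signedPow_eq {p : ℝ} (hp : 1 < p) (t : ℝ) :
    signedPow p t = max t 0 ^ (p - 1) - max (-t) 0 ^ (p - 1) := by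
  have h0 : (0 : ℝ) ^ (p - 1) = 0 := Real.zero_rpow (by linarith)
  unfold signedPow
  rcases lt_trichotomy t 0 with h | h | h
  · rw [max_eq_right h.le, max_eq_left (by linarith), h0, abs_of_neg h,
      show p - 1 = (p - 2) + 1 by ring, Real.rpow_add (by linarith), Real.rpow_one]
    ring
  · simp [h]
  · rw [max_eq_left h.le, max_eq_right (by linarith), h0, abs_of_pos h,
      show p - 1 = (p - 2) + 1 by ring, Real.rpow_add h, Real.rpow_one]
    ring

lemma continuous_signedPow {p : ℝ} (hp : 1 < p) : Continuous (signedPow p) := by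
  have : signedPow p = fun t => max t 0 ^ (p - 1) - max (-t) 0 ^ (p - 1) :=
    funext (signedPow_eq hp)
  rw [this]
  have h : ∀ t : ℝ, 0 ≤ p - 1 := fun _ => by linarith
  exact ((continuous_id.max continuous_const).rpow_const fun t => Or.inr (h t)).sub
    ((continuous_id.neg.max continuous_const).rpow_const fun t => Or.inr (h t))

lemma strictMono_signedPow {p : ℝ} (hp : 1 < p) : StrictMono (signedPow p) := by
  intro a b hab
  rw [signedPow_eq hp, signedPow_eq hp]
  have hp' : 0 < p - 1 := by linarith
  have h1 : max a 0 ^ (p - 1) ≤ max b 0 ^ (p - 1) :=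
    Real.rpow_le_rpow (le_max_right _ _) (max_le_max hab.le le_rfl) hp'.le
  have h2 : max (-b) 0 ^ (p - 1) ≤ max (-a) 0 ^ (p - 1) :=
    Real.rpow_le_rpow (le_max_right _ _) (max_le_max (by linarith) le_rfl) hp'.le
  rcases lt_or_ge 0 b with hb | hb
  · have : max a 0 ^ (p - 1) < max b 0 ^ (p - 1) :=
      Real.rpow_lt_rpow (le_max_right _ _) (max_lt (lt_max_of_lt_left hab) (lt_max_of_lt_left hb))
        hp'
    linarith
  · have : max (-b) 0 ^ (p - 1) < max (-a) 0 ^ (p - 1) :=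
      Real.rpow_lt_rpow (le_max_right _ _)
        (max_lt (lt_max_of_lt_left (by linarith)) (lt_max_of_lt_left (by linarith))) hp'
    linarith

lemma signedPow_mul {p t : ℝ} (ht : 0 < t) (a : ℝ) :
    signedPow p (t * a) = t ^ (p - 1) * signedPow p a := by
  unfold signedPow
  rw [abs_mul, abs_of_pos ht, Real.mul_rpow ht.le (abs_nonneg a),
    show p - 1 = (p - 2) + 1 by ring, Real.rpow_add ht, Real.rpow_one]
  ring

lemma signedPow_mul_self {p : ℝ} (hp : 1 < p) (a : ℝ) : signedPow p a * a = |a| ^ p := by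
  unfold signedPow
  rcases eq_or_ne a 0 with rfl | h
  · simp [Real.zero_rpow (by linarith : p ≠ 0)]
  · have ha : 0 < |a| := abs_pos.2 h
    rw [mul_assoc, ← abs_mul_abs_self a, ← mul_assoc, ← Real.rpow_add_one ha.ne',
      ← Real.rpow_add_one ha.ne']
    congr 1
    ring

lemma abs_signedPow {p : ℝ} (hp : 1 < p) (a : ℝ) : |signedPow p a| = |a| ^ (p - 1) := by
  unfold signedPow
  rcases eq_or_ne a 0 with rfl | h
  · simp [Real.zero_rpow (by linarith : p - 1 ≠ 0)]
  · have ha : 0 < |a| := abs_pos.2 h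
    rw [abs_mul, abs_of_nonneg (Real.rpow_nonneg ha.le _), ← Real.rpow_add_one ha.ne']
    congr 1
    ring

lemma signedPow_sub_mul_sub_nonneg {p : ℝ} (hp : 1 < p) (a b : ℝ) :
    0 ≤ (signedPow p a - signedPow p b) * (a - b) := by
  have hm := (strictMono_signedPow hp).monotone
  rcases le_total a b with h | h
  · exact mul_nonneg_of_nonpos_of_nonpos (sub_nonpos.2 (hm h)) (sub_nonpos.2 h)
  · exact mul_nonneg (sub_nonneg.2 (hm h)) (sub_nonneg.2 h)

lemma norm_prod_rpow_le (p a b : ℝ) : ‖(a, b)‖ ^ p ≤ |a| ^ p + |b| ^ p := by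
  have h1 := Real.rpow_nonneg (abs_nonneg a) p
  have h2 := Real.rpow_nonneg (abs_nonneg b) p
  rw [Prod.norm_def, Real.norm_eq_abs, Real.norm_eq_abs]
  rcases max_choice |a| |b| with h | h <;> rw [h] <;> linarith

lemma continuous_abs_rpow {X : Type*} [TopologicalSpace X] {p : ℝ} (hp : 0 < p) {g : X → ℝ}
    (hg : Continuous g) : Continuous fun x => |g x| ^ p :=
  hg.abs.rpow_const fun _ => Or.inr hp.le

lemma abs_mul_rpow {t : ℝ} (ht : 0 < t) (p a : ℝ) : |t * a| ^ p = t ^ p * |a| ^ p := by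
  rw [abs_mul, abs_of_pos ht, Real.mul_rpow ht.le (abs_nonneg a)]

/-- By strict monotonicity of `signedPow` the product vanishes only for a = b, and all terms are
`p`-homogeneous. The ε-term spares the usual distinction between p ≥ 2 and p < 2. -/
lemma abs_sub_rpow_le_monotonicity {p : ℝ} (hp : 1 < p) {ε : ℝ} (hε : 0 < ε) :
    ∃ C, 0 ≤ C ∧ ∀ a b : ℝ, |a - b| ^ p ≤
      C * ((signedPow p a - signedPow p b) * (a - b)) + ε * (|a| ^ p + |b| ^ p) := by
  have hp0 : 0 < p := by linarith
  have hJ := continuous_signedPow hp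
  obtain ⟨C, hC, h⟩ := exists_le_mul_add_of_homogeneous (V := ℝ × ℝ) (p := p)
    (F := fun x => |x.1 - x.2| ^ p)
    (H := fun x => (signedPow p x.1 - signedPow p x.2) * (x.1 - x.2))
    (continuous_abs_rpow hp0 (by fun_prop))
    (((hJ.comp continuous_fst).sub (hJ.comp continuous_snd)).mul (by fun_prop)) hp0
    (fun t ht x => by
      simp only [Prod.smul_fst, Prod.smul_snd, smul_eq_mul, ← mul_sub]
      exact abs_mul_rpow ht _ _)
    (fun t ht x => by
      simp only [Prod.smul_fst, Prod.smul_snd, smul_eq_mul, signedPow_mul ht]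
      rw [show p = (p - 1) + 1 by ring, Real.rpow_add_one ht.ne']
      ring_nf)
    (fun x => signedPow_sub_mul_sub_nonneg hp _ _)
    (fun x hx => by
      have : x.1 - x.2 = 0 := by
        rcases mul_eq_zero.1 hx with h | h
        · exact sub_eq_zero.2 ((strictMono_signedPow hp).injective (sub_eq_zero.1 h))
        · exact h
      simp [this, Real.zero_rpow hp0.ne'])
    hε
  refine ⟨C, hC, fun a b => (h (a, b)).trans ?_⟩
  have := mul_le_mul_of_nonneg_left (norm_prod_rpow_le p a b) hε.le
  simpa using this

/-- In the equality case, |a| ≠ |b| is excluded by strict convexity of t ↦ t^p; if a = -b, the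
midpoint vanishes and forces b = 0. -/
lemma abs_half_add_rpow_le {p : ℝ} (hp : 1 < p) (a b : ℝ) :
    |(a + b) / 2| ^ p ≤ (|a| ^ p + |b| ^ p) / 2 ∧
      ((|a| ^ p + |b| ^ p) / 2 = |(a + b) / 2| ^ p → a = b) := by
  have hp0 : 0 < p := by linarith
  have hab : |(a + b) / 2| ≤ (1 / 2 : ℝ) * |a| + (1 / 2 : ℝ) * |b| := by
    rw [abs_div, abs_two]
    linarith [abs_add_le a b]
  have h1 : |(a + b) / 2| ^ p ≤ ((1 / 2 : ℝ) * |a| + (1 / 2 : ℝ) * |b|) ^ p :=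
    Real.rpow_le_rpow (abs_nonneg _) hab hp0.le
  have h2 := (convexOn_rpow hp.le).2 (abs_nonneg a : |a| ∈ Set.Ici 0) (abs_nonneg b)
    (by norm_num : (0 : ℝ) ≤ 1 / 2) (by norm_num : (0 : ℝ) ≤ 1 / 2) (by norm_num)
  simp only [smul_eq_mul] at h2
  refine ⟨by linarith, fun heq => ?_⟩
  by_cases hne : |a| = |b|
  · rcases abs_eq_abs.1 hne with h | h
    · exact h
    · rw [h, neg_add_cancel, zero_div, abs_zero, Real.zero_rpow hp0.ne', abs_neg] at heq
      have hb : |b| ^ p = 0 := by linarith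
      have : b = 0 := by
        have := (Real.rpow_eq_zero (abs_nonneg b) hp0.ne').1 hb
        exact abs_eq_zero.1 this
      rw [h, this, neg_zero]
  · have h3 := (strictConvexOn_rpow hp).2 (abs_nonneg a : |a| ∈ Set.Ici 0) (abs_nonneg b) hne
      (by norm_num : (0 : ℝ) < 1 / 2) (by norm_num : (0 : ℝ) < 1 / 2) (by norm_num)
    simp only [smul_eq_mul] at h3
    linarith

/-- This plays the role of Clarkson's inequalities: integrated, it gives the uniform convexity of
`L^p` for all p > 1 at once. -/
lemma abs_sub_rpow_le_convexity_gap {p : ℝ} (hp : 1 < p) {ε : ℝ} (hε : 0 < ε) :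
    ∃ C, 0 ≤ C ∧ ∀ a b : ℝ, |a - b| ^ p ≤
      C * ((|a| ^ p + |b| ^ p) / 2 - |(a + b) / 2| ^ p) + ε * (|a| ^ p + |b| ^ p) := by
  have hp0 : 0 < p := by linarith
  obtain ⟨C, hC, h⟩ := exists_le_mul_add_of_homogeneous (V := ℝ × ℝ) (p := p)
    (F := fun x => |x.1 - x.2| ^ p)
    (H := fun x => (|x.1| ^ p + |x.2| ^ p) / 2 - |(x.1 + x.2) / 2| ^ p)
    (continuous_abs_rpow hp0 (by fun_prop))
    ((((continuous_abs_rpow hp0 continuous_fst).add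
      (continuous_abs_rpow hp0 continuous_snd)).div_const 2).sub
      (continuous_abs_rpow hp0 (by fun_prop))) hp0
    (fun t ht x => by
      simp only [Prod.smul_fst, Prod.smul_snd, smul_eq_mul, ← mul_sub]
      exact abs_mul_rpow ht _ _)
    (fun t ht x => by
      simp only [Prod.smul_fst, Prod.smul_snd, smul_eq_mul, ← mul_add, mul_div_assoc]
      rw [abs_mul_rpow ht, abs_mul_rpow ht, abs_mul_rpow ht]
      ring)
    (fun x => sub_nonneg.2 (abs_half_add_rpow_le hp _ _).1)
    (fun x hx => by
      have : x.1 = x.2 := (abs_half_add_rpow_le hp _ _).2 (sub_eq_zero.1 hx)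
      simp [this, Real.zero_rpow hp0.ne'])
    hε
  refine ⟨C, hC, fun a b => (h (a, b)).trans ?_⟩
  have := mul_le_mul_of_nonneg_left (norm_prod_rpow_le p a b) hε.le
  simpa using this

/-- A quantitative continuity of the form in its first, nonlinear argument; it serves to replace
difference quotients by weak derivatives. -/
lemma abs_signedPow_sub_mul_le {p : ℝ} (hp : 1 < p) {ε : ℝ} (hε : 0 < ε) :
    ∃ C, 0 ≤ C ∧ ∀ a b q : ℝ, |(signedPow p a - signedPow p b) * q| ≤
      C * |a - b| ^ p + ε * (|a| ^ p + |b| ^ p + |q| ^ p) := by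
  have hp0 : 0 < p := by linarith
  have hJ := continuous_signedPow hp
  obtain ⟨C, hC, h⟩ := exists_le_mul_add_of_homogeneous (V := (ℝ × ℝ) × ℝ) (p := p)
    (F := fun x => |(signedPow p x.1.1 - signedPow p x.1.2) * x.2|)
    (H := fun x => |x.1.1 - x.1.2| ^ p)
    (((hJ.comp (continuous_fst.comp continuous_fst)).sub
      (hJ.comp (continuous_snd.comp continuous_fst))).mul continuous_snd).abs
    (continuous_abs_rpow hp0 (by fun_prop)) hp0
    (fun t ht x => by
      simp only [Prod.smul_fst, Prod.smul_snd, smul_eq_mul, signedPow_mul ht]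
      have hpow : t ^ p = t ^ (p - 1) * t := by
        rw [← Real.rpow_add_one ht.ne', sub_add_cancel]
      rw [← abs_of_pos (Real.rpow_pos_of_pos ht p), ← abs_mul, hpow]
      ring_nf)
    (fun t ht x => by
      simp only [Prod.smul_fst, Prod.smul_snd, smul_eq_mul, ← mul_sub]
      exact abs_mul_rpow ht _ _)
    (fun x => Real.rpow_nonneg (abs_nonneg _) _)
    (fun x hx => by
      have : x.1.1 = x.1.2 :=
        sub_eq_zero.1 (abs_eq_zero.1 ((Real.rpow_eq_zero (abs_nonneg _) hp0.ne').1 hx))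
      simp [this])
    hε
  refine ⟨C, hC, fun a b q => (h ((a, b), q)).trans ?_⟩
  have h1 : ‖((a, b), q)‖ ^ p ≤ |a| ^ p + |b| ^ p + |q| ^ p := by
    have h1 := norm_prod_rpow_le p a b
    have h2 := Real.rpow_nonneg (abs_nonneg q) p
    have h3 : 0 ≤ ‖(a, b)‖ ^ p := Real.rpow_nonneg (norm_nonneg _) p
    rw [Prod.norm_def, Real.norm_eq_abs]
    rcases max_choice ‖(a, b)‖ |q| with h | h <;> simp only [] <;> rw [h] <;> linarith
  have := mul_le_mul_of_nonneg_left h1 hε.le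
  simpa using this

/-! ### Weak compactness from uniform convexity. -/

/-- In a Banach space with a uniformly convex nonnegative functional, a sequence that is bounded
along a filter has a point common to all closed convex sets containing it eventually. -/
lemma exists_mem_of_eventually_mem_convex {X ι : Type*} [NormedAddCommGroup X] [NormedSpace ℝ X]
    [CompleteSpace X] {Φ : X → ℝ} (hΦ0 : ∀ x, 0 ≤ Φ x)
    (hΦ : ∀ R ε : ℝ, 0 < ε → ∃ η > 0, ∀ x y, Φ x ≤ R → Φ y ≤ R → ε ≤ dist x y →
      Φ ((1 / 2 : ℝ) • x + (1 / 2 : ℝ) • y) ≤ (Φ x + Φ y) / 2 - η)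
    {l : Filter ι} [NeBot l] {x : ι → X} {R : ℝ} (hx : ∀ᶠ k in l, Φ (x k) ≤ R) :
    ∃ y, ∀ K : Set X, Convex ℝ K → IsClosed K → (∀ᶠ k in l, x k ∈ K) → y ∈ K := by
  let 𝒦 := {K : Set X // Convex ℝ K ∧ IsClosed K ∧ ∀ᶠ k in l, x k ∈ K}
  let d : 𝒦 → ℝ := fun K => sInf (Φ '' K.1)
  have hbdd : ∀ K : 𝒦, BddBelow (Φ '' K.1) := fun K => ⟨0, by rintro _ ⟨z, -, rfl⟩; exact hΦ0 z⟩
  have hne : ∀ K : 𝒦, (Φ '' K.1).Nonempty := fun K => by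
    obtain ⟨k, hk⟩ := K.2.2.2.exists
    exact ⟨_, x k, hk, rfl⟩
  have hdR : ∀ K, d K ≤ R := fun K => by
    obtain ⟨k, hk, hk'⟩ := (K.2.2.2.and hx).exists
    exact (csInf_le (hbdd K) ⟨x k, hk, rfl⟩).trans hk'
  have : Nonempty 𝒦 := ⟨⟨Set.univ, convex_univ, isClosed_univ, by simp⟩⟩
  have hdbdd : BddAbove (Set.range d) := ⟨R, by rintro _ ⟨K, rfl⟩; exact hdR K⟩
  -- The supremum is finite, since every K meets the sublevel set of height R. As d K ≤ D, each K
  -- contains almost minimal points at the level D + η; the sets of such points generate the filter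
  -- F.
  set D := ⨆ K, d K with hD
  let G : 𝒦 × {η : ℝ // 0 < η} → Set X := fun j => j.1.1 ∩ {z | Φ z ≤ D + j.2.1}
  let F : Filter X := ⨅ j, 𝓟 (G j)
  have : Nonempty (𝒦 × {η : ℝ // 0 < η}) := ⟨⟨Classical.arbitrary _, ⟨1, one_pos⟩⟩⟩
  have hGne : ∀ j, (G j).Nonempty := fun j => by
    have h1 : d j.1 < D + j.2.1 := lt_of_le_of_lt (le_ciSup hdbdd j.1) (lt_add_of_pos_right _ j.2.2)
    obtain ⟨_, ⟨z, hz, rfl⟩, hlt⟩ := exists_lt_of_csInf_lt (hne j.1) h1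
    exact ⟨z, hz, hlt.le⟩
  have hF : NeBot F := by
    refine iInf_neBot_of_directed' ?_ fun j => principal_neBot_iff.2 (hGne j)
    intro j j'
    refine ⟨⟨⟨j.1.1 ∩ j'.1.1, j.1.2.1.inter j'.1.2.1, j.1.2.2.1.inter j'.1.2.2.1,
      j.1.2.2.2.and j'.1.2.2.2⟩, ⟨min j.2.1 j'.2.1, lt_min j.2.2 j'.2.2⟩⟩, ?_, ?_⟩
    · refine principal_mono.2 ?_
      rintro z ⟨⟨hz, -⟩, hz'⟩
      have hz2 : Φ z ≤ D + min j.2.1 j'.2.1 := hz'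
      have hz3 : Φ z ≤ D + j.2.1 := hz2.trans (add_le_add_right (min_le_left _ _) _)
      exact ⟨hz, hz3⟩
    · refine principal_mono.2 ?_
      rintro z ⟨⟨-, hz⟩, hz'⟩
      have hz2 : Φ z ≤ D + min j.2.1 j'.2.1 := hz'
      have hz3 : Φ z ≤ D + j'.2.1 := hz2.trans (add_le_add_right (min_le_right _ _) _)
      exact ⟨hz, hz3⟩
  have hGF : ∀ j, G j ∈ F := fun j => mem_iInf_of_mem j (mem_principal_self _)
  have hC : Cauchy F := by
    refine Metric.cauchy_iff.2 ⟨hF, fun ε hε => ?_⟩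
    obtain ⟨η, hη, h⟩ := hΦ (D + 1) ε hε
    -- Two points of K at level D + η/2 and at distance at least ε would have a midpoint in K at
    -- level at most D - η/2 < d K, which is impossible. Hence F is Cauchy.
    obtain ⟨K, hK⟩ : ∃ K, D - η / 2 < d K := exists_lt_of_lt_ciSup (by linarith)
    refine ⟨_, hGF ⟨K, ⟨min 1 (η / 2), lt_min one_pos (by linarith)⟩⟩, fun a ha b hb => ?_⟩
    by_contra! hab
    have m1 := min_le_left (1 : ℝ) (η / 2)
    have m2 := min_le_right (1 : ℝ) (η / 2)
    have ha' : Φ a ≤ D + min 1 (η / 2) := ha.2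
    have hb' : Φ b ≤ D + min 1 (η / 2) := hb.2
    have h1 := h a b (by linarith) (by linarith) hab
    have hmid : (1 / 2 : ℝ) • a + (1 / 2 : ℝ) • b ∈ K.1 :=
      K.2.1 ha.1 hb.1 (by norm_num) (by norm_num) (by norm_num)
    have h2 : d K ≤ _ := csInf_le (hbdd K) ⟨_, hmid, rfl⟩
    linarith
  obtain ⟨y, hy⟩ := CompleteSpace.complete hC
  refine ⟨y, fun K hK1 hK2 hK3 => ?_⟩
  have hKF : K ∈ F :=
    mem_of_superset (hGF ⟨⟨K, hK1, hK2, hK3⟩, ⟨1, one_pos⟩⟩) Set.inter_subset_left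
  exact hK2.mem_of_tendsto (f := id) (b := F) (hy.trans le_rfl) hKF

/-! ### `L^p` spaces: uniform convexity, weak limits, integrated monotonicity. -/

section LpSpaces

variable {α : Type*} [MeasurableSpace α] {μ : Measure α} {p q : ℝ}

lemma integrable_abs_rpow (hp : 1 < p) {g : α → ℝ} (hg : MemLp g (ENNReal.ofReal p) μ) :
    Integrable (fun x => |g x| ^ p) μ := by
  have h0 : ENNReal.ofReal p ≠ 0 := by simp; linarith
  have := hg.integrable_norm_rpow h0 ENNReal.ofReal_ne_top
  rwa [ENNReal.toReal_ofReal (by linarith)] at this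

lemma eLpNorm_rpow_eq_lintegral (hp : 1 < p) (g : α → ℝ) :
    eLpNorm g (ENNReal.ofReal p) μ ^ p = ∫⁻ x, ‖g x‖ₑ ^ p ∂μ := by
  have h0 : ENNReal.ofReal p ≠ 0 := by simp; linarith
  have hp0 : p ≠ 0 := by linarith
  rw [eLpNorm_eq_lintegral_rpow_enorm_toReal h0 ENNReal.ofReal_ne_top,
    ENNReal.toReal_ofReal (by linarith), ← ENNReal.rpow_mul, one_div, inv_mul_cancel₀ hp0,
    ENNReal.rpow_one]

lemma enorm_rpow_eq_ofReal (hp : 1 < p) (a : ℝ) : ‖a‖ₑ ^ p = ENNReal.ofReal (|a| ^ p) := by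
  rw [← ofReal_norm, Real.norm_eq_abs, ENNReal.ofReal_rpow_of_nonneg (abs_nonneg _)
    (by linarith)]

lemma ofReal_integral_abs_rpow (hp : 1 < p) {g : α → ℝ} (hg : MemLp g (ENNReal.ofReal p) μ) :
    ENNReal.ofReal (∫ x, |g x| ^ p ∂μ) = ∫⁻ x, ‖g x‖ₑ ^ p ∂μ := by
  rw [ofReal_integral_eq_lintegral_ofReal (integrable_abs_rpow hp hg)
    (Eventually.of_forall fun x => Real.rpow_nonneg (abs_nonneg _) _)]
  exact lintegral_congr fun x => (enorm_rpow_eq_ofReal hp _).symm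

lemma memLp_iff_lintegral_lt_top (hp : 1 < p) {g : α → ℝ} (hg : AEStronglyMeasurable g μ) :
    MemLp g (ENNReal.ofReal p) μ ↔ ∫⁻ x, ‖g x‖ₑ ^ p ∂μ < ⊤ := by
  have hp0 : 0 < p := by linarith
  rw [MemLp, ← eLpNorm_rpow_eq_lintegral hp, ENNReal.rpow_lt_top_iff_of_pos hp0]
  exact and_iff_right hg

lemma norm_rpow_Lp_eq_integral (hp : 1 < p) (g : Lp ℝ (ENNReal.ofReal p) μ) :
    ‖g‖ ^ p = ∫ x, |g x| ^ p ∂μ := by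
  have h1 := eLpNorm_rpow_eq_lintegral (μ := μ) hp g
  rw [← ofReal_integral_abs_rpow hp (Lp.memLp g)] at h1
  have h2 := congrArg ENNReal.toReal h1
  rwa [ENNReal.toReal_ofReal (integral_nonneg fun x => Real.rpow_nonneg (abs_nonneg _) _),
    ← ENNReal.toReal_rpow, ← Lp.norm_def] at h2

lemma integral_abs_sub_rpow_le_gap (hp : 1 < p) {ε : ℝ} (hε : 0 < ε) :
    ∃ C, 0 ≤ C ∧ ∀ a b : α → ℝ, MemLp a (ENNReal.ofReal p) μ → MemLp b (ENNReal.ofReal p) μ →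
      ∫ x, |a x - b x| ^ p ∂μ ≤ C * ((∫ x, |a x| ^ p ∂μ + ∫ x, |b x| ^ p ∂μ) / 2 -
        ∫ x, |(a x + b x) / 2| ^ p ∂μ) + ε * (∫ x, |a x| ^ p ∂μ + ∫ x, |b x| ^ p ∂μ) := by
  obtain ⟨C, hC, h⟩ := abs_sub_rpow_le_convexity_gap hp hε
  refine ⟨C, hC, fun a b ha hb => ?_⟩
  have ia := integrable_abs_rpow hp ha
  have ib := integrable_abs_rpow hp hb
  have iab := integrable_abs_rpow hp (ha.sub hb)
  have imid : Integrable (fun x => |(a x + b x) / 2| ^ p) μ := by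
    have := integrable_abs_rpow hp ((ha.add hb).mul_const (1 / 2 : ℝ))
    refine this.congr (Eventually.of_forall fun x => ?_)
    simp only [Pi.add_apply]
    rw [mul_one_div]
  have isum : Integrable (fun x => |a x| ^ p + |b x| ^ p) μ := ia.add ib
  have igap : Integrable (fun x => (|a x| ^ p + |b x| ^ p) / 2 - |(a x + b x) / 2| ^ p) μ :=
    (isum.div_const 2).sub imid
  calc ∫ x, |a x - b x| ^ p ∂μ
      ≤ ∫ x, (C * ((|a x| ^ p + |b x| ^ p) / 2 - |(a x + b x) / 2| ^ p) +
          ε * (|a x| ^ p + |b x| ^ p)) ∂μ :=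
        integral_mono iab ((igap.const_mul C).add (isum.const_mul ε)) fun x => h (a x) (b x)
    _ = _ := by
        rw [integral_add (igap.const_mul C) (isum.const_mul ε), integral_const_mul,
          integral_const_mul, integral_sub (isum.div_const 2) imid, integral_div,
          integral_add ia ib]

lemma Lp_uniformly_convex (hp : 1 < p) (R ε : ℝ) (hε : 0 < ε) [Fact (1 ≤ ENNReal.ofReal p)] :
    ∃ η > 0, ∀ x y : Lp ℝ (ENNReal.ofReal p) μ, ‖x‖ ^ p ≤ R → ‖y‖ ^ p ≤ R → ε ≤ dist x y →
      ‖(1 / 2 : ℝ) • x + (1 / 2 : ℝ) • y‖ ^ p ≤ (‖x‖ ^ p + ‖y‖ ^ p) / 2 - η := by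
  have hp0 : 0 < p := by linarith
  have hεp : 0 < ε ^ p := Real.rpow_pos_of_pos hε p
  have hR : 0 < 2 * |R| + 1 := by positivity
  obtain ⟨C, hC, h⟩ := integral_abs_sub_rpow_le_gap (μ := μ) hp
    (show 0 < ε ^ p / (2 * (2 * |R| + 1)) by positivity)
  -- With the error weight chosen above, the ε-term is at most half of ε^p, so C times the convexity
  -- gap is at least ε^p / 2. The shift C + 1 allows C = 0.
  refine ⟨ε ^ p / (2 * (C + 1)), by positivity, fun x y hx hy hxy => ?_⟩
  have h1 := h x y (Lp.memLp x) (Lp.memLp y)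
  have e1 : ∫ a, |x a - y a| ^ p ∂μ = dist x y ^ p := by
    rw [dist_eq_norm, norm_rpow_Lp_eq_integral hp]
    refine integral_congr_ae ?_
    filter_upwards [Lp.coeFn_sub x y] with a ha
    rw [ha, Pi.sub_apply]
  have e2 : ∫ a, |(x a + y a) / 2| ^ p ∂μ = ‖(1 / 2 : ℝ) • x + (1 / 2 : ℝ) • y‖ ^ p := by
    rw [norm_rpow_Lp_eq_integral hp]
    refine integral_congr_ae ?_
    filter_upwards [Lp.coeFn_add ((1 / 2 : ℝ) • x) ((1 / 2 : ℝ) • y), Lp.coeFn_smul (1 / 2 : ℝ) x,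
      Lp.coeFn_smul (1 / 2 : ℝ) y] with a ha hb hc
    rw [ha, Pi.add_apply, hb, hc, Pi.smul_apply, Pi.smul_apply, smul_eq_mul, smul_eq_mul]
    ring_nf
  rw [e1, e2, ← norm_rpow_Lp_eq_integral hp, ← norm_rpow_Lp_eq_integral hp] at h1
  have h2 : ε ^ p ≤ dist x y ^ p := Real.rpow_le_rpow hε.le hxy hp0.le
  have h3 : ε ^ p / (2 * (2 * |R| + 1)) * (‖x‖ ^ p + ‖y‖ ^ p) ≤ ε ^ p / 2 := by
    have : ‖x‖ ^ p + ‖y‖ ^ p ≤ 2 * |R| + 1 := by linarith [le_abs_self R]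
    calc _ ≤ ε ^ p / (2 * (2 * |R| + 1)) * (2 * |R| + 1) := by gcongr
      _ = ε ^ p / 2 := by field_simp
  set gap := (‖x‖ ^ p + ‖y‖ ^ p) / 2 - ‖(1 / 2 : ℝ) • x + (1 / 2 : ℝ) • y‖ ^ p with hgap
  have h4 : ε ^ p / 2 ≤ C * gap := by linarith
  have hgap0 : 0 ≤ gap := by
    by_contra! hneg
    have := mul_nonpos_of_nonneg_of_nonpos hC hneg.le
    linarith
  have h5 : ε ^ p / (2 * (C + 1)) ≤ gap := by
    rw [div_le_iff₀ (by positivity)]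
    nlinarith
  linarith

/-- Weak compactness of bounded sets in `L^p`, `1 < p < ∞`, along an ultrafilter. -/
lemma exists_weak_limit {ι : Type*} (hpq : p.HolderConjugate q) (l : Ultrafilter ι)
    {g : ι → α → ℝ} (hg : ∀ k, MemLp (g k) (ENNReal.ofReal p) μ) {R : ℝ}
    (hR : ∀ᶠ k in l, ∫ x, |g k x| ^ p ∂μ ≤ R) :
    ∃ g₀, MemLp g₀ (ENNReal.ofReal p) μ ∧ ∀ ψ : α → ℝ, MemLp ψ (ENNReal.ofReal q) μ →
      Tendsto (fun k => ∫ x, ψ x * g k x ∂μ) l (𝓝 (∫ x, ψ x * g₀ x ∂μ)) := by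
  have hp : 1 < p := hpq.lt
  have hp1 : Fact (1 ≤ ENNReal.ofReal p) := ⟨by simpa using hp.le⟩
  have hq1 : Fact (1 ≤ ENNReal.ofReal q) := ⟨by simpa using hpq.symm.lt.le⟩
  have := hpq.symm.ennrealOfReal
  have hxR : ∀ᶠ k in (l : Filter ι), ‖(hg k).toLp (g k)‖ ^ p ≤ R := by
    filter_upwards [hR] with k hk
    rw [norm_rpow_Lp_eq_integral hp]
    refine le_of_eq_of_le (integral_congr_ae ?_) hk
    filter_upwards [(hg k).coeFn_toLp] with a ha
    rw [ha]
  obtain ⟨y, hy⟩ := exists_mem_of_eventually_mem_convex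
    (Φ := fun x : Lp ℝ (ENNReal.ofReal p) μ => ‖x‖ ^ p)
    (fun x => Real.rpow_nonneg (norm_nonneg _) _)
    (fun R ε hε => Lp_uniformly_convex hp R ε hε) (l := (l : Filter ι))
    (x := fun k => (hg k).toLp (g k)) hxR
  refine ⟨y, Lp.memLp y, fun ψ hψ => ?_⟩
  set L : Lp ℝ (ENNReal.ofReal p) μ →L[ℝ] ℝ :=
    (ContinuousLinearMap.mul ℝ ℝ).lpPairing μ (ENNReal.ofReal q) (ENNReal.ofReal p) (hψ.toLp ψ)
    with hL
  have hLapp : ∀ h : Lp ℝ (ENNReal.ofReal p) μ, L h = ∫ x, ψ x * h x ∂μ := fun h => by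
    rw [hL, ContinuousLinearMap.lpPairing_eq_integral]
    refine integral_congr_ae ?_
    filter_upwards [hψ.coeFn_toLp] with a ha
    rw [ha, ContinuousLinearMap.mul_apply']
  have hLg : ∀ k, L ((hg k).toLp (g k)) = ∫ x, ψ x * g k x ∂μ := fun k => by
    rw [hLapp]
    refine integral_congr_ae ?_
    filter_upwards [(hg k).coeFn_toLp] with a ha
    rw [ha]
  have hbound : ∀ᶠ k in (l : Filter ι), ∫ x, ψ x * g k x ∂μ ∈
      Set.Icc (-(‖L‖ * |R| ^ p⁻¹)) (‖L‖ * |R| ^ p⁻¹) := by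
    filter_upwards [hxR] with k hk
    rw [← hLg, Set.mem_Icc, ← abs_le, ← Real.norm_eq_abs]
    refine (L.le_opNorm _).trans ?_
    gcongr
    rw [Real.le_rpow_inv_iff_of_pos (norm_nonneg _) (abs_nonneg _) (by linarith)]
    exact hk.trans (le_abs_self R)
  -- The pairings are bounded, hence converge along the ultrafilter to some c. The preimage of a
  -- closed ball about c under L is closed, convex and eventually contains the sequence, so it
  -- contains y; therefore L y = c.
  obtain ⟨c, -, hc⟩ := (isCompact_Icc (a := -(‖L‖ * |R| ^ p⁻¹))
    (b := ‖L‖ * |R| ^ p⁻¹)).ultrafilter_le_nhds (l.map fun k => ∫ x, ψ x * g k x ∂μ)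
    (le_principal_iff.2 hbound)
  have hc' : Tendsto (fun k => ∫ x, ψ x * g k x ∂μ) l (𝓝 c) := hc
  have hyc : L y = c := by
    refine eq_of_forall_dist_le fun ε hε => ?_
    have hconv : Convex ℝ (L ⁻¹' Metric.closedBall c ε) :=
      (convex_closedBall c ε).is_linear_preimage L.isBoundedLinearMap.toIsLinearMap
    refine hy _ hconv (Metric.isClosed_closedBall.preimage L.continuous) ?_
    filter_upwards [hc'.eventually (Metric.closedBall_mem_nhds c hε)] with k hk
    rwa [Set.mem_preimage, hLg]
  rwa [← hLapp, hyc]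

lemma memLp_signedPow (hpq : p.HolderConjugate q) {g : α → ℝ}
    (hg : MemLp g (ENNReal.ofReal p) μ) :
    MemLp (fun x => signedPow p (g x)) (ENNReal.ofReal q) μ := by
  have hp : 1 < p := hpq.lt
  rw [memLp_iff_lintegral_lt_top hpq.symm.lt
    ((continuous_signedPow hp).comp_aestronglyMeasurable hg.1)]
  refine lt_of_eq_of_lt (lintegral_congr fun x => ?_)
    ((memLp_iff_lintegral_lt_top hp hg.1).1 hg)
  rw [enorm_rpow_eq_ofReal hpq.symm.lt, enorm_rpow_eq_ofReal hp, abs_signedPow hp,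
    ← Real.rpow_mul (abs_nonneg _), hpq.sub_one_mul_conj]

lemma integrable_mul_of_holderConjugate (hpq : p.HolderConjugate q) {f g : α → ℝ}
    (hf : MemLp f (ENNReal.ofReal p) μ) (hg : MemLp g (ENNReal.ofReal q) μ) :
    Integrable (fun x => f x * g x) μ := by
  have := hpq.ennrealOfReal
  exact hf.integrable_mul hg

lemma integrable_signedPow_mul (hp : 1 < p) {f g : α → ℝ} (hf : MemLp f (ENNReal.ofReal p) μ)
    (hg : MemLp g (ENNReal.ofReal p) μ) : Integrable (fun x => signedPow p (f x) * g x) μ :=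
  integrable_mul_of_holderConjugate (Real.HolderConjugate.conjExponent hp).symm
    (memLp_signedPow (Real.HolderConjugate.conjExponent hp) hf) hg

lemma integral_monotonicity_nonneg (hp : 1 < p) {a b : α → ℝ} (ha : MemLp a (ENNReal.ofReal p) μ)
    (hb : MemLp b (ENNReal.ofReal p) μ) :
    0 ≤ ∫ x, signedPow p (a x) * (a x - b x) ∂μ - ∫ x, signedPow p (b x) * (a x - b x) ∂μ := by
  have i1 : Integrable (fun x => signedPow p (a x) * (a x - b x)) μ :=
    integrable_signedPow_mul hp ha (ha.sub hb)
  have i2 : Integrable (fun x => signedPow p (b x) * (a x - b x)) μ :=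
    integrable_signedPow_mul hp hb (ha.sub hb)
  rw [← integral_sub i1 i2]
  refine integral_nonneg fun x => ?_
  simp only [Pi.zero_apply, ← sub_mul]
  exact signedPow_sub_mul_sub_nonneg hp _ _

/-- The constant is chosen before the measure space, because the measures attached to the horizons
vary along the sequence. -/
lemma integral_abs_sub_rpow_le_monotonicity (hp : 1 < p) {ε : ℝ} (hε : 0 < ε) :
    ∃ C, 0 ≤ C ∧ ∀ {α : Type} [MeasurableSpace α] (μ : Measure α) (a b : α → ℝ),
      MemLp a (ENNReal.ofReal p) μ → MemLp b (ENNReal.ofReal p) μ →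
      ∫ x, |a x - b x| ^ p ∂μ ≤ C * (∫ x, signedPow p (a x) * (a x - b x) ∂μ -
        ∫ x, signedPow p (b x) * (a x - b x) ∂μ) +
        ε * (∫ x, |a x| ^ p ∂μ + ∫ x, |b x| ^ p ∂μ) := by
  obtain ⟨C, hC, h⟩ := abs_sub_rpow_le_monotonicity hp hε
  refine ⟨C, hC, fun μ a b ha hb => ?_⟩
  have ia := integrable_abs_rpow hp ha
  have ib := integrable_abs_rpow hp hb
  have isum : Integrable (fun x => |a x| ^ p + |b x| ^ p) μ := ia.add ib
  have i1 : Integrable (fun x => signedPow p (a x) * (a x - b x)) μ :=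
    integrable_signedPow_mul hp ha (ha.sub hb)
  have i2 : Integrable (fun x => signedPow p (b x) * (a x - b x)) μ :=
    integrable_signedPow_mul hp hb (ha.sub hb)
  have i3 : Integrable (fun x => (signedPow p (a x) - signedPow p (b x)) * (a x - b x)) μ :=
    (i1.sub i2).congr (Eventually.of_forall fun x => by simp only [Pi.sub_apply, sub_mul])
  calc ∫ x, |a x - b x| ^ p ∂μ
      ≤ ∫ x, (C * ((signedPow p (a x) - signedPow p (b x)) * (a x - b x)) +
          ε * (|a x| ^ p + |b x| ^ p)) ∂μ :=
        integral_mono (integrable_abs_rpow hp (ha.sub hb))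
          ((i3.const_mul C).add (isum.const_mul ε)) fun x => h (a x) (b x)
    _ = _ := by
        rw [integral_add (i3.const_mul C) (isum.const_mul ε), integral_const_mul,
          integral_const_mul, ← integral_sub i1 i2, integral_add ia ib]
        simp only [sub_mul]

lemma abs_integral_signedPow_sub_le (hp : 1 < p) {ε : ℝ} (hε : 0 < ε) :
    ∃ C, 0 ≤ C ∧ ∀ {α : Type} [MeasurableSpace α] (μ : Measure α) (a b r : α → ℝ),
      MemLp a (ENNReal.ofReal p) μ → MemLp b (ENNReal.ofReal p) μ →
      MemLp r (ENNReal.ofReal p) μ →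
      |∫ x, signedPow p (a x) * r x ∂μ - ∫ x, signedPow p (b x) * r x ∂μ| ≤
        C * ∫ x, |a x - b x| ^ p ∂μ +
        ε * (∫ x, |a x| ^ p ∂μ + ∫ x, |b x| ^ p ∂μ + ∫ x, |r x| ^ p ∂μ) := by
  obtain ⟨C, hC, h⟩ := abs_signedPow_sub_mul_le hp hε
  refine ⟨C, hC, fun μ a b r ha hb hr => ?_⟩
  have ia := integrable_abs_rpow hp ha
  have ib := integrable_abs_rpow hp hb
  have ir := integrable_abs_rpow hp hr
  have isum2 : Integrable (fun x => |a x| ^ p + |b x| ^ p) μ := ia.add ib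
  have isum : Integrable (fun x => |a x| ^ p + |b x| ^ p + |r x| ^ p) μ := isum2.add ir
  have iab : Integrable (fun x => |a x - b x| ^ p) μ := integrable_abs_rpow hp (ha.sub hb)
  have i1 := integrable_signedPow_mul hp ha hr
  have i2 := integrable_signedPow_mul hp hb hr
  rw [← integral_sub i1 i2]
  refine abs_integral_le_integral_abs.trans ?_
  calc ∫ x, |signedPow p (a x) * r x - signedPow p (b x) * r x| ∂μ
      ≤ ∫ x, (C * |a x - b x| ^ p + ε * (|a x| ^ p + |b x| ^ p + |r x| ^ p)) ∂μ := by
        refine integral_mono (i1.sub i2).abs ((iab.const_mul C).add (isum.const_mul ε))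
          fun x => ?_
        simp only [← sub_mul]
        exact h (a x) (b x) (r x)
    _ = _ := by
        rw [integral_add (iab.const_mul C) (isum.const_mul ε), integral_const_mul,
          integral_const_mul, integral_add isum2 ir, integral_add ia ib]

end LpSpaces

/-! ### A level-set estimate for anisotropic Gagliardo energies. -/

/-- The `p`-th power of the `L^p` norm of the increment of step `h` in the direction `eᵢ`. -/
def incrEnergy {n : ℕ} (i : Fin n) (p : ℝ) (u : EuclideanSpace ℝ (Fin n) → ℝ) (h : ℝ) : ℝ≥0∞ :=
  ∫⁻ x, ‖incr i u x h‖ₑ ^ p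

/-- The full (one-sided) Gagliardo energy in the direction `eᵢ`. -/
def halfEnergy {n : ℕ} (i : Fin n) (s p : ℝ) (u : EuclideanSpace ℝ (Fin n) → ℝ) : ℝ≥0∞ :=
  ∫⁻ h in Set.Ioi (0 : ℝ), incrEnergy i p u h * ENNReal.ofReal (h ^ (-(1 + s * p)))

section Sobolev

variable {n : ℕ}

/-- The vector whose first `j` coordinates are those of `h`, the others being zero. -/
def partialShift (h : Fin n → ℝ) (j : ℕ) : EuclideanSpace ℝ (Fin n) :=
  WithLp.toLp 2 fun i => if (i : ℕ) < j then h i else 0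

lemma partialShift_zero (h : Fin n → ℝ) : partialShift h 0 = 0 := by
  ext i
  simp [partialShift]

lemma partialShift_self (h : Fin n → ℝ) : partialShift h n = WithLp.toLp 2 h := by
  ext i
  simp [partialShift]

lemma partialShift_succ (h : Fin n → ℝ) (i : Fin n) :
    partialShift h (i + 1) = partialShift h i + h i • EuclideanSpace.single i (1 : ℝ) := by
  ext j
  simp only [partialShift, PiLp.add_apply, PiLp.smul_apply, PiLp.single_apply,
    smul_eq_mul]
  rcases lt_trichotomy (j : ℕ) i with hj | hj | hj
  · have : j ≠ i := fun hh => by simp [hh] at hj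
    simp [this, hj, Nat.lt_succ_of_lt hj]
  · have : j = i := Fin.ext hj
    subst this
    simp
  · have : j ≠ i := fun hh => by simp [hh] at hj
    have h1 : ¬ (j : ℕ) < i + 1 := by omega
    have h2 : ¬ (j : ℕ) < i := by omega
    simp [this, h1, h2]

/-- The displacement by h is travelled one coordinate at a time, so the total jump is the sum of n
coordinate increments and they cannot all be smaller than c / n. -/
lemma exists_le_abs_incr (hn : 0 < n) (v : EuclideanSpace ℝ (Fin n) → ℝ)
    (x : EuclideanSpace ℝ (Fin n)) (h : Fin n → ℝ) {c : ℝ}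
    (hc : c ≤ |v (x + WithLp.toLp 2 h) - v x|) :
    ∃ i, c / n ≤ |incr i v (x + partialShift h i) (h i)| := by
  by_contra! hlt
  have hn' : (0 : ℝ) < n := by exact_mod_cast hn
  have htel : v (x + WithLp.toLp 2 h) - v x =
      ∑ i : Fin n, incr i v (x + partialShift h i) (h i) := by
    have h1 := Finset.sum_range_sub (fun j => v (x + partialShift h j)) n
    rw [partialShift_zero, partialShift_self, add_zero] at h1
    rw [← h1, ← Fin.sum_univ_eq_sum_range
      (fun j => v (x + partialShift h (j + 1)) - v (x + partialShift h j))]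
    refine Finset.sum_congr rfl fun i _ => ?_
    rw [partialShift_succ, incr, add_assoc]
  have : |v (x + WithLp.toLp 2 h) - v x| < ∑ _i : Fin n, c / n := by
    rw [htel]
    refine (Finset.abs_sum_le_sum_abs _ _).trans_lt (Finset.sum_lt_sum_of_nonempty ?_ ?_)
    · have := Fin.pos_iff_nonempty.1 hn
      exact Finset.univ_nonempty
    · exact fun i _ => hlt i
  rw [Finset.sum_const, Finset.card_univ, Fintype.card_fin, nsmul_eq_mul,
    mul_div_cancel₀ _ hn'.ne'] at this
  linarith

lemma measurable_incr_prod (i : Fin n) {u : EuclideanSpace ℝ (Fin n) → ℝ} (hu : Measurable u) :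
    Measurable fun z : EuclideanSpace ℝ (Fin n) × ℝ => incr i u z.1 z.2 := by
  unfold incr
  exact (hu.comp (by fun_prop)).sub (hu.comp measurable_fst)

lemma measurable_incr (i : Fin n) {u : EuclideanSpace ℝ (Fin n) → ℝ} (hu : Measurable u) (h : ℝ) :
    Measurable fun x => incr i u x h :=
  (measurable_incr_prod i hu).comp (measurable_id.prodMk measurable_const)

lemma measurable_incrEnergy (i : Fin n) (p : ℝ) {u : EuclideanSpace ℝ (Fin n) → ℝ}
    (hu : Measurable u) : Measurable (incrEnergy i p u) :=
  Measurable.lintegral_prod_left' (f := fun z : EuclideanSpace ℝ (Fin n) × ℝ =>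
    ‖incr i u z.1 z.2‖ₑ ^ p) ((measurable_incr_prod i hu).enorm.pow_const p)

/-- Markov's inequality. Translation invariance removes y, so the intermediate points of a
coordinate path do not matter. -/
lemma volume_le_abs_incr_le (i : Fin n) {p : ℝ} (hp : 0 < p) {u : EuclideanSpace ℝ (Fin n) → ℝ}
    (hu : Measurable u) {c : ℝ} (hc : 0 < c) (y : EuclideanSpace ℝ (Fin n)) (h : ℝ) :
    volume {x | c ≤ |incr i u (x + y) h|} ≤ ENNReal.ofReal (c ^ (-p)) * incrEnergy i p u h := by
  have h1 : {x | c ≤ |incr i u (x + y) h|} ⊆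
      {x | ENNReal.ofReal (c ^ p) ≤ ‖incr i u (x + y) h‖ₑ ^ p} := by
    intro x hx
    have hx' : c ≤ |incr i u (x + y) h| := hx
    have : ENNReal.ofReal (c ^ p) ≤ ‖incr i u (x + y) h‖ₑ ^ p := by
      rw [← ENNReal.ofReal_rpow_of_pos hc, ← ofReal_norm, Real.norm_eq_abs]
      gcongr
    exact this
  have hcp : 0 < c ^ p := Real.rpow_pos_of_pos hc p
  refine (measure_mono h1).trans ((meas_ge_le_lintegral_div ?_ ?_ ?_).trans ?_)
  · exact (((measurable_incr i hu h).comp (measurable_add_const y)).enorm.pow_const p).aemeasurable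
  · simpa using hcp
  · exact ENNReal.ofReal_ne_top
  · rw [lintegral_add_right_eq_self (fun x => ‖incr i u x h‖ₑ ^ p) y, ENNReal.div_eq_inv_mul,
      ← ENNReal.ofReal_inv_of_pos hcp, ← Real.rpow_neg hc.le]
    rfl

lemma setLIntegral_incrEnergy_le (i : Fin n) {s p : ℝ} (hs : 0 < s) (hp : 0 < p)
    (u : EuclideanSpace ℝ (Fin n) → ℝ) {r : ℝ} :
    ∫⁻ h in Set.Ioc 0 r, incrEnergy i p u h ≤
      ENNReal.ofReal (r ^ (1 + s * p)) * halfEnergy i s p u := by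
  have hsp : 0 < 1 + s * p := by positivity
  calc ∫⁻ h in Set.Ioc 0 r, incrEnergy i p u h
      ≤ ∫⁻ h in Set.Ioc 0 r, ENNReal.ofReal (r ^ (1 + s * p)) *
          (incrEnergy i p u h * ENNReal.ofReal (h ^ (-(1 + s * p)))) := by
        refine setLIntegral_mono' measurableSet_Ioc fun h hh => ?_
        rw [mul_left_comm, ← ENNReal.ofReal_mul (Real.rpow_nonneg (hh.1.le.trans hh.2) _)]
        refine le_mul_of_one_le_right' ?_
        rw [ENNReal.one_le_ofReal, Real.rpow_neg hh.1.le, ← div_eq_mul_inv,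
          one_le_div (Real.rpow_pos_of_pos hh.1 _)]
        exact Real.rpow_le_rpow hh.1.le hh.2 hsp.le
    _ = ENNReal.ofReal (r ^ (1 + s * p)) * ∫⁻ h in Set.Ioc 0 r,
          (incrEnergy i p u h * ENNReal.ofReal (h ^ (-(1 + s * p)))) :=
        lintegral_const_mul' _ _ ENNReal.ofReal_ne_top
    _ ≤ _ := by
        gcongr
        exact lintegral_mono_set Set.Ioc_subset_Ioi_self

/-- The measure of the set where `v` is equal to `c` is controlled by the measure of its support
and by its Gagliardo energies. -/
lemma volume_eq_const_le (hn : 0 < n) {s p : Fin n → ℝ} (hs : ∀ i, 0 < s i) (hp : ∀ i, 1 < p i)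
    {κ τ : ℝ} (hκ : κ = ∑ i, 1 / (s i * p i)) (hτ : τ = ∑ i, 1 / s i)
    {v : EuclideanSpace ℝ (Fin n) → ℝ} (hv : Measurable v) {c a : ℝ} (hc : 0 < c) (ha : 0 < a)
    (hsupp : volume {x | v x ≠ 0} ≤ ENNReal.ofReal a) {e : ℝ≥0∞}
    (he : ∀ i, halfEnergy i (s i) (p i) v ≤ e) :
    volume {x | v x = c} ≤
      ENNReal.ofReal ((∑ i, (n : ℝ) ^ p i) * 2 * (2 * a * c ^ (-τ)) ^ κ⁻¹) * e := by
  have hne : Nonempty (Fin n) := Fin.pos_iff_nonempty.1 hn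
  have hn' : (0 : ℝ) < n := by exact_mod_cast hn
  have hκ0 : 0 < κ := by
    rw [hκ]
    refine Finset.sum_pos (fun i _ => ?_) Finset.univ_nonempty
    have := hs i
    have := hp i
    positivity
  -- Steps are averaged over the box with sides r i. The condition r i ^ (s i * p i) = b * c ^ p i
  -- removes c from every directional bound except through b, and b is fixed by requiring the volume
  -- b^κ c^τ of the box to be 2a.
  set b : ℝ := (2 * a * c ^ (-τ)) ^ κ⁻¹ with hb
  have hc' : 0 < c ^ (-τ) := Real.rpow_pos_of_pos hc _
  have hb0 : 0 < b := Real.rpow_pos_of_pos (by positivity) _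
  set r : Fin n → ℝ := fun i => (b * c ^ p i) ^ (1 / (s i * p i)) with hr
  have hbc : ∀ i, 0 < b * c ^ p i := fun i => mul_pos hb0 (Real.rpow_pos_of_pos hc _)
  have hr0 : ∀ i, 0 < r i := fun i => Real.rpow_pos_of_pos (hbc i) _
  have hrpow : ∀ i, r i ^ (s i * p i) = b * c ^ p i := fun i => by
    have h1 := hs i
    have h2 := hp i
    have h3 : s i * p i ≠ 0 := by positivity
    rw [hr]
    dsimp only
    rw [← Real.rpow_mul (hbc i).le, one_div, inv_mul_cancel₀ h3, Real.rpow_one]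
  have hprod : ∏ i, r i = 2 * a := by
    have h1 : ∀ i, r i = b ^ (1 / (s i * p i)) * c ^ (1 / s i) := fun i => by
      have h1 := hs i
      have h2 := hp i
      rw [hr]
      dsimp only
      rw [Real.mul_rpow hb0.le (Real.rpow_nonneg hc.le _), ← Real.rpow_mul hc.le]
      congr 2
      field_simp
    rw [Finset.prod_congr rfl fun i _ => h1 i, Finset.prod_mul_distrib, ← Real.rpow_sum_of_pos hb0,
      ← Real.rpow_sum_of_pos hc, ← hκ, ← hτ, hb, ← Real.rpow_mul (by positivity),
      inv_mul_cancel₀ hκ0.ne', Real.rpow_one, mul_assoc, ← Real.rpow_add hc, neg_add_cancel,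
      Real.rpow_zero, mul_one]
  set ρ : Measure (Fin n → ℝ) := Measure.pi fun i => volume.restrict (Set.Ioc 0 (r i)) with hρ
  have hρle : ρ ≤ volume := by
    rw [hρ, ← Measure.restrict_pi_pi]
    exact Measure.restrict_le_self
  have hρuniv : ρ Set.univ = ENNReal.ofReal (2 * a) := by
    rw [hρ, Measure.pi_univ]
    simp only [Measure.restrict_apply_univ, Real.volume_Ioc, sub_zero]
    rw [← ENNReal.ofReal_prod_of_nonneg fun i _ => (hr0 i).le, hprod]
  set T : Set (EuclideanSpace ℝ (Fin n) × (Fin n → ℝ)) :=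
    {z | v z.1 = c ∧ v (z.1 + WithLp.toLp 2 z.2) = 0} with hT
  have hTm : MeasurableSet T := by
    refine MeasurableSet.inter ?_ ?_
    · exact (hv.comp measurable_fst) (measurableSet_singleton c)
    · refine (hv.comp (measurable_fst.add ?_)) (measurableSet_singleton 0)
      exact (WithLp.measurable_toLp 2 _).comp measurable_snd
  -- From a point where v = c, at most half of the box (measure a out of 2a) leads into the support
  -- of v, so steps of measure at least a lead to the zero set.
  have hlow : ENNReal.ofReal a * volume {x | v x = c} ≤ (volume.prod ρ) T := by
    rw [Measure.prod_apply hTm]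
    calc ENNReal.ofReal a * volume {x | v x = c}
        = ∫⁻ _x in {x | v x = c}, ENNReal.ofReal a := by rw [setLIntegral_const]
      _ ≤ ∫⁻ x in {x | v x = c}, ρ (Prod.mk x ⁻¹' T) := by
          refine setLIntegral_mono' (hv (measurableSet_singleton c)) fun x hx => ?_
          have hx' : v x = c := hx
          have hmp : MeasurePreserving (fun h : Fin n → ℝ => x + WithLp.toLp 2 h) :=
            (measurePreserving_add_left volume x).comp (PiLp.volume_preserving_toLp (Fin n))
          have h1 : ρ {h | v (x + WithLp.toLp 2 h) ≠ 0} ≤ ENNReal.ofReal a := by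
            refine (hρle _).trans (le_trans (le_of_eq ?_) hsupp)
            exact hmp.measure_preimage
              (hv (measurableSet_singleton 0).compl).nullMeasurableSet
          have h2 : Prod.mk x ⁻¹' T = {h | v (x + WithLp.toLp 2 h) = 0} := by
            ext h
            simp [hT, hx']
          rw [h2]
          refine ENNReal.le_of_add_le_add_right (ENNReal.ofReal_ne_top (r := a)) ?_
          calc ENNReal.ofReal a + ENNReal.ofReal a = ρ Set.univ := by
                rw [hρuniv, ← ENNReal.ofReal_add ha.le ha.le, two_mul]
            _ ≤ ρ {h | v (x + WithLp.toLp 2 h) = 0} + ρ {h | v (x + WithLp.toLp 2 h) ≠ 0} := by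
                refine le_trans (measure_mono fun h _ => ?_) (measure_union_le _ _)
                exact em _
            _ ≤ _ := by gcongr
      _ ≤ _ := setLIntegral_le_lintegral _ _
  -- On T the function drops from c to 0, so some coordinate increment is at least c / n; Markov's
  -- inequality is then integrated over the box.
  have hup : (volume.prod ρ) T ≤
      ∑ i, ENNReal.ofReal ((n : ℝ) ^ p i * (2 * a) * b) * e := by
    rw [Measure.prod_apply_symm hTm]
    have h1 : ∀ h : Fin n → ℝ, volume ((fun x => (x, h)) ⁻¹' T) ≤
        ∑ i, ENNReal.ofReal ((c / n) ^ (-p i)) * incrEnergy i (p i) v (h i) := fun h => by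
      have h2 : (fun x => (x, h)) ⁻¹' T ⊆
          ⋃ i, {x | c / n ≤ |incr i v (x + partialShift h i) (h i)|} := by
        intro x hx
        have hx1 : v x = c := hx.1
        have hx2 : v (x + WithLp.toLp 2 h) = 0 := hx.2
        have : c ≤ |v (x + WithLp.toLp 2 h) - v x| := by
          rw [hx1, hx2, zero_sub, abs_neg]
          exact le_abs_self c
        obtain ⟨i, hi⟩ := exists_le_abs_incr hn v x h this
        exact Set.mem_iUnion.2 ⟨i, hi⟩
      refine (measure_mono h2).trans ((measure_iUnion_fintype_le _ _).trans ?_)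
      exact Finset.sum_le_sum fun i _ =>
        volume_le_abs_incr_le i (zero_lt_one.trans (hp i)) hv (by positivity) _ _
    refine (lintegral_mono h1).trans ?_
    rw [lintegral_finsetSum']
    · refine Finset.sum_le_sum fun i _ => ?_
      have hm := measurable_incrEnergy i (p i) hv
      have hpi0 : 0 < p i := zero_lt_one.trans (hp i)
      have h3 : ∫⁻ h, incrEnergy i (p i) v (h i) ∂ρ =
          (∏ j ∈ Finset.univ.erase i, ENNReal.ofReal (r j)) *
            ∫⁻ t in Set.Ioc 0 (r i), incrEnergy i (p i) v t := by
        have hmap := lintegral_map (μ := ρ) hm (measurable_pi_apply i)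
        have heval : (fun h : Fin n → ℝ => h i) = Function.eval i := rfl
        rw [← hmap, hρ, heval, Measure.pi_map_eval, lintegral_smul_measure]
        simp
      rw [lintegral_const_mul' _ _ ENNReal.ofReal_ne_top, h3]
      calc ENNReal.ofReal ((c / n) ^ (-p i)) * ((∏ j ∈ Finset.univ.erase i, ENNReal.ofReal (r j)) *
            ∫⁻ t in Set.Ioc 0 (r i), incrEnergy i (p i) v t)
          ≤ ENNReal.ofReal ((c / n) ^ (-p i)) * ((∏ j ∈ Finset.univ.erase i, ENNReal.ofReal (r j)) *
            (ENNReal.ofReal (r i ^ (1 + s i * p i)) * e)) := by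
            gcongr
            refine (setLIntegral_incrEnergy_le i (hs i) hpi0 v).trans ?_
            gcongr
            exact he i
        _ = ENNReal.ofReal ((c / n) ^ (-p i) * ((∏ j ∈ Finset.univ.erase i, r j) *
            r i ^ (1 + s i * p i))) * e := by
            have hrn : 0 ≤ ∏ j ∈ Finset.univ.erase i, r j :=
              Finset.prod_nonneg fun j _ => (hr0 j).le
            rw [ENNReal.ofReal_mul (by positivity), ENNReal.ofReal_mul hrn,
              ENNReal.ofReal_prod_of_nonneg fun j _ => (hr0 j).le]
            ring
        _ = ENNReal.ofReal ((n : ℝ) ^ p i * (2 * a) * b) * e := by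
            congr 2
            rw [Real.rpow_add (hr0 i), Real.rpow_one, hrpow, ← mul_assoc (∏ j ∈ _, _),
              Finset.prod_erase_mul _ _ (Finset.mem_univ i), hprod,
              Real.div_rpow hc.le hn'.le, Real.rpow_neg hc.le, Real.rpow_neg hn'.le]
            have := Real.rpow_pos_of_pos hc (p i)
            have := Real.rpow_pos_of_pos hn' (p i)
            field_simp
    · intro i _
      exact (((measurable_incrEnergy i (p i) hv).comp (measurable_pi_apply i)).const_mul
        _).aemeasurable
  have hfin := hlow.trans hup
  have ha' : ENNReal.ofReal a ≠ 0 := by simpa using ha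
  rw [← ENNReal.mul_le_mul_iff_right ha' ENNReal.ofReal_ne_top]
  refine hfin.trans (le_of_eq ?_)
  rw [← Finset.sum_mul, ← ENNReal.ofReal_sum_of_nonneg fun i _ => by positivity, ← mul_assoc,
    ← ENNReal.ofReal_mul ha.le]
  congr 2
  rw [← Finset.sum_mul, ← Finset.sum_mul]
  ring

end Sobolev

/-! ### The critical Sobolev inequality by dyadic truncation. -/

section Sobolev

variable {n : ℕ}

/-- The dyadic truncation of `|t|` between the levels `c` and `2c`. -/
def dyadicTrunc (c t : ℝ) : ℝ := min |t| (2 * c) - min |t| c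

lemma continuous_dyadicTrunc (c : ℝ) : Continuous (dyadicTrunc c) := by
  unfold dyadicTrunc
  fun_prop

lemma dyadicTrunc_of_le {c t : ℝ} (hc : 0 < c) (h : 2 * c ≤ |t|) : dyadicTrunc c t = c := by
  rw [dyadicTrunc, min_eq_right h, min_eq_right (by linarith)]
  ring

lemma le_abs_of_dyadicTrunc_ne_zero {c t : ℝ} (hc : 0 < c) (h : dyadicTrunc c t ≠ 0) :
    c ≤ |t| := by
  by_contra! hlt
  apply h
  rw [dyadicTrunc, min_eq_left hlt.le, min_eq_left (by linarith), sub_self]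

lemma dyadicTrunc_mono {c a b : ℝ} (hc : 0 < c) (hab : |b| ≤ |a|) :
    dyadicTrunc c b ≤ dyadicTrunc c a := by
  unfold dyadicTrunc
  grind

/-- For |b| ≤ |a| each truncation is ordered, so the absolute values disappear; over consecutive
levels the sum telescopes, and what remains is at most |a| - |b|. -/
lemma sum_abs_dyadicTrunc_sub_le (F : Finset ℤ) (a b : ℝ) :
    ∑ k ∈ F, |dyadicTrunc (2 ^ k) a - dyadicTrunc (2 ^ k) b| ≤ |a - b| := by
  wlog hab : |b| ≤ |a| generalizing a b
  · have := this b a (le_of_not_ge hab)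
    simpa only [abs_sub_comm] using this
  have hpos : ∀ k : ℤ, (0 : ℝ) < 2 ^ k := fun k => zpow_pos two_pos k
  obtain ⟨N, hN⟩ : ∃ N : ℕ, ∀ k ∈ F, k.natAbs < N :=
    ⟨F.sup Int.natAbs + 1, fun k hk => Nat.lt_succ_of_le (Finset.le_sup (f := Int.natAbs) hk)⟩
  have hinj : Function.Injective fun j : ℕ => (j : ℤ) - N := fun i j h => by
    simpa using h
  have hsub : F ⊆ (Finset.range (2 * N)).map ⟨fun j : ℕ => (j : ℤ) - N, hinj⟩ := by
    intro k hk
    have := hN k hk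
    simp only [Finset.mem_map, Finset.mem_range, Function.Embedding.coeFn_mk]
    exact ⟨(k + N).toNat, by omega, by omega⟩
  refine (Finset.sum_le_sum_of_subset_of_nonneg hsub fun _ _ _ => abs_nonneg _).trans ?_
  rw [Finset.sum_map]
  have hz : ∀ j : ℕ, (2 : ℝ) * 2 ^ ((j : ℤ) - N) = 2 ^ (((j + 1 : ℕ) : ℤ) - N) := fun j => by
    rw [← zpow_one_add₀ two_ne_zero]
    congr 1
    push_cast
    ring
  set G : ℕ → ℝ := fun j => min |a| (2 ^ ((j : ℤ) - N)) - min |b| (2 ^ ((j : ℤ) - N)) with hG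
  have h1 : ∀ j : ℕ, |dyadicTrunc (2 ^ ((j : ℤ) - N)) a - dyadicTrunc (2 ^ ((j : ℤ) - N)) b| =
      G (j + 1) - G j := fun j => by
    rw [abs_of_nonneg (sub_nonneg.2 (dyadicTrunc_mono (hpos _) hab)), dyadicTrunc, dyadicTrunc,
      hz, hG]
    ring
  simp only [Function.Embedding.coeFn_mk]
  rw [Finset.sum_congr rfl fun j _ => h1 j, Finset.sum_range_sub]
  have h2 : 0 ≤ G 0 := sub_nonneg.2 (min_le_min hab le_rfl)
  have h3 : G (2 * N) ≤ |a| - |b| := by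
    rw [hG]
    dsimp only
    grind
  linarith [abs_sub_abs_le_abs_sub a b]

/-- Nonnegative numbers with sum at most A satisfy ∑ x_k^p ≤ A^(p-1) ∑ x_k ≤ A^p. -/
lemma tsum_enorm_dyadicTrunc_sub_rpow_le {p : ℝ} (hp : 1 < p) (a b : ℝ) :
    ∑' k : ℤ, ‖dyadicTrunc (2 ^ k) a - dyadicTrunc (2 ^ k) b‖ₑ ^ p ≤ ‖a - b‖ₑ ^ p := by
  rw [ENNReal.tsum_eq_iSup_sum]
  refine iSup_le fun F => ?_
  simp only [enorm_rpow_eq_ofReal hp]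
  rw [← ENNReal.ofReal_sum_of_nonneg fun _ _ => Real.rpow_nonneg (abs_nonneg _) _]
  refine ENNReal.ofReal_le_ofReal ?_
  have hsum := sum_abs_dyadicTrunc_sub_le F a b
  have hsplit : ∀ t : ℝ, 0 ≤ t → t ^ p = t ^ (p - 1) * t := fun t ht => by
    rw [← Real.rpow_add_one' ht (by linarith), sub_add_cancel]
  calc ∑ k ∈ F, |dyadicTrunc (2 ^ k) a - dyadicTrunc (2 ^ k) b| ^ p
      ≤ ∑ k ∈ F, |a - b| ^ (p - 1) * |dyadicTrunc (2 ^ k) a - dyadicTrunc (2 ^ k) b| := by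
        refine Finset.sum_le_sum fun k hk => ?_
        rw [hsplit _ (abs_nonneg _)]
        refine mul_le_mul_of_nonneg_right ?_ (abs_nonneg _)
        refine Real.rpow_le_rpow (abs_nonneg _) (le_trans ?_ hsum) (by linarith)
        exact Finset.single_le_sum
          (f := fun k : ℤ => |dyadicTrunc (2 ^ k) a - dyadicTrunc (2 ^ k) b|)
          (fun _ _ => abs_nonneg _) hk
    _ ≤ |a - b| ^ (p - 1) * |a - b| := by
        rw [← Finset.mul_sum]
        exact mul_le_mul_of_nonneg_left hsum (Real.rpow_nonneg (abs_nonneg _) _)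
    _ = |a - b| ^ p := (hsplit _ (abs_nonneg _)).symm

lemma halfEnergy_comp_le (i : Fin n) (s : ℝ) {p : ℝ} (hp : 0 < p) {φ : ℝ → ℝ}
    (hφ : ∀ a b, |φ a - φ b| ≤ |a - b|) (u : EuclideanSpace ℝ (Fin n) → ℝ) :
    halfEnergy i s p (fun x => φ (u x)) ≤ halfEnergy i s p u := by
  unfold halfEnergy incrEnergy
  gcongr with h x
  rw [enorm_le_iff_norm_le]
  exact hφ _ _

lemma tsum_halfEnergy_dyadicTrunc_le (i : Fin n) (s : ℝ) {p : ℝ} (hp : 1 < p)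
    {u : EuclideanSpace ℝ (Fin n) → ℝ} (hu : Measurable u) :
    ∑' k : ℤ, halfEnergy i s p (fun x => dyadicTrunc (2 ^ k) (u x)) ≤ halfEnergy i s p u := by
  have hm : ∀ k : ℤ, Measurable fun x => dyadicTrunc (2 ^ k) (u x) := fun k =>
    (continuous_dyadicTrunc _).measurable.comp hu
  unfold halfEnergy
  have hm' : ∀ k : ℤ, Measurable fun h =>
      incrEnergy i p (fun x => dyadicTrunc (2 ^ k) (u x)) h * ENNReal.ofReal (h ^ (-(1 + s * p))) :=
    fun k => (measurable_incrEnergy i p (hm k)).mul (by fun_prop)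
  rw [← lintegral_tsum fun k => (hm' k).aemeasurable]
  refine lintegral_mono fun h => ?_
  rw [ENNReal.tsum_mul_right]
  gcongr
  unfold incrEnergy
  rw [← lintegral_tsum fun k => ((measurable_incr i (hm k) h).enorm.pow_const p).aemeasurable]
  exact lintegral_mono fun x => tsum_enorm_dyadicTrunc_sub_rpow_le hp _ _

/-- Maz'ya's truncation: the level-set estimate is applied to each dyadic piece, and the energies of
the pieces sum to at most that of u. The integral I reappears on the right with the power 1/κ < 1
and is absorbed; this is where its finiteness enters. -/
lemma lintegral_rpow_le_of_bounded (hn : 0 < n) {s p : Fin n → ℝ} (hs : ∀ i, 0 < s i)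
    (hp : ∀ i, 1 < p i) {κ τ P : ℝ} (hκ : κ = ∑ i, 1 / (s i * p i)) (hτ : τ = ∑ i, 1 / s i)
    (hκ1 : 1 < κ) (hP : P = τ / (κ - 1)) (hP1 : 1 < P) {u : EuclideanSpace ℝ (Fin n) → ℝ}
    (hu : Measurable u) (hfin : ∫⁻ x, ‖u x‖ₑ ^ P < ⊤) {M : ℝ} (hM : 0 ≤ M)
    (he : ∀ i, halfEnergy i (s i) (p i) u ≤ ENNReal.ofReal M) :
    ∫⁻ x, ‖u x‖ₑ ^ P ≤ ENNReal.ofReal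
      (((4 : ℝ) ^ P * ((∑ i, (n : ℝ) ^ p i) * 2) * 2 ^ κ⁻¹ * n * M) ^ (κ / (κ - 1))) := by
  have hκ0 : 0 < κ := by linarith
  set I := ∫⁻ x, ‖u x‖ₑ ^ P with hI
  obtain ⟨Sr, hSr, hIS⟩ : ∃ Sr : ℝ, 0 ≤ Sr ∧ I = ENNReal.ofReal Sr :=
    ⟨I.toReal, ENNReal.toReal_nonneg, (ENNReal.ofReal_toReal hfin.ne).symm⟩
  rcases hSr.eq_or_lt with h0 | hS0
  · rw [hIS, ← h0, ENNReal.ofReal_zero]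
    exact zero_le
  have hpos : ∀ k : ℤ, (0 : ℝ) < 2 ^ k := fun k => zpow_pos two_pos k
  have hK0 : 0 ≤ (∑ i, (n : ℝ) ^ p i) * 2 :=
    mul_nonneg (Finset.sum_nonneg fun i _ => Real.rpow_nonneg (Nat.cast_nonneg n) _) zero_le_two
  set K : ℝ := (∑ i, (n : ℝ) ^ p i) * 2 with hK
  clear_value K
  set e : ℤ → ℝ≥0∞ := fun k =>
    ∑ i, halfEnergy i (s i) (p i) (fun x => dyadicTrunc (2 ^ k) (u x)) with hedef
  have hlevel : ∀ k : ℤ, ENNReal.ofReal ((4 * 2 ^ k : ℝ) ^ P) *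
      volume {x | dyadicTrunc (2 ^ k) (u x) = 2 ^ k} ≤
      ENNReal.ofReal (4 ^ P * K * (2 * Sr) ^ κ⁻¹) * e k := fun k => by
    set c : ℝ := 2 ^ k with hc
    have hc0 : 0 < c := hpos k
    have hcP : 0 < c ^ (-P) := Real.rpow_pos_of_pos hc0 _
    have hsupp : volume {x | dyadicTrunc c (u x) ≠ 0} ≤ ENNReal.ofReal (Sr * c ^ (-P)) := by
      have hsub : {x | dyadicTrunc c (u x) ≠ 0} ⊆ {x | ENNReal.ofReal (c ^ P) ≤ ‖u x‖ₑ ^ P} := by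
        intro x hx
        have h1 := le_abs_of_dyadicTrunc_ne_zero hc0 hx
        have : ENNReal.ofReal (c ^ P) ≤ ‖u x‖ₑ ^ P := by
          rw [enorm_rpow_eq_ofReal hP1]
          exact ENNReal.ofReal_le_ofReal (Real.rpow_le_rpow hc0.le h1 (by linarith))
        exact this
      have hcP' : 0 < c ^ P := Real.rpow_pos_of_pos hc0 _
      refine (measure_mono hsub).trans ((meas_ge_le_lintegral_div
        (hu.enorm.pow_const P).aemeasurable (by simpa using hcP') ENNReal.ofReal_ne_top).trans
        (le_of_eq ?_))
      rw [← hI, hIS, ← ENNReal.ofReal_div_of_pos hcP', Real.rpow_neg hc0.le, div_eq_mul_inv]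
    have h1 := volume_eq_const_le hn hs hp hκ hτ
      ((continuous_dyadicTrunc c).measurable.comp hu) hc0 (mul_pos hS0 hcP) hsupp (e := e k)
      fun i => Finset.single_le_sum
        (f := fun i => halfEnergy i (s i) (p i) (fun x => dyadicTrunc (2 ^ k) (u x)))
        (fun _ _ => zero_le) (Finset.mem_univ i)
    refine (mul_le_mul_right h1 _).trans (le_of_eq ?_)
    rw [← mul_assoc, ← ENNReal.ofReal_mul (by positivity)]
    congr 2
    -- This is where criticality enters: P = τ/(κ-1) means (P + τ)/κ = P, so the powers of c cancel
    -- and the bound is uniform over the levels.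
    have h2 : (2 * (Sr * c ^ (-P)) * c ^ (-τ)) ^ κ⁻¹ = (2 * Sr) ^ κ⁻¹ * c ^ (-P) := by
      rw [← mul_assoc, mul_assoc, ← Real.rpow_add hc0,
        Real.mul_rpow (by positivity) (by positivity),
        ← Real.rpow_mul hc0.le]
      congr 2
      have : κ - 1 ≠ 0 := by linarith
      rw [hP]
      field_simp
      ring
    rw [h2, ← hK, Real.mul_rpow (by norm_num) hc0.le, Real.rpow_neg hc0.le]
    have := Real.rpow_pos_of_pos hc0 P
    field_simp
  have hsum : I ≤ ∑' k : ℤ, ENNReal.ofReal ((4 * 2 ^ k : ℝ) ^ P) *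
      volume {x | dyadicTrunc (2 ^ k) (u x) = 2 ^ k} := by
    have hmeas : ∀ k : ℤ, MeasurableSet {x | dyadicTrunc (2 ^ k) (u x) = 2 ^ k} := fun k =>
      ((continuous_dyadicTrunc _).measurable.comp hu) (measurableSet_singleton _)
    have h1 : ∀ k : ℤ, ENNReal.ofReal ((4 * 2 ^ k : ℝ) ^ P) *
        volume {x | dyadicTrunc (2 ^ k) (u x) = 2 ^ k} =
        ∫⁻ x, {x | dyadicTrunc (2 ^ k) (u x) = 2 ^ k}.indicator
          (fun _ => ENNReal.ofReal ((4 * 2 ^ k : ℝ) ^ P)) x := fun k => by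
      rw [lintegral_indicator_const (hmeas k)]
    rw [tsum_congr h1,
      ← lintegral_tsum fun k => (measurable_const.indicator (hmeas k)).aemeasurable]
    refine lintegral_mono fun x => ?_
    rcases eq_or_ne (u x) 0 with h0 | h0
    · rw [h0, enorm_zero, ENNReal.zero_rpow_of_pos (by linarith)]
      exact zero_le
    · obtain ⟨k, hk1, hk2⟩ := exists_mem_Ico_zpow (abs_pos.2 h0) (one_lt_two (α := ℝ))
      -- For 2^k ≤ |u x| < 2^(k+1) the level c = 2^(k-1) satisfies 2c ≤ |u x| < 4c: the truncation
      -- equals c there, and the factor 4 covers |u x|.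
      refine le_trans ?_ (ENNReal.le_tsum (k - 1))
      have hk3 : (2 : ℝ) ^ k = 2 * 2 ^ (k - 1) := by
        rw [← zpow_one_add₀ two_ne_zero]
        congr 1
        ring
      rw [Set.indicator_of_mem, enorm_rpow_eq_ofReal hP1]
      · refine ENNReal.ofReal_le_ofReal (Real.rpow_le_rpow (abs_nonneg _) ?_ (by linarith))
        rw [zpow_add_one₀ two_ne_zero, hk3] at hk2
        linarith
      · exact dyadicTrunc_of_le (hpos _) (hk3 ▸ hk1)
  have htot : ∑' k, e k ≤ ENNReal.ofReal (n * M) := by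
    rw [hedef, Summable.tsum_finsetSum fun _ _ => ENNReal.summable]
    calc _ ≤ ∑ _i : Fin n, ENNReal.ofReal M := Finset.sum_le_sum fun i _ =>
          (tsum_halfEnergy_dyadicTrunc_le i (s i) (hp i) hu).trans (he i)
      _ = ENNReal.ofReal (n * M) := by
          rw [Finset.sum_const, Finset.card_univ, Fintype.card_fin, nsmul_eq_mul,
            ENNReal.ofReal_mul (by positivity), ENNReal.ofReal_natCast]
  clear_value e
  have hmain : Sr ≤ 4 ^ P * K * (2 * Sr) ^ κ⁻¹ * (n * M) := by
    rw [← ENNReal.ofReal_le_ofReal_iff (by positivity), ← hIS]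
    refine hsum.trans ((ENNReal.tsum_le_tsum hlevel).trans ?_)
    rw [ENNReal.tsum_mul_left, ENNReal.ofReal_mul (q := n * M) (by positivity)]
    gcongr
  rw [hIS]
  refine ENNReal.ofReal_le_ofReal ?_
  have hκ' : 0 < κ - 1 := by linarith
  have h3 : Sr ^ ((κ - 1) / κ) ≤ 4 ^ P * K * 2 ^ κ⁻¹ * n * M := by
    have h4 : Sr = Sr ^ ((κ - 1) / κ) * Sr ^ κ⁻¹ := by
      rw [← Real.rpow_add hS0]
      nth_rewrite 1 [← Real.rpow_one Sr]
      congr 1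
      field_simp
      ring
    have h5 : 0 < Sr ^ κ⁻¹ := Real.rpow_pos_of_pos hS0 _
    refine le_of_mul_le_mul_right ?_ h5
    rw [← h4]
    refine hmain.trans (le_of_eq ?_)
    rw [Real.mul_rpow (by norm_num) hS0.le]
    ring
  calc Sr = (Sr ^ ((κ - 1) / κ)) ^ (κ / (κ - 1)) := by
        rw [← Real.rpow_mul hS0.le, div_mul_div_cancel₀ hκ0.ne', div_self hκ'.ne', Real.rpow_one]
    _ ≤ _ := Real.rpow_le_rpow (by positivity) h3 (by positivity)

/-- The critical anisotropic fractional Sobolev inequality. -/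
theorem exists_lintegral_rpow_le (hn : 0 < n) {s p : Fin n → ℝ} (hs : ∀ i, 0 < s i)
    (hp : ∀ i, 1 < p i) {κ τ P : ℝ} (hκ : κ = ∑ i, 1 / (s i * p i)) (hτ : τ = ∑ i, 1 / s i)
    (hκ1 : 1 < κ) (hP : P = τ / (κ - 1)) (hP1 : 1 < P) :
    ∃ C : ℝ, 0 ≤ C ∧ ∀ u : EuclideanSpace ℝ (Fin n) → ℝ, Measurable u →
      volume {x | u x ≠ 0} < ⊤ → ∀ M : ℝ, 0 ≤ M →
      (∀ i, halfEnergy i (s i) (p i) u ≤ ENNReal.ofReal M) →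
      ∫⁻ x, ‖u x‖ₑ ^ P ≤ ENNReal.ofReal ((C * M) ^ (κ / (κ - 1))) := by
  refine ⟨(4 : ℝ) ^ P * ((∑ i, (n : ℝ) ^ p i) * 2) * 2 ^ κ⁻¹ * n, by positivity,
    fun u hu hsupp M hM he => ?_⟩
  have hP0 : 0 < P := by linarith
  -- Truncation at height m makes the critical integral finite, as the support has finite measure,
  -- and does not increase the energies; m → ∞ follows by monotone convergence.
  have hbound : ∀ m : ℕ, ∫⁻ x, ‖min |u x| (m : ℝ)‖ₑ ^ P ≤ ENNReal.ofReal
      (((4 : ℝ) ^ P * ((∑ i, (n : ℝ) ^ p i) * 2) * 2 ^ κ⁻¹ * n * M) ^ (κ / (κ - 1))) := fun m => by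
    have hmeas : Measurable fun x => min |u x| (m : ℝ) := by fun_prop
    refine lintegral_rpow_le_of_bounded hn hs hp hκ hτ hκ1 hP hP1 hmeas ?_ hM fun i =>
      (halfEnergy_comp_le i (s i) (zero_lt_one.trans (hp i)) (φ := fun t => min |t| (m : ℝ))
        ?_ u).trans (he i)
    · calc ∫⁻ x, ‖min |u x| (m : ℝ)‖ₑ ^ P
          ≤ ∫⁻ x, {x | u x ≠ 0}.indicator (fun _ => ENNReal.ofReal ((m : ℝ) ^ P)) x := by
            refine lintegral_mono fun x => ?_
            by_cases hx : u x = 0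
            · simp [hx, hP0]
            · rw [Set.indicator_of_mem (show x ∈ {x | u x ≠ 0} from hx), enorm_rpow_eq_ofReal hP1]
              refine ENNReal.ofReal_le_ofReal (Real.rpow_le_rpow (abs_nonneg _) ?_ hP0.le)
              rw [abs_of_nonneg (le_min (abs_nonneg _) (Nat.cast_nonneg m))]
              exact min_le_right _ _
        _ = ENNReal.ofReal ((m : ℝ) ^ P) * volume {x | u x ≠ 0} :=
            lintegral_indicator_const (hu (measurableSet_singleton 0).compl) _
        _ < ⊤ := ENNReal.mul_lt_top ENNReal.ofReal_lt_top hsupp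
    · intro a b
      refine (abs_min_sub_min_le_max _ _ _ _).trans ?_
      simp only [sub_self, abs_zero]
      exact max_le (abs_abs_sub_abs_le_abs_sub a b) (abs_nonneg _)
  have hlim : Tendsto (fun m : ℕ => ∫⁻ x, ‖min |u x| (m : ℝ)‖ₑ ^ P) atTop
      (𝓝 (∫⁻ x, ‖u x‖ₑ ^ P)) := by
    refine lintegral_tendsto_of_tendsto_of_monotone (fun m => ?_) (ae_of_all _ fun x => ?_)
      (ae_of_all _ fun x => ?_)
    · exact Measurable.aemeasurable (by fun_prop)
    · intro m m' hmm
      dsimp only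
      refine ENNReal.rpow_le_rpow ?_ hP0.le
      rw [enorm_le_iff_norm_le, Real.norm_eq_abs, Real.norm_eq_abs,
        abs_of_nonneg (a := min |u x| (m : ℝ)) (le_min (abs_nonneg _) (Nat.cast_nonneg m)),
        abs_of_nonneg (a := min |u x| (m' : ℝ)) (le_min (abs_nonneg _) (Nat.cast_nonneg m'))]
      exact min_le_min le_rfl (by exact_mod_cast hmm)
    · refine tendsto_const_nhds.congr' ?_
      obtain ⟨m, hm⟩ := exists_nat_ge |u x|
      filter_upwards [eventually_ge_atTop m] with m' hm'
      have : |u x| ≤ (m' : ℝ) := hm.trans (by exact_mod_cast hm')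
      rw [min_eq_left this, ← Real.norm_eq_abs, enorm_norm]
  exact le_of_tendsto' hlim hbound

end Sobolev

/-! ### Comparison of horizons, uniform in the horizon. -/

section Horizon

variable {n : ℕ}

/-- The (one-sided) Gagliardo energy in the direction `eᵢ`, truncated at the horizon `δ`. -/
def truncEnergy (i : Fin n) (s p δ : ℝ) (u : EuclideanSpace ℝ (Fin n) → ℝ) : ℝ≥0∞ :=
  ∫⁻ h in Set.Ioc 0 δ, incrEnergy i p u h * ENNReal.ofReal (h ^ (-(1 + s * p)))

/-- A step m h is a chain of m steps h. Convexity costs m^(p-1), and by translation invariance the m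
terms have equal integrals. -/
lemma incrEnergy_nat_mul_le (i : Fin n) {p : ℝ} (hp : 1 < p)
    {u : EuclideanSpace ℝ (Fin n) → ℝ} (hu : Measurable u) (m : ℕ) (hm : 0 < m) (h : ℝ) :
    incrEnergy i p u (m * h) ≤ ENNReal.ofReal ((m : ℝ) ^ p) * incrEnergy i p u h := by
  have hm' : (0 : ℝ) < m := by exact_mod_cast hm
  have htel : ∀ x, incr i u x (m * h) = ∑ j ∈ Finset.range m,
      incr i u (x + ((j : ℝ) * h) • EuclideanSpace.single i (1 : ℝ)) h := fun x => by
    have h1 := Finset.sum_range_sub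
      (fun j : ℕ => u (x + ((j : ℝ) * h) • EuclideanSpace.single i (1 : ℝ))) m
    simp only [Nat.cast_zero, zero_mul, zero_smul, add_zero] at h1
    rw [incr, ← h1]
    refine Finset.sum_congr rfl fun j _ => ?_
    rw [incr, Nat.cast_add, Nat.cast_one, add_mul, one_mul, add_smul, add_assoc]
  unfold incrEnergy
  calc ∫⁻ x, ‖incr i u x (m * h)‖ₑ ^ p
      ≤ ∫⁻ x, ENNReal.ofReal ((m : ℝ) ^ (p - 1)) * ∑ j ∈ Finset.range m,
          ‖incr i u (x + ((j : ℝ) * h) • EuclideanSpace.single i (1 : ℝ)) h‖ₑ ^ p := by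
        refine lintegral_mono fun x => ?_
        rw [htel]
        refine (ENNReal.rpow_le_rpow (enorm_sum_le _ _) (by linarith)).trans ?_
        refine (ENNReal.rpow_sum_le_const_mul_sum_rpow _ _ hp.le).trans (le_of_eq ?_)
        rw [Finset.card_range, ← ENNReal.ofReal_rpow_of_pos hm', ENNReal.ofReal_natCast]
    _ = ENNReal.ofReal ((m : ℝ) ^ (p - 1)) * ∑ j ∈ Finset.range m, ∫⁻ x, ‖incr i u x h‖ₑ ^ p := by
        rw [lintegral_const_mul' _ _ ENNReal.ofReal_ne_top, lintegral_finsetSum]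
        · congr 1
          refine Finset.sum_congr rfl fun j _ => ?_
          exact lintegral_add_right_eq_self (fun x => ‖incr i u x h‖ₑ ^ p) _
        · intro j _
          exact ((measurable_incr i hu h).comp (measurable_add_const _)).enorm.pow_const p
    _ = _ := by
        rw [Finset.sum_const, Finset.card_range, nsmul_eq_mul, ← mul_assoc,
          ← ENNReal.ofReal_natCast m, ← ENNReal.ofReal_mul (by positivity),
          ← Real.rpow_add_one hm'.ne', sub_add_cancel]

/-- Under the substitution h = m t the factors are m from dh, m^p from the increments and m^(-1-sp)
from the kernel. Their product is the power that the scaling of the form compensates. -/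
lemma truncEnergy_nat_mul_le (i : Fin n) (s : ℝ) {p δ : ℝ} (hp : 1 < p)
    {u : EuclideanSpace ℝ (Fin n) → ℝ} (hu : Measurable u) (m : ℕ) (hm : 0 < m) :
    truncEnergy i s p (m * δ) u ≤
      ENNReal.ofReal ((m : ℝ) ^ (p * (1 - s))) * truncEnergy i s p δ u := by
  have hm' : (0 : ℝ) < m := by exact_mod_cast hm
  have hmeas : Measurable fun h => incrEnergy i p u h * ENNReal.ofReal (h ^ (-(1 + s * p))) :=
    (measurable_incrEnergy i p hu).mul (by fun_prop)
  unfold truncEnergy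
  rw [← lintegral_indicator measurableSet_Ioc, ← lintegral_indicator measurableSet_Ioc,
    ← Real.smul_map_volume_mul_left hm'.ne', lintegral_smul_measure,
    lintegral_map (hmeas.indicator measurableSet_Ioc) (measurable_const_mul _),
    Real.smul_map_volume_mul_left hm'.ne', abs_of_pos hm', smul_eq_mul,
    ← lintegral_const_mul' _ _ ENNReal.ofReal_ne_top,
    ← lintegral_const_mul' _ _ ENNReal.ofReal_ne_top]
  refine lintegral_mono fun t => ?_
  by_cases ht : t ∈ Set.Ioc 0 δ
  · have hmt : (m : ℝ) * t ∈ Set.Ioc 0 (m * δ) :=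
      ⟨mul_pos hm' ht.1, mul_le_mul_of_nonneg_left ht.2 hm'.le⟩
    rw [Set.indicator_of_mem hmt, Set.indicator_of_mem ht]
    calc ENNReal.ofReal m * (incrEnergy i p u (m * t) *
          ENNReal.ofReal ((m * t) ^ (-(1 + s * p))))
        ≤ ENNReal.ofReal m * ((ENNReal.ofReal ((m : ℝ) ^ p) * incrEnergy i p u t) *
          ENNReal.ofReal ((m * t) ^ (-(1 + s * p)))) := by
          gcongr
          exact incrEnergy_nat_mul_le i hp hu m hm t
      _ = ENNReal.ofReal (m * (m : ℝ) ^ p * m ^ (-(1 + s * p))) *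
          (incrEnergy i p u t * ENNReal.ofReal (t ^ (-(1 + s * p)))) := by
          rw [Real.mul_rpow hm'.le ht.1.le, ENNReal.ofReal_mul (by positivity),
            ENNReal.ofReal_mul (by positivity), ENNReal.ofReal_mul (by positivity)]
          ring
      _ = _ := by
          congr 2
          nth_rewrite 1 [← Real.rpow_one (m : ℝ)]
          rw [← Real.rpow_add hm', ← Real.rpow_add hm']
          congr 1
          ring
  · have hmt : (m : ℝ) * t ∉ Set.Ioc 0 (m * δ) := fun h =>
      ht ⟨pos_of_mul_pos_right h.1 hm'.le, le_of_mul_le_mul_left h.2 hm'⟩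
    rw [Set.indicator_of_notMem hmt, Set.indicator_of_notMem ht, mul_zero]
    exact zero_le

lemma truncEnergy_mono (i : Fin n) (s p : ℝ) (u : EuclideanSpace ℝ (Fin n) → ℝ) {δ ρ : ℝ}
    (h : δ ≤ ρ) : truncEnergy i s p δ u ≤ truncEnergy i s p ρ u :=
  lintegral_mono_set (Set.Ioc_subset_Ioc_right h)

/-- The scaled truncated energies control those with a larger horizon. -/
lemma truncEnergy_le_scaled (i : Fin n) {s p δ ρ : ℝ} (hs : s < 1) (hp : 1 < p) (hδ : 0 < δ)
    (hδρ : δ ≤ ρ) {u : EuclideanSpace ℝ (Fin n) → ℝ} (hu : Measurable u) :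
    truncEnergy i s p ρ u ≤ ENNReal.ofReal ((2 * ρ) ^ (p * (1 - s)) * δ ^ (-(p * (1 - s)))) *
      truncEnergy i s p δ u := by
  -- The multiple m δ reaches ρ, while m ≤ 2ρ/δ because ρ/δ ≥ 1.
  set m := ⌈ρ / δ⌉₊ with hm
  have hρ : 0 < ρ := hδ.trans_le hδρ
  have hm0 : 0 < m := Nat.ceil_pos.2 (by positivity)
  have h1 : ρ ≤ m * δ := by
    rw [← div_le_iff₀ hδ]
    exact Nat.le_ceil _
  have h2 : (m : ℝ) ≤ 2 * ρ * δ⁻¹ := by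
    have h3 := (Nat.ceil_lt_add_one (show 0 ≤ ρ / δ by positivity)).le
    have h4 : 1 ≤ ρ / δ := (one_le_div hδ).2 hδρ
    calc (m : ℝ) ≤ ρ / δ + 1 := h3
      _ ≤ ρ / δ + ρ / δ := by linarith
      _ = _ := by ring
  refine (truncEnergy_mono i s p u h1).trans ((truncEnergy_nat_mul_le i s hp hu m hm0).trans ?_)
  have hps : 0 ≤ p * (1 - s) := mul_nonneg (by linarith) (by linarith)
  gcongr
  rw [Real.rpow_neg hδ.le, ← Real.inv_rpow hδ.le, ← Real.mul_rpow (by positivity) (by positivity)]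
  exact Real.rpow_le_rpow (Nat.cast_nonneg m) h2 hps

/-- A step longer than the diameter 2R carries every point of Ω out of Ω. -/
lemma incr_ae_eq_neg_of_support (i : Fin n) {Ω : Set (EuclideanSpace ℝ (Fin n))} {R : ℝ}
    (hΩ : Ω ⊆ Metric.ball 0 R) {u : EuclideanSpace ℝ (Fin n) → ℝ}
    (hu0 : ∀ᵐ x, x ∉ Ω → u x = 0) {h : ℝ} (hh : 2 * R < h) :
    ∀ᵐ x, x ∈ Ω → incr i u x h = -u x := by
  have h1 : ∀ᵐ x, x + h • EuclideanSpace.single i (1 : ℝ) ∉ Ω →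
      u (x + h • EuclideanSpace.single i (1 : ℝ)) = 0 :=
    (measurePreserving_add_right volume
      (h • EuclideanSpace.single i (1 : ℝ))).quasiMeasurePreserving.ae hu0
  filter_upwards [h1] with x hx hxΩ
  rw [incr, hx, zero_sub]
  intro hmem
  have e1 : ‖x‖ < R := by simpa using hΩ hxΩ
  have e2 : ‖x + h • EuclideanSpace.single i (1 : ℝ)‖ < R := by simpa using hΩ hmem
  have e3 : ‖h • EuclideanSpace.single i (1 : ℝ)‖ = |h| := by
    rw [norm_smul, PiLp.norm_single, norm_one, mul_one, Real.norm_eq_abs]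
  have e4 := norm_sub_le (x + h • EuclideanSpace.single i (1 : ℝ)) x
  rw [add_sub_cancel_left, e3] at e4
  linarith [le_abs_self h]

lemma lintegral_rpow_le_incrEnergy (i : Fin n) {Ω : Set (EuclideanSpace ℝ (Fin n))} {R p : ℝ}
    (hp : 0 < p) (hΩ : Ω ⊆ Metric.ball 0 R) {u : EuclideanSpace ℝ (Fin n) → ℝ}
    (hu0 : ∀ᵐ x, x ∉ Ω → u x = 0) {h : ℝ} (hh : 2 * R < h) :
    ∫⁻ x, ‖u x‖ₑ ^ p ≤ incrEnergy i p u h := by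
  refine lintegral_mono_ae ?_
  filter_upwards [hu0, incr_ae_eq_neg_of_support i hΩ hu0 hh] with x hx hx'
  by_cases hxΩ : x ∈ Ω
  · rw [hx' hxΩ, enorm_neg]
  · rw [hx hxΩ, enorm_zero, ENNReal.zero_rpow_of_pos hp]
    exact zero_le

lemma incrEnergy_le_lintegral_rpow (i : Fin n) {p : ℝ} (hp : 1 < p)
    {u : EuclideanSpace ℝ (Fin n) → ℝ} (hu : Measurable u) (h : ℝ) :
    incrEnergy i p u h ≤ ENNReal.ofReal (2 ^ p) * ∫⁻ x, ‖u x‖ₑ ^ p := by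
  have h2 : ENNReal.ofReal (2 ^ p) = 2 ^ (p - 1) * 2 := by
    rw [← ENNReal.ofReal_rpow_of_pos two_pos, ENNReal.ofReal_ofNat]
    have h3 := ENNReal.rpow_add (p - 1) 1 (two_ne_zero (α := ℝ≥0∞)) ENNReal.ofNat_ne_top
    rwa [sub_add_cancel, ENNReal.rpow_one] at h3
  have hm : Measurable fun x => ‖u x‖ₑ ^ p := hu.enorm.pow_const p
  calc incrEnergy i p u h
      ≤ ∫⁻ x, 2 ^ (p - 1) * (‖u (x + h • EuclideanSpace.single i (1 : ℝ))‖ₑ ^ p + ‖u x‖ₑ ^ p) := by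
        refine lintegral_mono fun x => ?_
        exact (ENNReal.rpow_le_rpow enorm_sub_le (by linarith)).trans
          (ENNReal.rpow_add_le_mul_rpow_add_rpow _ _ hp.le)
    _ = _ := by
        rw [lintegral_const_mul' _ _ (by finiteness), lintegral_add_right _ hm,
          lintegral_add_right_eq_self (fun x => ‖u x‖ₑ ^ p), h2, ← two_mul, mul_assoc]

/-- Poincaré inequality for the truncated energy with a large horizon. -/
lemma lintegral_rpow_le_truncEnergy (i : Fin n) {Ω : Set (EuclideanSpace ℝ (Fin n))} {R s p : ℝ}
    (hR : 0 < R) (hs : 0 < s) (hp : 0 < p) (hΩ : Ω ⊆ Metric.ball 0 R)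
    {u : EuclideanSpace ℝ (Fin n) → ℝ} (hu0 : ∀ᵐ x, x ∉ Ω → u x = 0) {ρ : ℝ} (hρ : 3 * R ≤ ρ) :
    ∫⁻ x, ‖u x‖ₑ ^ p ≤
      ENNReal.ofReal (R⁻¹ * (3 * R) ^ (1 + s * p)) * truncEnergy i s p ρ u := by
  have hsp : 0 < 1 + s * p := by positivity
  have h3R : 0 < (3 * R) ^ (1 + s * p) := by positivity
  -- Only the steps in (2R, 3R] are used: the increment energy is at least the integral of |u|^p
  -- there, and the kernel is at least its value at 3R.
  have h1 : ENNReal.ofReal (R * (3 * R) ^ (-(1 + s * p))) * ∫⁻ x, ‖u x‖ₑ ^ p ≤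
      truncEnergy i s p ρ u := by
    calc ENNReal.ofReal (R * (3 * R) ^ (-(1 + s * p))) * ∫⁻ x, ‖u x‖ₑ ^ p
        = ∫⁻ _h in Set.Ioc (2 * R) (3 * R), (∫⁻ x, ‖u x‖ₑ ^ p) *
            ENNReal.ofReal ((3 * R) ^ (-(1 + s * p))) := by
          rw [setLIntegral_const, Real.volume_Ioc, ENNReal.ofReal_mul hR.le,
            show 3 * R - 2 * R = R by ring]
          ring
      _ ≤ ∫⁻ h in Set.Ioc (2 * R) (3 * R),
            incrEnergy i p u h * ENNReal.ofReal (h ^ (-(1 + s * p))) := by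
          refine setLIntegral_mono' measurableSet_Ioc fun h hh => ?_
          have hh0 : 0 < h := lt_trans (by positivity) hh.1
          gcongr ?_ * ENNReal.ofReal ?_
          · exact lintegral_rpow_le_incrEnergy i hp hΩ hu0 hh.1
          · exact Real.rpow_le_rpow_of_nonpos hh0 hh.2 (by linarith)
      _ ≤ _ := lintegral_mono_set (Set.Ioc_subset_Ioc (by positivity) hρ)
  calc ∫⁻ x, ‖u x‖ₑ ^ p
      = ENNReal.ofReal (R⁻¹ * (3 * R) ^ (1 + s * p)) *
          (ENNReal.ofReal (R * (3 * R) ^ (-(1 + s * p))) * ∫⁻ x, ‖u x‖ₑ ^ p) := by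
        rw [← mul_assoc, ← ENNReal.ofReal_mul (by positivity), Real.rpow_neg (by positivity)]
        have : R⁻¹ * (3 * R) ^ (1 + s * p) * (R * ((3 * R) ^ (1 + s * p))⁻¹) = 1 := by
          field_simp
        rw [this, ENNReal.ofReal_one, one_mul]
    _ ≤ _ := by gcongr

/-- Beyond ρ the increment energy is at most 2^p times the integral of |u|^p, and the kernel is
integrable at infinity. -/
lemma halfEnergy_le_truncEnergy_add (i : Fin n) {s p ρ : ℝ} (hs : 0 < s) (hp : 1 < p) (hρ : 0 < ρ)
    {u : EuclideanSpace ℝ (Fin n) → ℝ} (hu : Measurable u) :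
    halfEnergy i s p u ≤ truncEnergy i s p ρ u +
      ENNReal.ofReal (2 ^ p * (ρ ^ (-(s * p)) / (s * p))) * ∫⁻ x, ‖u x‖ₑ ^ p := by
  have hsp : 0 < s * p := mul_pos hs (by linarith)
  have hint : ∫⁻ h in Set.Ioi ρ, ENNReal.ofReal (h ^ (-(1 + s * p))) =
      ENNReal.ofReal (ρ ^ (-(s * p)) / (s * p)) := by
    rw [← ofReal_integral_eq_lintegral_ofReal (integrableOn_Ioi_rpow_of_lt (by linarith) hρ),
      integral_Ioi_rpow_of_lt (by linarith) hρ]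
    · congr 1
      rw [show -(1 + s * p) + 1 = -(s * p) by ring, neg_div_neg_eq]
    · filter_upwards [ae_restrict_mem measurableSet_Ioi] with h hh
      exact Real.rpow_nonneg (hρ.trans hh).le _
  unfold halfEnergy truncEnergy
  rw [← Set.Ioc_union_Ioi_eq_Ioi hρ.le, lintegral_union measurableSet_Ioi
    (Set.Ioc_disjoint_Ioi le_rfl)]
  gcongr
  calc ∫⁻ h in Set.Ioi ρ, incrEnergy i p u h * ENNReal.ofReal (h ^ (-(1 + s * p)))
      ≤ ∫⁻ h in Set.Ioi ρ, (ENNReal.ofReal (2 ^ p) * ∫⁻ x, ‖u x‖ₑ ^ p) *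
          ENNReal.ofReal (h ^ (-(1 + s * p))) := by
        refine lintegral_mono fun h => ?_
        gcongr
        exact incrEnergy_le_lintegral_rpow i hp hu h
    _ = _ := by
        rw [lintegral_const_mul _ (by fun_prop), hint, ENNReal.ofReal_mul (by positivity)]
        ring

lemma incrEnergy_congr (i : Fin n) (p : ℝ) {u v : EuclideanSpace ℝ (Fin n) → ℝ}
    (huv : u =ᵐ[volume] v) : incrEnergy i p u = incrEnergy i p v := by
  funext h
  have h1 : ∀ᵐ x, u (x + h • EuclideanSpace.single i (1 : ℝ)) =
      v (x + h • EuclideanSpace.single i (1 : ℝ)) :=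
    (measurePreserving_add_right volume
      (h • EuclideanSpace.single i (1 : ℝ))).quasiMeasurePreserving.ae huv
  refine lintegral_congr_ae ?_
  filter_upwards [huv, h1] with x hx hx'
  rw [incr, incr, hx, hx']

/-- The scaled truncated energies control the full Gagliardo energy and the `L^p` norm, uniformly
with respect to the horizon. -/
lemma exists_energy_le_scaled (i : Fin n) {Ω : Set (EuclideanSpace ℝ (Fin n))}
    (hΩ : Bornology.IsBounded Ω) {s p : ℝ} (hs : 0 < s ∧ s < 1) (hp : 1 < p) (D : ℝ) :
    ∃ C : ℝ, 0 ≤ C ∧ ∀ δ : ℝ, 0 < δ → δ ≤ D → ∀ u : EuclideanSpace ℝ (Fin n) → ℝ,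
      AEStronglyMeasurable u volume → (∀ᵐ x, x ∉ Ω → u x = 0) →
      halfEnergy i s p u ≤
        ENNReal.ofReal (C * δ ^ (-(p * (1 - s)))) * truncEnergy i s p δ u ∧
      ∫⁻ x, ‖u x‖ₑ ^ p ≤
        ENNReal.ofReal (C * δ ^ (-(p * (1 - s)))) * truncEnergy i s p δ u := by
  obtain ⟨R', hR'⟩ := hΩ.subset_ball 0
  set R := max R' 1 with hRdef
  have hR : 0 < R := lt_max_of_lt_right one_pos
  have hΩR : Ω ⊆ Metric.ball 0 R := hR'.trans (Metric.ball_subset_ball (le_max_left _ _))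
  -- A single large horizon that serves the Poincaré inequality and exceeds every δ ≤ D; the small
  -- horizon is compared with it.
  set ρ := max (3 * R) D with hρdef
  have hρ : 0 < ρ := lt_max_of_lt_left (by positivity)
  set A : ℝ := (2 * ρ) ^ (p * (1 - s)) with hA
  have hA0 : 0 ≤ A := by positivity
  set B : ℝ := R⁻¹ * (3 * R) ^ (1 + s * p) with hB
  have hB0 : 0 ≤ B := by positivity
  set E : ℝ := 2 ^ p * (ρ ^ (-(s * p)) / (s * p)) with hE
  have hE0 : 0 ≤ E := by
    have := hs.1
    positivity
  clear_value A B E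
  refine ⟨A + E * (B * A) + B * A, by positivity, fun δ hδ hδD u hu hu0 => ?_⟩
  wlog hum : Measurable u generalizing u
  · have hmk := hu.ae_eq_mk
    have h1 := this (hu.mk u) hu.stronglyMeasurable_mk.aestronglyMeasurable
      (by filter_upwards [hu0, hmk] with x hx hx' hxΩ using hx' ▸ hx hxΩ)
      hu.stronglyMeasurable_mk.measurable
    have h2 : ∫⁻ x, ‖u x‖ₑ ^ p = ∫⁻ x, ‖hu.mk u x‖ₑ ^ p :=
      lintegral_congr_ae (by filter_upwards [hmk] with x hx using by rw [hx])
    simp only [halfEnergy, truncEnergy, incrEnergy_congr i p hmk, h2] at h1 ⊢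
    exact h1
  set d : ℝ := δ ^ (-(p * (1 - s))) with hd
  have hd0 : 0 ≤ d := by positivity
  set T := truncEnergy i s p δ u with hT
  have h1 : truncEnergy i s p ρ u ≤ ENNReal.ofReal (A * d) * T := by
    rw [hA]
    exact truncEnergy_le_scaled i hs.2 hp hδ (hδD.trans (le_max_right _ _)) hum
  have h2 : ∫⁻ x, ‖u x‖ₑ ^ p ≤ ENNReal.ofReal (B * A * d) * T := by
    refine (lintegral_rpow_le_truncEnergy i hR hs.1 (by linarith) hΩR hu0
      (le_max_left (3 * R) D)).trans ?_
    rw [← hB, mul_assoc B, ENNReal.ofReal_mul hB0, mul_assoc]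
    gcongr
  constructor
  · refine (halfEnergy_le_truncEnergy_add i hs.1 hp hρ hum).trans ?_
    rw [← hE]
    calc _ ≤ ENNReal.ofReal (A * d) * T + ENNReal.ofReal E * (ENNReal.ofReal (B * A * d) * T) := by
          gcongr
      _ = ENNReal.ofReal (A * d + E * (B * A * d)) * T := by
          rw [ENNReal.ofReal_add (by positivity) (by positivity),
            ENNReal.ofReal_mul (p := E) hE0]
          ring
      _ ≤ _ := by
          gcongr
          have : 0 ≤ B * A * d := by positivity
          linarith
  · refine h2.trans ?_
    gcongr
    have : 0 ≤ E * (B * A) := by positivity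
    linarith

end Horizon

/-! ### Averages over the steps. -/

section Fibres

variable {α : Type*} [MeasurableSpace α]

lemma enorm_integral_rpow_le {p : ℝ} (hp : 1 < p) (ν : Measure α) [IsFiniteMeasure ν] (F : α → ℝ) :
    ‖∫ y, F y ∂ν‖ₑ ^ p ≤ ν Set.univ ^ (p - 1) * ∫⁻ y, ‖F y‖ₑ ^ p ∂ν := by
  have hp0 : 0 < p := by linarith
  by_cases hF : AEStronglyMeasurable F ν
  · have h1 : ‖∫ y, F y ∂ν‖ₑ ≤ eLpNorm F 1 ν := by
      rw [eLpNorm_one_eq_lintegral_enorm]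
      exact enorm_integral_le_lintegral_enorm F
    have h2 := eLpNorm_le_eLpNorm_mul_rpow_measure_univ (p := 1) (q := ENNReal.ofReal p)
      (by simpa using hp.le) hF
    have h3 := ENNReal.rpow_le_rpow (h1.trans h2) hp0.le
    rw [ENNReal.mul_rpow_of_nonneg _ _ hp0.le, eLpNorm_rpow_eq_lintegral hp, ← ENNReal.rpow_mul,
      mul_comm, ENNReal.toReal_ofReal hp0.le, ENNReal.toReal_one] at h3
    convert h3 using 3
    field_simp
  -- Without measurability the Bochner integral is 0 by convention and the bound is trivial.
  · rw [integral_undef fun h => hF h.1, enorm_zero, ENNReal.zero_rpow_of_pos hp0]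
    exact zero_le

lemma lintegral_fibre_integral_le {p : ℝ} (hp : 1 < p) (μ : Measure α) [SFinite μ] (ν : Measure ℝ)
    [IsFiniteMeasure ν] {F : α × ℝ → ℝ} (hF : AEStronglyMeasurable F (μ.prod ν)) :
    ∫⁻ x, ‖∫ t, F (x, t) ∂ν‖ₑ ^ p ∂μ ≤
      ν Set.univ ^ (p - 1) * ∫⁻ z, ‖F z‖ₑ ^ p ∂(μ.prod ν) := by
  rw [lintegral_prod _ (hF.enorm.pow_const p)]
  have hne : ν Set.univ ^ (p - 1) ≠ ⊤ :=
    ENNReal.rpow_ne_top_of_nonneg (by linarith) (measure_ne_top _ _)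
  rw [← lintegral_const_mul' _ _ hne]
  exact lintegral_mono fun x => enorm_integral_rpow_le hp ν _

lemma memLp_fibre_integral {p : ℝ} (hp : 1 < p) {μ : Measure α} [SFinite μ] {ν : Measure ℝ}
    [IsFiniteMeasure ν] {F : α × ℝ → ℝ} (hF : MemLp F (ENNReal.ofReal p) (μ.prod ν)) :
    MemLp (fun x => ∫ t, F (x, t) ∂ν) (ENNReal.ofReal p) μ := by
  rw [memLp_iff_lintegral_lt_top hp hF.1.integral_prod_right']
  refine (lintegral_fibre_integral_le hp μ ν hF.1).trans_lt ?_
  exact ENNReal.mul_lt_top (ENNReal.rpow_lt_top_of_nonneg (by linarith) (measure_ne_top _ _))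
    ((memLp_iff_lintegral_lt_top hp hF.1).1 hF)

end Fibres

/-! ### Weak derivatives and difference quotients. -/

section WeakDerivative

variable {n : ℕ}

/-- For each fixed second coordinate the map is a translation of the space. -/
lemma measurePreserving_shear (i : Fin n) (ν : Measure ℝ) [SFinite ν] (c : ℝ) :
    MeasurePreserving (fun z : EuclideanSpace ℝ (Fin n) × ℝ =>
      (z.1 + (c * z.2) • EuclideanSpace.single i (1 : ℝ), z.2))
      (volume.prod ν) (volume.prod ν) := by
  have h := (MeasurePreserving.id ν).skew_product
    (μc := (volume : Measure (EuclideanSpace ℝ (Fin n))))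
    (μd := volume) (g := fun t x => x + (c * t) • EuclideanSpace.single i (1 : ℝ)) (by fun_prop)
    (ae_of_all _ fun t => (measurePreserving_add_right volume _).map_eq)
  exact (Measure.measurePreserving_swap.comp h).comp Measure.measurePreserving_swap

lemma memLp_shear (i : Fin n) {ν : Measure ℝ} [IsFiniteMeasure ν] (c : ℝ) {p : ℝ≥0∞}
    {g : EuclideanSpace ℝ (Fin n) → ℝ} (hg : MemLp g p) :
    MemLp (fun z : EuclideanSpace ℝ (Fin n) × ℝ =>
      g (z.1 + (c * z.2) • EuclideanSpace.single i (1 : ℝ))) p (volume.prod ν) :=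
  (hg.comp_fst ν).comp_measurePreserving (measurePreserving_shear i ν c)

lemma HasWeakPartial.ae_unique {i : Fin n} {u g g' : EuclideanSpace ℝ (Fin n) → ℝ}
    (hg : HasWeakPartial i u g) (hg' : HasWeakPartial i u g') : g =ᵐ[volume] g' := by
  refine ae_eq_of_integral_contDiff_smul_eq hg.2.1 hg'.2.1 fun φ hφ hφc => ?_
  have h1 := hg.2.2 φ hφ hφc
  have h2 := hg'.2.2 φ hφ hφc
  simp only [smul_eq_mul, mul_comm (φ _)]
  linarith

lemma HasWeakPartial.hasWeakPartial_weakPartial {i : Fin n}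
    {u g : EuclideanSpace ℝ (Fin n) → ℝ} (hg : HasWeakPartial i u g) :
    HasWeakPartial i u (weakPartial i u) := by
  have h : ∃ g, HasWeakPartial i u g := ⟨g, hg⟩
  rw [weakPartial, dif_pos h]
  exact h.choose_spec

lemma HasWeakPartial.weakPartial_ae_eq {i : Fin n} {u g : EuclideanSpace ℝ (Fin n) → ℝ}
    (hg : HasWeakPartial i u g) : weakPartial i u =ᵐ[volume] g :=
  hg.hasWeakPartial_weakPartial.ae_unique hg

lemma integrable_mul_test {f φ : EuclideanSpace ℝ (Fin n) → ℝ} (hf : LocallyIntegrable f)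
    (hφ : Continuous φ) (hφc : HasCompactSupport φ) : Integrable fun x => f x * φ x := by
  have := hf.integrable_smul_left_of_hasCompactSupport hφ hφc
  exact this.congr (ae_of_all _ fun x => by simp only [smul_eq_mul, mul_comm])

lemma continuous_fderiv_test {φ : EuclideanSpace ℝ (Fin n) → ℝ} (hφ : ContDiff ℝ (⊤ : ℕ∞) φ)
    (e : EuclideanSpace ℝ (Fin n)) : Continuous fun x => fderiv ℝ φ x e :=
  (hφ.continuous_fderiv (by simp)).clm_apply continuous_const

lemma hasCompactSupport_fderiv_test {φ : EuclideanSpace ℝ (Fin n) → ℝ}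
    (hφc : HasCompactSupport φ) (e : EuclideanSpace ℝ (Fin n)) :
    HasCompactSupport fun x => fderiv ℝ φ x e :=
  hφc.fderiv_apply ℝ e

lemma HasWeakPartial.add_const_mul {i : Fin n} {u v g g' : EuclideanSpace ℝ (Fin n) → ℝ}
    (hg : HasWeakPartial i u g) (hg' : HasWeakPartial i v g') (c : ℝ) :
    HasWeakPartial i (fun x => u x + c * v x) (fun x => g x + c * g' x) := by
  refine ⟨hg.1.add (hg'.1.smul c), hg.2.1.add (hg'.2.1.smul c), fun φ hφ hφc => ?_⟩
  have hd := continuous_fderiv_test hφ (EuclideanSpace.single i (1 : ℝ))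
  have hdc := hasCompactSupport_fderiv_test hφc (EuclideanSpace.single i (1 : ℝ))
  simp only [add_mul, mul_assoc]
  rw [integral_add (integrable_mul_test hg.1 hd hdc)
    ((integrable_mul_test hg'.1 hd hdc).const_mul c),
    integral_add (integrable_mul_test hg.2.1 hφ.continuous hφc)
    ((integrable_mul_test hg'.2.1 hφ.continuous hφc).const_mul c), integral_const_mul,
    integral_const_mul, hg.2.2 φ hφ hφc, hg'.2.2 φ hφ hφc]
  ring

open scoped Convolution in
lemma convolution_line (f φ : EuclideanSpace ℝ (Fin n) → ℝ) (y : EuclideanSpace ℝ (Fin n)) :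
    (f ⋆[ContinuousLinearMap.lsmul ℝ ℝ, volume] fun x => φ (-x)) y = ∫ x, f (x + y) * φ x := by
  rw [convolution_def, ← integral_add_right_eq_self _ y]
  refine integral_congr_ae (ae_of_all _ fun x => ?_)
  simp only [ContinuousLinearMap.lsmul_apply, smul_eq_mul]
  congr 2
  abel

-- The derivative falls on the smooth factor η. Testing the weak derivative with x ↦ η(y - x) moves
-- it to u; the sign of the reflection cancels that of the integration by parts.
open scoped Convolution in
lemma HasWeakPartial.hasDerivAt_convolution_line {i : Fin n}
    {u g : EuclideanSpace ℝ (Fin n) → ℝ} (hg : HasWeakPartial i u g)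
    {η : EuclideanSpace ℝ (Fin n) → ℝ} (hηs : ContDiff ℝ (⊤ : ℕ∞) η) (hηc : HasCompactSupport η)
    (h t : ℝ) :
    HasDerivAt (fun t : ℝ => (u ⋆[ContinuousLinearMap.lsmul ℝ ℝ, volume] η)
        ((h * t) • EuclideanSpace.single i (1 : ℝ)))
      (h * (g ⋆[ContinuousLinearMap.lsmul ℝ ℝ, volume] η)
        ((h * t) • EuclideanSpace.single i (1 : ℝ))) t := by
  generalize he : EuclideanSpace.single i (1 : ℝ) = e
  have h1 := hηc.hasFDerivAt_convolution_right (ContinuousLinearMap.lsmul ℝ ℝ) hg.1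
    (hηs.of_le (by simp)) ((h * t) • e)
  have h2 : HasDerivAt (fun t : ℝ => (h * t) • e) (h • e) t := by
    simpa using (((hasDerivAt_id t).const_mul h).smul_const e)
  have h3 := h1.comp_hasDerivAt t h2
  refine h3.congr_deriv ?_
  rw [map_smul, smul_eq_mul]
  congr 1
  generalize (h * t) • e = y
  have hint : Integrable fun x => ((ContinuousLinearMap.lsmul ℝ ℝ).precompR
      (EuclideanSpace ℝ (Fin n))) (u x) (fderiv ℝ η (y - x)) :=
    (hηc.fderiv ℝ).convolutionExists_right _ hg.1 (hηs.continuous_fderiv (by simp)) _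
  have hψs : ContDiff ℝ (⊤ : ℕ∞) fun x => η (y - x) := hηs.comp (contDiff_const.sub contDiff_id)
  have hψc : HasCompactSupport fun x => η (y - x) := hηc.comp_homeomorph (Homeomorph.subLeft y)
  have hψd : ∀ x, fderiv ℝ (fun x => η (y - x)) x e = -(fderiv ℝ η (y - x) e) := fun x => by
    have h4 : HasFDerivAt η (fderiv ℝ η (y - x)) (y - x) :=
      (hηs.differentiable (by simp) _).hasFDerivAt
    have h5 := h4.comp x ((hasFDerivAt_id x).const_sub y)
    have h6 : fderiv ℝ (fun x => η (y - x)) x = _ := h5.fderiv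
    rw [h6]
    simp
  have h7 := hg.2.2 _ hψs hψc
  rw [he] at h7
  simp only [hψd, mul_neg, integral_neg, neg_inj] at h7
  rw [convolution_def, ContinuousLinearMap.integral_apply hint, convolution_def]
  exact h7

-- The fundamental theorem of calculus for the smooth function t ↦ ∫ u(x + h t eᵢ) φ(x) dx, a
-- convolution with the reflected φ evaluated along a line.
open scoped Convolution in
lemma HasWeakPartial.integral_incr_mul {i : Fin n} {u g : EuclideanSpace ℝ (Fin n) → ℝ}
    (hg : HasWeakPartial i u g) {φ : EuclideanSpace ℝ (Fin n) → ℝ} (hφ : ContDiff ℝ (⊤ : ℕ∞) φ)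
    (hφc : HasCompactSupport φ) (h : ℝ) :
    ∫ x, incr i u x h * φ x = h * ∫ t in (0 : ℝ)..1,
      ∫ x, g (x + (h * t) • EuclideanSpace.single i (1 : ℝ)) * φ x := by
  have hηs : ContDiff ℝ (⊤ : ℕ∞) fun y => φ (-y) := hφ.comp contDiff_neg
  have hηc : HasCompactSupport fun y => φ (-y) := hφc.comp_homeomorph (Homeomorph.neg _)
  have hcont : Continuous fun t : ℝ => h * (g ⋆[ContinuousLinearMap.lsmul ℝ ℝ, volume]
      fun y => φ (-y)) ((h * t) • EuclideanSpace.single i (1 : ℝ)) :=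
    continuous_const.mul ((hηc.continuous_convolution_right _ hg.2.1 hηs.continuous).comp
      (by fun_prop))
  have hftc := intervalIntegral.integral_eq_sub_of_hasDerivAt
    (fun t _ => hg.hasDerivAt_convolution_line hηs hηc h t) (hcont.intervalIntegrable 0 1)
  rw [intervalIntegral.integral_const_mul] at hftc
  simp only [convolution_line, mul_one, mul_zero, zero_smul, add_zero] at hftc
  rw [hftc]
  have hi1 : Integrable fun x => u (x + h • EuclideanSpace.single i (1 : ℝ)) * φ x := by
    have h8 := (integrable_mul_test hg.1 (φ := fun x =>
      φ (x - h • EuclideanSpace.single i (1 : ℝ))) (hφ.continuous.comp (by fun_prop))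
      (hφc.comp_homeomorph (Homeomorph.subRight _))).comp_add_right
      (h • EuclideanSpace.single i (1 : ℝ))
    simpa only [add_sub_cancel_right] using h8
  rw [← integral_sub hi1 (integrable_mul_test hg.1 hφ.continuous hφc)]
  refine integral_congr_ae (ae_of_all _ fun x => ?_)
  simp only [incr, sub_mul]

lemma memLp_incr (i : Fin n) {p : ℝ≥0∞} {u : EuclideanSpace ℝ (Fin n) → ℝ} (hu : MemLp u p)
    (h : ℝ) : MemLp (fun x => incr i u x h) p :=
  (hu.comp_measurePreserving (measurePreserving_add_right volume _)).sub hu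

lemma one_le_ofReal {p : ℝ} (hp : 1 < p) : 1 ≤ ENNReal.ofReal p := by simpa using hp.le

/-- The increments of `u` are obtained by integrating its weak derivative. -/
lemma HasWeakPartial.incr_ae_eq {i : Fin n} {u g : EuclideanSpace ℝ (Fin n) → ℝ} {p : ℝ}
    (hp : 1 < p) (hg : HasWeakPartial i u g) (hu : MemLp u (ENNReal.ofReal p))
    (hgp : MemLp g (ENNReal.ofReal p)) (h : ℝ) :
    (fun x => incr i u x h) =ᵐ[volume] fun x => h * ∫ t in Set.Ioc (0 : ℝ) 1,
      g (x + (h * t) • EuclideanSpace.single i (1 : ℝ)) := by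
  have hpq := Real.HolderConjugate.conjExponent hp
  have hG := memLp_shear i (ν := volume.restrict (Set.Ioc (0 : ℝ) 1)) h hgp
  have h1 := memLp_fibre_integral hp hG
  refine ae_eq_of_integral_contDiff_smul_eq ((memLp_incr i hu h).locallyIntegrable
    (one_le_ofReal hp)) ((h1.const_mul h).locallyIntegrable (one_le_ofReal hp)) fun φ hφ hφc => ?_
  simp only [smul_eq_mul, mul_comm (φ _)]
  rw [hg.integral_incr_mul hφ hφc h, intervalIntegral.integral_of_le zero_le_one]
  have hφq : MemLp φ (ENNReal.ofReal p.conjExponent) :=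
    hφ.continuous.memLp_of_hasCompactSupport hφc
  have hint : Integrable (fun z : EuclideanSpace ℝ (Fin n) × ℝ =>
      g (z.1 + (h * z.2) • EuclideanSpace.single i (1 : ℝ)) * φ z.1)
      (volume.prod (volume.restrict (Set.Ioc (0 : ℝ) 1))) :=
    integrable_mul_of_holderConjugate hpq hG (hφq.comp_fst _)
  rw [← integral_integral_swap (f := fun x t =>
    g (x + (h * t) • EuclideanSpace.single i (1 : ℝ)) * φ x) hint, ← integral_const_mul]
  refine integral_congr_ae (ae_of_all _ fun x => ?_)
  simp only
  rw [integral_mul_const]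
  ring

/-- Continuity of translations in `L^p`, restated without the quotient space. -/
lemma tendsto_lintegral_translate_sub {p : ℝ} (hp : 1 < p) (i : Fin n)
    {g : EuclideanSpace ℝ (Fin n) → ℝ} (hg : MemLp g (ENNReal.ofReal p)) :
    Tendsto (fun t : ℝ => ∫⁻ x, ‖g (x + t • EuclideanSpace.single i (1 : ℝ)) - g x‖ₑ ^ p)
      (𝓝 0) (𝓝 0) := by
  have hp1 : Fact (1 ≤ ENNReal.ofReal p) := ⟨one_le_ofReal hp⟩
  set e : EuclideanSpace ℝ (Fin n) := EuclideanSpace.single i (1 : ℝ)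
  let Γ : C(ℝ, C(EuclideanSpace ℝ (Fin n), EuclideanSpace ℝ (Fin n))) :=
    (ContinuousMap.mk (fun z : ℝ × EuclideanSpace ℝ (Fin n) => z.2 + z.1 • e)
      (by fun_prop)).curry
  have hΓ : ∀ t, MeasurePreserving (Γ t) := fun t => measurePreserving_add_right volume (t • e)
  have h1 := (tendsto_const_nhds (x := hg.toLp g) (f := 𝓝 (0 : ℝ))).compMeasurePreservingLp
    (Γ.continuous.tendsto 0) hΓ (hΓ 0) ENNReal.ofReal_ne_top
  rw [tendsto_iff_edist_tendsto_0] at h1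
  have hp0 : 0 < p := by linarith
  have h2 := (ENNReal.continuous_rpow_const (y := p)).tendsto 0 |>.comp h1
  rw [ENNReal.zero_rpow_of_pos hp0] at h2
  refine h2.congr fun t => ?_
  simp only [Function.comp_apply]
  rw [Lp.toLp_compMeasurePreserving, Lp.toLp_compMeasurePreserving, Lp.edist_toLp_toLp,
    eLpNorm_rpow_eq_lintegral hp]
  refine lintegral_congr fun x => ?_
  simp [Γ]

lemma lintegral_average_le {p : ℝ} (hp : 1 < p) {F : EuclideanSpace ℝ (Fin n) × ℝ → ℝ}
    (hF : AEStronglyMeasurable F (volume.prod (volume.restrict (Set.Ioc (0 : ℝ) 1)))) {B : ℝ≥0∞}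
    (hB : ∀ t ∈ Set.Ioc (0 : ℝ) 1, ∫⁻ x, ‖F (x, t)‖ₑ ^ p ≤ B) :
    ∫⁻ x, ‖∫ t in Set.Ioc (0 : ℝ) 1, F (x, t)‖ₑ ^ p ≤ B := by
  refine (lintegral_fibre_integral_le hp volume _ hF).trans ?_
  rw [lintegral_prod_symm _ (hF.enorm.pow_const p)]
  calc _ ≤ (volume.restrict (Set.Ioc (0 : ℝ) 1)) Set.univ ^ (p - 1) *
        ∫⁻ _t in Set.Ioc (0 : ℝ) 1, B := by
        gcongr 1
        exact setLIntegral_mono' measurableSet_Ioc hB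
    _ = B := by simp

lemma HasWeakPartial.lintegral_quotient_le {i : Fin n} {u g : EuclideanSpace ℝ (Fin n) → ℝ} {p : ℝ}
    (hp : 1 < p) (hg : HasWeakPartial i u g) (hu : MemLp u (ENNReal.ofReal p))
    (hgp : MemLp g (ENNReal.ofReal p)) {h : ℝ} (hh : h ≠ 0) :
    ∫⁻ x, ‖incr i u x h / h‖ₑ ^ p ≤ ∫⁻ x, ‖g x‖ₑ ^ p := by
  have hG := memLp_shear i (ν := volume.restrict (Set.Ioc (0 : ℝ) 1)) h hgp
  have hB : ∀ t ∈ Set.Ioc (0 : ℝ) 1, ∫⁻ x,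
      ‖g (x + (h * t) • EuclideanSpace.single i (1 : ℝ))‖ₑ ^ p ≤ ∫⁻ x, ‖g x‖ₑ ^ p := fun t _ =>
    (lintegral_add_right_eq_self (fun x => ‖g x‖ₑ ^ p) _).le
  refine le_trans (le_of_eq (lintegral_congr_ae ?_)) (lintegral_average_le hp hG.1 hB)
  filter_upwards [hg.incr_ae_eq hp hu hgp h] with x hx
  rw [hx, mul_div_cancel_left₀ _ hh]

/-- The quotient minus g is the average over t in (0, 1] of translates of g minus g, so its norm is
bounded by that of the worst translate. -/
lemma HasWeakPartial.lintegral_quotient_sub_le {i : Fin n} {u g : EuclideanSpace ℝ (Fin n) → ℝ}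
    {p : ℝ} (hp : 1 < p) (hg : HasWeakPartial i u g) (hu : MemLp u (ENNReal.ofReal p))
    (hgp : MemLp g (ENNReal.ofReal p)) {ε : ℝ≥0∞} (hε : 0 < ε) :
    ∃ r : ℝ, 0 < r ∧ ∀ h : ℝ, h ≠ 0 → |h| ≤ r →
      ∫⁻ x, ‖incr i u x h / h - g x‖ₑ ^ p ≤ ε := by
  have h1 := (tendsto_lintegral_translate_sub hp i hgp).eventually (ge_mem_nhds hε)
  obtain ⟨r, hr, hball⟩ := Metric.eventually_nhds_iff_ball.1 h1
  refine ⟨r / 2, by positivity, fun h hh hhr => ?_⟩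
  have hG := memLp_shear i (ν := volume.restrict (Set.Ioc (0 : ℝ) 1)) h hgp
  have hF := hG.sub (hgp.comp_fst (volume.restrict (Set.Ioc (0 : ℝ) 1)))
  refine le_trans (le_of_eq (lintegral_congr_ae ?_)) (lintegral_average_le hp hF.1
    (B := ε) fun t ht => hball (h * t) ?_)
  · have h2 : ∀ᵐ x, Integrable (fun t => g (x + (h * t) • EuclideanSpace.single i (1 : ℝ)))
        (volume.restrict (Set.Ioc (0 : ℝ) 1)) := by
      have h3 := (memLp_iff_lintegral_lt_top hp hG.1).1 hG
      rw [lintegral_prod _ (hG.1.enorm.pow_const p)] at h3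
      have h4 := ae_lt_top' ((hG.1.enorm.pow_const p).lintegral_prod_right') h3.ne
      filter_upwards [h4, hG.1.prodMk_left] with x hx hxm
      exact ((memLp_iff_lintegral_lt_top hp hxm).2 hx).integrable (one_le_ofReal hp)
    filter_upwards [hg.incr_ae_eq hp hu hgp h, h2] with x hx hx2
    rw [hx, mul_div_cancel_left₀ _ hh]
    simp only [Pi.sub_apply]
    rw [integral_sub hx2 (integrable_const _)]
    simp
  · rw [Metric.mem_ball, dist_zero_right, norm_mul, Real.norm_eq_abs, Real.norm_eq_abs,
      abs_of_pos ht.1]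
    calc |h| * t ≤ |h| * 1 := by gcongr; exact ht.2
      _ < r := by linarith

end WeakDerivative

/-! ### The measure on the steps attached to a horizon. -/

/-- The weight of the truncated Gagliardo energy of horizon `δ > 0`, after the increments have been
replaced by difference quotients. -/
def horizonDensity (s p δ h : ℝ) : ℝ := δ ^ (-(p * (1 - s))) * |h| ^ (p * (1 - s) - 1)

/-- The measure on the steps associated to the horizon `δ`; its mass `2 / (p (1 - s))` does not
depend on `δ`, and it is concentrated at the origin if `δ = 0`. -/
def horizonMeasure (s p δ : ℝ) : Measure ℝ :=
  if δ = 0 then ENNReal.ofReal (2 / (p * (1 - s))) • Measure.dirac 0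
  else (volume.restrict (Set.Icc (-δ) δ)).withDensity
    fun h => ENNReal.ofReal (horizonDensity s p δ h)

/-- The difference quotient of `u`, or its weak derivative if the horizon is `0`. -/
def dirQuot {n : ℕ} (i : Fin n) (δ : ℝ) (u : EuclideanSpace ℝ (Fin n) → ℝ)
    (z : EuclideanSpace ℝ (Fin n) × ℝ) : ℝ :=
  if δ = 0 then weakPartial i u z.1 else incr i u z.1 z.2 / z.2

section HorizonMeasure

variable {s p δ : ℝ}

lemma measurable_horizonDensity : Measurable fun h => ENNReal.ofReal (horizonDensity s p δ h) := by
  unfold horizonDensity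
  fun_prop

lemma horizonDensity_nonneg (hδ : 0 ≤ δ) (h : ℝ) : 0 ≤ horizonDensity s p δ h := by
  unfold horizonDensity
  positivity

lemma lintegral_horizonDensity (hs : s < 1) (hp : 1 < p) (hδ : 0 < δ) :
    ∫⁻ h in Set.Icc (-δ) δ, ENNReal.ofReal (horizonDensity s p δ h) =
      ENNReal.ofReal (2 / (p * (1 - s))) := by
  set a := p * (1 - s) with ha
  have ha0 : 0 < a := mul_pos (by linarith) (by linarith)
  set F : ℝ → ℝ := (Set.Iic δ).indicator fun x => δ ^ (-a) * x ^ (a - 1) with hF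
  have hind : (fun h => F |h|) = (Set.Icc (-δ) δ).indicator (horizonDensity s p δ) := by
    funext h
    by_cases hh : |h| ≤ δ
    · rw [hF, Set.indicator_of_mem (show |h| ∈ Set.Iic δ from hh),
        Set.indicator_of_mem (Set.mem_Icc.2 (abs_le.1 hh)), horizonDensity]
    · rw [hF, Set.indicator_of_notMem (show |h| ∉ Set.Iic δ from hh),
        Set.indicator_of_notMem fun h' => hh (abs_le.2 (Set.mem_Icc.1 h'))]
  have hval : ∫ h, F |h| = 2 / a := by
    rw [integral_comp_abs, hF, setIntegral_indicator measurableSet_Iic, Set.Ioi_inter_Iic,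
      integral_const_mul, ← intervalIntegral.integral_of_le hδ.le,
      integral_rpow (Or.inl (by linarith)), sub_add_cancel, Real.zero_rpow ha0.ne', sub_zero,
      Real.rpow_neg hδ.le]
    have := Real.rpow_pos_of_pos hδ a
    field_simp
  have hint : Integrable fun h => F |h| := by
    -- A function that is not integrable has Bochner integral 0, so the nonzero value just computed
    -- gives integrability.
    refine Integrable.of_integral_ne_zero ?_
    rw [hval]
    positivity
  have hnn : ∀ h, 0 ≤ F |h| := fun h => by
    rw [show F |h| = (fun h => F |h|) h from rfl, hind]
    exact Set.indicator_nonneg (fun h _ => horizonDensity_nonneg hδ.le h) h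
  rw [← hval, ofReal_integral_eq_lintegral_ofReal hint (ae_of_all _ hnn),
    ← lintegral_indicator measurableSet_Icc]
  refine lintegral_congr fun h => ?_
  rw [show F |h| = (fun h => F |h|) h from rfl, hind]
  by_cases hh : h ∈ Set.Icc (-δ) δ
  · rw [Set.indicator_of_mem hh, Set.indicator_of_mem hh]
  · rw [Set.indicator_of_notMem hh, Set.indicator_of_notMem hh, ENNReal.ofReal_zero]

lemma horizonMeasure_univ (hs : s < 1) (hp : 1 < p) (hδ : 0 ≤ δ) :
    horizonMeasure s p δ Set.univ = ENNReal.ofReal (2 / (p * (1 - s))) := by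
  unfold horizonMeasure
  split_ifs with h
  · simp
  · rw [withDensity_apply _ MeasurableSet.univ, Measure.restrict_univ,
      lintegral_horizonDensity hs hp (lt_of_le_of_ne hδ (Ne.symm h))]

lemma isFiniteMeasure_horizonMeasure (hs : s < 1) (hp : 1 < p) (hδ : 0 ≤ δ) :
    IsFiniteMeasure (horizonMeasure s p δ) :=
  ⟨by rw [horizonMeasure_univ hs hp hδ]; exact ENNReal.ofReal_lt_top⟩

lemma lintegral_horizonMeasure (hδ : 0 < δ) (F : ℝ → ℝ≥0∞) :
    ∫⁻ h, F h ∂(horizonMeasure s p δ) =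
      ∫⁻ h in Set.Icc (-δ) δ, ENNReal.ofReal (horizonDensity s p δ h) * F h := by
  rw [horizonMeasure, if_neg hδ.ne', lintegral_withDensity_eq_lintegral_mul_non_measurable _
    measurable_horizonDensity (ae_of_all _ fun _ => ENNReal.ofReal_lt_top)]
  rfl

lemma integral_horizonMeasure (hδ : 0 < δ) (F : ℝ → ℝ) :
    ∫ h, F h ∂(horizonMeasure s p δ) =
      ∫ h in Set.Icc (-δ) δ, horizonDensity s p δ h * F h := by
  rw [horizonMeasure, if_neg hδ.ne', integral_withDensity_eq_integral_toReal_smul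
    measurable_horizonDensity (ae_of_all _ fun _ => ENNReal.ofReal_lt_top)]
  refine integral_congr_ae (ae_of_all _ fun h => ?_)
  simp only [ENNReal.toReal_ofReal (horizonDensity_nonneg hδ.le h), smul_eq_mul]

lemma ae_horizonMeasure (hδ : 0 < δ) :
    ∀ᵐ h ∂(horizonMeasure s p δ), h ≠ 0 ∧ |h| ≤ δ := by
  rw [horizonMeasure, if_neg hδ.ne']
  refine (withDensity_absolutelyContinuous _ _).ae_le ?_
  have h1 : ∀ᵐ h ∂(volume.restrict (Set.Icc (-δ) δ)), h ≠ 0 :=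
    ae_restrict_of_ae (Measure.ae_ne volume 0)
  filter_upwards [h1, ae_restrict_mem measurableSet_Icc] with h hh hh'
  exact ⟨hh, abs_le.2 hh'⟩

/-- The quotients X/h and Y/h contribute |h|^(-p) in total, and the exponent of the density minus p
is -(1 + s p), that of the Gagliardo kernel. -/
lemma horizonDensity_mul_signedPow (hδ : 0 < δ) (hsp : 0 < 1 + s * p) (X Y h : ℝ) :
    horizonDensity s p δ h * (signedPow p (X / h) * (Y / h)) =
      1 / δ ^ (p * (1 - s)) * (|X| ^ (p - 2) * X * Y / |h| ^ (1 + s * p)) := by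
  rcases eq_or_ne h 0 with rfl | hh
  -- Both sides vanish at h = 0 by the convention for division by zero.
  · simp [Real.zero_rpow hsp.ne']
  · have ha : 0 < |h| := abs_pos.2 hh
    have h1 : |h| ^ (p * (1 - s) - 1) = |h| ^ (p - 2) * h ^ 2 / |h| ^ (1 + s * p) := by
      rw [← sq_abs, ← Real.rpow_two, ← Real.rpow_add ha, ← Real.rpow_sub ha]
      congr 1
      ring
    have h2 := Real.rpow_pos_of_pos ha (p - 2)
    have h3 := Real.rpow_pos_of_pos hδ (p * (1 - s))
    have h4 := Real.rpow_pos_of_pos ha (1 + s * p)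
    rw [horizonDensity, signedPow, h1, abs_div, Real.div_rpow (abs_nonneg _) ha.le,
      Real.rpow_neg hδ.le]
    field_simp

lemma horizonDensity_mul_abs_rpow (hδ : 0 < δ) (hp : 1 < p) (hsp : 0 < 1 + s * p) (X h : ℝ) :
    horizonDensity s p δ h * |X / h| ^ p =
      1 / δ ^ (p * (1 - s)) * (|X| ^ p / |h| ^ (1 + s * p)) := by
  rw [← signedPow_mul_self hp, horizonDensity_mul_signedPow hδ hsp, ← signedPow_mul_self hp]
  rfl

end HorizonMeasure

/-! ### Energies and forms through quotients on the product space. -/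

section DirQuot

variable {n : ℕ} {i : Fin n} {s p δ : ℝ} {u v : EuclideanSpace ℝ (Fin n) → ℝ}

lemma aestronglyMeasurable_dirQuot (hδ : δ ≠ 0) (hu : AEStronglyMeasurable u) (ν : Measure ℝ)
    [SFinite ν] : AEStronglyMeasurable (dirQuot i δ u) (volume.prod ν) := by
  have h1 := hu.comp_fst (ν := ν)
  have h2 := h1.comp_measurePreserving (measurePreserving_shear i ν 1)
  have h3 : AEStronglyMeasurable (fun z : EuclideanSpace ℝ (Fin n) × ℝ => incr i u z.1 z.2)
      (volume.prod ν) :=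
    (h2.sub h1).congr (ae_of_all _ fun z => by simp [incr])
  refine (h3.aemeasurable.div measurable_snd.aemeasurable).aestronglyMeasurable.congr
    (ae_of_all _ fun z => ?_)
  simp [dirQuot, hδ]

lemma lintegral_dirQuot (hs : 0 < s ∧ s < 1) (hp : 1 < p) (hδ : 0 < δ)
    (hu : AEStronglyMeasurable u) :
    ∫⁻ z, ‖dirQuot i δ u z‖ₑ ^ p ∂(volume.prod (horizonMeasure s p δ)) =
      ENNReal.ofReal (1 / δ ^ (p * (1 - s))) * gagliardo i s p δ u := by
  have := isFiniteMeasure_horizonMeasure hs.2 hp hδ.le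
  have hsp : 0 < 1 + s * p := by nlinarith
  rw [lintegral_prod _ ((aestronglyMeasurable_dirQuot hδ.ne' hu _).enorm.pow_const p), gagliardo,
    ← lintegral_const_mul' _ _ ENNReal.ofReal_ne_top]
  refine lintegral_congr fun x => ?_
  rw [lintegral_horizonMeasure hδ, ← lintegral_const_mul' _ _ ENNReal.ofReal_ne_top]
  refine lintegral_congr fun h => ?_
  rw [enorm_rpow_eq_ofReal hp, ← ENNReal.ofReal_mul (horizonDensity_nonneg hδ.le h), dirQuot,
    if_neg hδ.ne', horizonDensity_mul_abs_rpow hδ hp hsp, ENNReal.ofReal_mul (by positivity)]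

lemma MemWi.memLp_dirQuot (hs : 0 < s ∧ s < 1) (hp : 1 < p) (hδ : 0 ≤ δ) (hu : MemWi i s p δ u) :
    MemLp (dirQuot i δ u) (ENNReal.ofReal p) (volume.prod (horizonMeasure s p δ)) := by
  have := isFiniteMeasure_horizonMeasure hs.2 hp hδ
  obtain ⟨hu1, hu2⟩ := hu
  rcases hδ.eq_or_lt with rfl | hδ'
  · rw [if_pos rfl] at hu2
    obtain ⟨g, hg, hgp⟩ := hu2
    have h1 : MemLp (weakPartial i u) (ENNReal.ofReal p) :=
      hgp.ae_eq hg.weakPartial_ae_eq.symm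
    refine (h1.comp_fst (horizonMeasure s p 0)).ae_eq (ae_of_all _ fun z => ?_)
    simp [dirQuot]
  · rw [if_neg hδ'.ne'] at hu2
    rw [memLp_iff_lintegral_lt_top hp (aestronglyMeasurable_dirQuot hδ'.ne' hu1.1 _),
      lintegral_dirQuot hs hp hδ' hu1.1]
    exact ENNReal.mul_lt_top ENNReal.ofReal_lt_top hu2

lemma memWi_of_memLp_dirQuot (hs : 0 < s ∧ s < 1) (hp : 1 < p) (hδ : 0 < δ)
    (hu : MemLp u (ENNReal.ofReal p))
    (hq : MemLp (dirQuot i δ u) (ENNReal.ofReal p) (volume.prod (horizonMeasure s p δ))) :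
    MemWi i s p δ u := by
  refine ⟨hu, ?_⟩
  rw [if_neg hδ.ne']
  have h1 := (memLp_iff_lintegral_lt_top hp hq.1).1 hq
  rw [lintegral_dirQuot hs hp hδ hu.1] at h1
  have h2 := Real.rpow_pos_of_pos hδ (p * (1 - s))
  refine (ENNReal.mul_lt_top_iff.1 h1).elim And.right fun h3 => h3.elim (fun h4 => ?_) fun h4 => ?_
  · exact absurd (ENNReal.ofReal_eq_zero.1 h4) (not_le.2 (by positivity))
  · rw [h4]
    exact ENNReal.zero_lt_top

/-- This unifies the two kinds of directions: for δ = 0 the mass of the Dirac measure is exactly the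
constant of the local form. Membership of u and v makes the integrand integrable, as Fubini's
theorem requires. -/
lemma formI_eq_integral (hs : 0 < s ∧ s < 1) (hp : 1 < p) (hδ : 0 ≤ δ) (hu : MemWi i s p δ u)
    (hv : MemWi i s p δ v) :
    formI i s p δ u v = ∫ z, signedPow p (dirQuot i δ u z) * dirQuot i δ v z
      ∂(volume.prod (horizonMeasure s p δ)) := by
  have := isFiniteMeasure_horizonMeasure hs.2 hp hδ
  have hint := integrable_signedPow_mul hp (hu.memLp_dirQuot hs hp hδ) (hv.memLp_dirQuot hs hp hδ)
  have hsp : 0 < 1 + s * p := by nlinarith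
  rw [integral_prod _ hint, formI]
  rcases hδ.eq_or_lt with rfl | hδ'
  · rw [if_pos rfl, ← integral_const_mul]
    refine integral_congr_ae (ae_of_all _ fun x => ?_)
    have hc : 0 ≤ 2 / (p * (1 - s)) := by
      have : 0 < 1 - s := by linarith
      positivity
    simp [horizonMeasure, dirQuot, signedPow, ENNReal.toReal_ofReal hc]
  · rw [if_neg hδ'.ne', ← integral_const_mul]
    refine integral_congr_ae (ae_of_all _ fun x => ?_)
    simp only
    rw [integral_horizonMeasure hδ', ← integral_const_mul]
    refine integral_congr_ae (ae_of_all _ fun h => ?_)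
    simp only [dirQuot, if_neg hδ'.ne', horizonDensity_mul_signedPow hδ' hsp]

/-- For δ = 0 the identity holds only almost everywhere, since `weakPartial` is a chosen
representative. -/
lemma dirQuot_add_const_mul (hs : 0 < s ∧ s < 1) (hp : 1 < p) (hδ : 0 ≤ δ) (hu : MemWi i s p δ u)
    (hv : MemWi i s p δ v) (c : ℝ) :
    dirQuot i δ (fun x => u x + c * v x) =ᵐ[volume.prod (horizonMeasure s p δ)]
      fun z => dirQuot i δ u z + c * dirQuot i δ v z := by
  have := isFiniteMeasure_horizonMeasure hs.2 hp hδ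
  rcases hδ.eq_or_lt with rfl | hδ'
  · obtain ⟨-, hu2⟩ := hu
    obtain ⟨-, hv2⟩ := hv
    rw [if_pos rfl] at hu2 hv2
    obtain ⟨g, hg, -⟩ := hu2
    obtain ⟨g', hg', -⟩ := hv2
    have h1 := (hg.hasWeakPartial_weakPartial.add_const_mul
      hg'.hasWeakPartial_weakPartial c).weakPartial_ae_eq
    have h2 := (Measure.quasiMeasurePreserving_fst (μ := (volume : Measure
      (EuclideanSpace ℝ (Fin n)))) (ν := horizonMeasure s p 0)).ae h1
    filter_upwards [h2] with z hz
    simpa only [dirQuot, if_true] using hz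
  · refine ae_of_all _ fun z => ?_
    simp only [dirQuot, if_neg hδ'.ne', incr]
    ring

lemma MemWi.add_const_mul (hu : MemWi i s p δ u) (hv : MemWi i s p δ v) (hs : 0 < s ∧ s < 1)
    (hp : 1 < p) (hδ : 0 ≤ δ) (c : ℝ) : MemWi i s p δ fun x => u x + c * v x := by
  rcases hδ.eq_or_lt with rfl | hδ'
  · obtain ⟨hu1, hu2⟩ := hu
    obtain ⟨hv1, hv2⟩ := hv
    refine ⟨hu1.add (hv1.const_mul c), ?_⟩
    rw [if_pos rfl] at hu2 hv2 ⊢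
    obtain ⟨g, hg, hgp⟩ := hu2
    obtain ⟨g', hg', hgp'⟩ := hv2
    exact ⟨_, hg.add_const_mul hg' c, hgp.add (hgp'.const_mul c)⟩
  · refine memWi_of_memLp_dirQuot hs hp hδ' (hu.1.add (hv.1.const_mul c)) ?_
    exact ((hu.memLp_dirQuot hs hp hδ).add ((hv.memLp_dirQuot hs hp hδ).const_mul c)).ae_eq
      (dirQuot_add_const_mul hs hp hδ hu hv c).symm

lemma truncEnergy_le_lintegral_dirQuot (hs : 0 < s ∧ s < 1) (hp : 1 < p) (hδ : 0 < δ)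
    (hu : AEStronglyMeasurable u) :
    ENNReal.ofReal (δ ^ (-(p * (1 - s)))) * truncEnergy i s p δ u ≤
      ∫⁻ z, ‖dirQuot i δ u z‖ₑ ^ p ∂(volume.prod (horizonMeasure s p δ)) := by
  have := isFiniteMeasure_horizonMeasure hs.2 hp hδ.le
  have hsp : 0 < 1 + s * p := by nlinarith
  rw [lintegral_prod_symm _ ((aestronglyMeasurable_dirQuot hδ.ne' hu _).enorm.pow_const p),
    lintegral_horizonMeasure hδ, truncEnergy, ← lintegral_const_mul' _ _ ENNReal.ofReal_ne_top]
  have hsub : Set.Ioc 0 δ ⊆ Set.Icc (-δ) δ := fun h hh => ⟨by linarith [hh.1], hh.2⟩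
  refine le_trans ?_ (lintegral_mono_set hsub)
  refine setLIntegral_mono' measurableSet_Ioc fun h hh => ?_
  rw [incrEnergy, ← lintegral_mul_const' _ _ ENNReal.ofReal_ne_top,
    ← lintegral_const_mul' _ _ ENNReal.ofReal_ne_top,
    ← lintegral_const_mul' _ _ ENNReal.ofReal_ne_top]
  refine lintegral_mono fun x => le_of_eq ?_
  rw [enorm_rpow_eq_ofReal hp, enorm_rpow_eq_ofReal hp, dirQuot, if_neg hδ.ne',
    ← ENNReal.ofReal_mul (by positivity), ← ENNReal.ofReal_mul (by positivity),
    ← ENNReal.ofReal_mul (horizonDensity_nonneg hδ.le h), horizonDensity_mul_abs_rpow hδ hp hsp,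
    abs_of_pos hh.1, Real.rpow_neg hδ.le, Real.rpow_neg hh.1.le]
  congr 1
  ring

lemma lintegral_dirQuot_zero (hs : 0 < s ∧ s < 1) (hp : 1 < p) {g : EuclideanSpace ℝ (Fin n) → ℝ}
    (hg : HasWeakPartial i u g) (hgp : MemLp g (ENNReal.ofReal p)) :
    ∫⁻ z, ‖dirQuot i 0 u z‖ₑ ^ p ∂(volume.prod (horizonMeasure s p 0)) =
      ENNReal.ofReal (2 / (p * (1 - s))) * ∫⁻ x, ‖g x‖ₑ ^ p := by
  have := isFiniteMeasure_horizonMeasure (s := s) hs.2 hp le_rfl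
  have hw : MemLp (weakPartial i u) (ENNReal.ofReal p) := hgp.ae_eq hg.weakPartial_ae_eq.symm
  have h1 : ∀ z : EuclideanSpace ℝ (Fin n) × ℝ, dirQuot i 0 u z = weakPartial i u z.1 := fun z => by
    simp [dirQuot]
  simp only [h1]
  rw [lintegral_prod_symm _ ((hw.1.comp_fst).enorm.pow_const p)]
  simp only [lintegral_const]
  rw [horizonMeasure_univ hs.2 hp le_rfl, mul_comm]
  congr 1
  refine lintegral_congr_ae ?_
  filter_upwards [hg.weakPartial_ae_eq] with x hx
  rw [hx]

lemma HasWeakPartial.lintegral_dirQuot_le (hs : 0 < s ∧ s < 1) (hp : 1 < p) (hδ : 0 < δ)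
    {g : EuclideanSpace ℝ (Fin n) → ℝ} (hg : HasWeakPartial i u g)
    (hu : MemLp u (ENNReal.ofReal p)) (hgp : MemLp g (ENNReal.ofReal p)) :
    ∫⁻ z, ‖dirQuot i δ u z‖ₑ ^ p ∂(volume.prod (horizonMeasure s p δ)) ≤
      ENNReal.ofReal (2 / (p * (1 - s))) * ∫⁻ x, ‖g x‖ₑ ^ p := by
  have := isFiniteMeasure_horizonMeasure hs.2 hp hδ.le
  rw [lintegral_prod_symm _ ((aestronglyMeasurable_dirQuot hδ.ne' hu.1 _).enorm.pow_const p),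
    ← horizonMeasure_univ hs.2 hp hδ.le, mul_comm, ← lintegral_const]
  refine lintegral_mono_ae ?_
  filter_upwards [ae_horizonMeasure hδ] with h hh
  simp only [dirQuot, if_neg hδ.ne']
  exact hg.lintegral_quotient_le hp hu hgp hh.1

/-- Local regularity implies nonlocal regularity for every horizon. -/
lemma MemWi.of_zero (hu : MemWi i s p 0 u) (hs : 0 < s ∧ s < 1) (hp : 1 < p) (hδ : 0 ≤ δ) :
    MemWi i s p δ u := by
  rcases hδ.eq_or_lt with rfl | hδ'
  · exact hu
  have := isFiniteMeasure_horizonMeasure hs.2 hp hδ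
  obtain ⟨hu1, hu2⟩ := hu
  rw [if_pos rfl] at hu2
  obtain ⟨g, hg, hgp⟩ := hu2
  refine memWi_of_memLp_dirQuot hs hp hδ' hu1 ?_
  rw [memLp_iff_lintegral_lt_top hp (aestronglyMeasurable_dirQuot hδ'.ne' hu1.1 _)]
  exact (hg.lintegral_dirQuot_le hs hp hδ' hu1 hgp).trans_lt
    (ENNReal.mul_lt_top ENNReal.ofReal_lt_top ((memLp_iff_lintegral_lt_top hp hgp.1).1 hgp))

/-- The difference quotients converge to the weak derivative as the horizon tends to zero. -/
lemma HasWeakPartial.exists_lintegral_dirQuot_sub_le (hs : 0 < s ∧ s < 1) (hp : 1 < p)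
    {g : EuclideanSpace ℝ (Fin n) → ℝ} (hg : HasWeakPartial i u g)
    (hu : MemLp u (ENNReal.ofReal p)) (hgp : MemLp g (ENNReal.ofReal p)) {ε : ℝ≥0∞} (hε : 0 < ε) :
    ∃ r : ℝ, 0 < r ∧ ∀ δ : ℝ, 0 < δ → δ ≤ r →
      ∫⁻ z, ‖dirQuot i δ u z - g z.1‖ₑ ^ p ∂(volume.prod (horizonMeasure s p δ)) ≤
        ε * ENNReal.ofReal (2 / (p * (1 - s))) := by
  obtain ⟨r, hr, h1⟩ := hg.lintegral_quotient_sub_le hp hu hgp hε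
  refine ⟨r, hr, fun δ hδ hδr => ?_⟩
  have := isFiniteMeasure_horizonMeasure hs.2 hp hδ.le
  have hm : AEStronglyMeasurable (fun z => dirQuot i δ u z - g z.1)
      (volume.prod (horizonMeasure s p δ)) :=
    (aestronglyMeasurable_dirQuot hδ.ne' hu.1 _).sub hgp.1.comp_fst
  rw [lintegral_prod_symm _ (hm.enorm.pow_const p), ← horizonMeasure_univ hs.2 hp hδ.le,
    ← lintegral_const]
  refine lintegral_mono_ae ?_
  filter_upwards [ae_horizonMeasure hδ] with h hh
  simp only [dirQuot, if_neg hδ.ne']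
  exact h1 h hh.1 (hh.2.trans hδr)

/-- The energies control the full Gagliardo energy and the `L^p` norm, uniformly with respect to
the horizon. -/
lemma exists_halfEnergy_le_dirQuot (i : Fin n) {Ω : Set (EuclideanSpace ℝ (Fin n))}
    (hΩ : Bornology.IsBounded Ω) (hs : 0 < s ∧ s < 1) (hp : 1 < p) (D : ℝ) :
    ∃ C : ℝ, 0 ≤ C ∧ ∀ δ : ℝ, 0 ≤ δ → δ ≤ D → ∀ u : EuclideanSpace ℝ (Fin n) → ℝ,
      MemWi i s p δ u → (∀ᵐ x, x ∉ Ω → u x = 0) →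
      halfEnergy i s p u ≤ ENNReal.ofReal C *
        ∫⁻ z, ‖dirQuot i δ u z‖ₑ ^ p ∂(volume.prod (horizonMeasure s p δ)) ∧
      ∫⁻ x, ‖u x‖ₑ ^ p ≤ ENNReal.ofReal C *
        ∫⁻ z, ‖dirQuot i δ u z‖ₑ ^ p ∂(volume.prod (horizonMeasure s p δ)) := by
  -- Horizon 1 is included because the case δ = 0 is reduced to it: the energy of horizon 1 is at
  -- most the local one.
  obtain ⟨C, hC, h⟩ := exists_energy_le_scaled i hΩ hs hp (max D 1)
  have key : ∀ δ : ℝ, 0 < δ → δ ≤ max D 1 → ∀ u : EuclideanSpace ℝ (Fin n) → ℝ,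
      AEStronglyMeasurable u → (∀ᵐ x, x ∉ Ω → u x = 0) →
      halfEnergy i s p u ≤ ENNReal.ofReal C *
        ∫⁻ z, ‖dirQuot i δ u z‖ₑ ^ p ∂(volume.prod (horizonMeasure s p δ)) ∧
      ∫⁻ x, ‖u x‖ₑ ^ p ≤ ENNReal.ofReal C *
        ∫⁻ z, ‖dirQuot i δ u z‖ₑ ^ p ∂(volume.prod (horizonMeasure s p δ)) := by
    intro δ hδ hδD u hu hu0
    have h1 : ENNReal.ofReal (C * δ ^ (-(p * (1 - s)))) * truncEnergy i s p δ u ≤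
        ENNReal.ofReal C *
          ∫⁻ z, ‖dirQuot i δ u z‖ₑ ^ p ∂(volume.prod (horizonMeasure s p δ)) := by
      rw [ENNReal.ofReal_mul hC, mul_assoc]
      gcongr
      exact truncEnergy_le_lintegral_dirQuot hs hp hδ hu
    obtain ⟨h2, h3⟩ := h δ hδ hδD u hu hu0
    exact ⟨h2.trans h1, h3.trans h1⟩
  refine ⟨C, hC, fun δ hδ hδD u hu hu0 => ?_⟩
  rcases hδ.eq_or_lt with rfl | hδ'
  · obtain ⟨hu1, hu2⟩ := hu
    rw [if_pos rfl] at hu2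
    obtain ⟨g, hg, hgp⟩ := hu2
    obtain ⟨h2, h3⟩ := key 1 one_pos (le_max_right _ _) u hu1.1 hu0
    rw [lintegral_dirQuot_zero hs hp hg hgp]
    have h4 := mul_le_mul_right (hg.lintegral_dirQuot_le hs hp one_pos hu1 hgp)
      (ENNReal.ofReal C)
    exact ⟨h2.trans h4, h3.trans h4⟩
  · exact key δ hδ' (hδD.trans (le_max_left _ _)) u hu.1.1 hu0

end DirQuot

/-! ### Limit passage in a single direction. -/

section DirectionLimit

variable {n : ℕ}

lemma integral_comp_shear (i : Fin n) (ν : Measure ℝ) [SFinite ν]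
    {F : EuclideanSpace ℝ (Fin n) × ℝ → ℝ} (hF : AEStronglyMeasurable F (volume.prod ν)) :
    ∫ z, F (z.1 + z.2 • EuclideanSpace.single i (1 : ℝ), z.2) ∂(volume.prod ν) =
      ∫ z, F z ∂(volume.prod ν) := by
  have h := measurePreserving_shear i ν 1
  have h1 := integral_map h.measurable.aemeasurable (h.map_eq.symm ▸ hF)
  rw [h.map_eq] at h1
  rw [h1]
  simp only [one_mul]

/-- Set integrals of the increments are integrals against a bounded function. -/
lemma exists_setIntegral_incr_eq (i : Fin n) (ν : Measure ℝ) [IsFiniteMeasure ν]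
    {B : Set (EuclideanSpace ℝ (Fin n) × ℝ)} (hB : MeasurableSet B) :
    ∃ ψ : EuclideanSpace ℝ (Fin n) → ℝ, AEStronglyMeasurable ψ ∧ (∃ M, ∀ x, |ψ x| ≤ M) ∧
      ∀ f : EuclideanSpace ℝ (Fin n) → ℝ, Integrable f →
        ∫ z in B, incr i f z.1 z.2 ∂(volume.prod ν) = ∫ x, ψ x * f x := by
  -- A change of variables moves the translation from f to the indicator of B; σ translates back by
  -- the step, and ψ is the fibre integral of the difference of the two indicators.
  set σ : EuclideanSpace ℝ (Fin n) × ℝ → EuclideanSpace ℝ (Fin n) × ℝ :=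
    fun z => (z.1 + (-1 * z.2) • EuclideanSpace.single i (1 : ℝ), z.2) with hσ
  have hσm : Measurable σ := (measurePreserving_shear i ν (-1)).measurable
  set b : EuclideanSpace ℝ (Fin n) × ℝ → ℝ := B.indicator fun _ => 1 with hb
  have hbm : Measurable b := measurable_const.indicator hB
  have hb1 : ∀ z, 0 ≤ b z ∧ b z ≤ 1 := fun z => by
    by_cases hz : z ∈ B <;> simp [hb, hz]
  set χ : EuclideanSpace ℝ (Fin n) × ℝ → ℝ := fun z => b (σ z) - b z with hχ
  have hχm : Measurable χ := (hbm.comp hσm).sub hbm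
  have hχ1 : ∀ z, |χ z| ≤ 1 := fun z => by
    have h1 := hb1 z
    have h2 := hb1 (σ z)
    rw [abs_le]
    constructor <;> simp only [hχ] <;> linarith
  refine ⟨fun x => ∫ h, χ (x, h) ∂ν, ?_, ⟨1 * ν.real Set.univ, fun x => ?_⟩, fun f hf => ?_⟩
  · exact hχm.aestronglyMeasurable.integral_prod_right' (μ := volume)
  · rw [← Real.norm_eq_abs]
    exact norm_integral_le_of_norm_le_const (ae_of_all _ fun h => hχ1 (x, h))
  · have hfst : Integrable (fun z : EuclideanSpace ℝ (Fin n) × ℝ => f z.1) (volume.prod ν) :=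
      hf.comp_fst ν
    have hi1 : Integrable (fun z => b z * f z.1) (volume.prod ν) :=
      hfst.bdd_mul hbm.aestronglyMeasurable (c := 1) (ae_of_all _ fun z => by
        rw [Real.norm_eq_abs, abs_of_nonneg (hb1 z).1]
        exact (hb1 z).2)
    have hi2 : Integrable (fun z => b (σ z) * f z.1) (volume.prod ν) :=
      hfst.bdd_mul (hbm.comp hσm).aestronglyMeasurable (c := 1) (ae_of_all _ fun z => by
        rw [Real.norm_eq_abs, abs_of_nonneg (hb1 _).1]
        exact (hb1 _).2)
    have hσshear : ∀ z : EuclideanSpace ℝ (Fin n) × ℝ,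
        σ (z.1 + z.2 • EuclideanSpace.single i (1 : ℝ), z.2) = z := fun z => by
      simp [hσ]
    have hi3 : Integrable
        (fun z => b z * f (z.1 + z.2 • EuclideanSpace.single i (1 : ℝ))) (volume.prod ν) := by
      have := (measurePreserving_shear i ν 1).integrable_comp_of_integrable hi2
      refine this.congr (ae_of_all _ fun z => ?_)
      simp only [Function.comp_apply, one_mul, hσshear]
    have e2 := integral_comp_shear i ν hi2.1
    simp only [hσshear] at e2
    calc ∫ z in B, incr i f z.1 z.2 ∂(volume.prod ν)
        = ∫ z, (b z * f (z.1 + z.2 • EuclideanSpace.single i (1 : ℝ)) - b z * f z.1)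
            ∂(volume.prod ν) := by
          rw [← integral_indicator hB]
          refine integral_congr_ae (ae_of_all _ fun z => ?_)
          by_cases hz : z ∈ B <;> simp [hb, hz, incr]
      _ = ∫ z, χ z * f z.1 ∂(volume.prod ν) := by
          rw [integral_sub hi3 hi1, e2, ← integral_sub hi2 hi1]
          refine integral_congr_ae (ae_of_all _ fun z => ?_)
          simp only [hχ, sub_mul]
      _ = ∫ x, (∫ h, χ (x, h) ∂ν) * f x := by
          rw [integral_prod]
          · simp only [integral_mul_const]
          · exact (hi2.sub hi1).congr (ae_of_all _ fun z => by simp [hχ, sub_mul])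

variable {i : Fin n} {s p : ℝ} {l : Ultrafilter ℕ} {v : ℕ → EuclideanSpace ℝ (Fin n) → ℝ}
  {v₀ : EuclideanSpace ℝ (Fin n) → ℝ}

/-- Limit passage in a direction with a fixed positive horizon. -/
lemma tendsto_formI_of_fixed (hs : 0 < s ∧ s < 1) (hp : 1 < p) {δ : ℝ} (hδ : 0 < δ)
    (hv : ∀ k, MemWi i s p δ (v k)) (hvi : ∀ k, Integrable (v k)) (hv0i : Integrable v₀)
    (hv0 : MemLp v₀ (ENNReal.ofReal p)) {R : ℝ}
    (hR : ∀ᶠ k in l, ∫ z, |dirQuot i δ (v k) z| ^ p ∂(volume.prod (horizonMeasure s p δ)) ≤ R)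
    (hweak : ∀ φ : EuclideanSpace ℝ (Fin n) → ℝ, AEStronglyMeasurable φ →
      (∃ M, ∀ x, |φ x| ≤ M) →
      Tendsto (fun k => ∫ x, φ x * v k x) l (𝓝 (∫ x, φ x * v₀ x))) :
    MemWi i s p δ v₀ ∧ ∀ w, MemWi i s p δ w →
      Tendsto (fun k => formI i s p δ w (v k)) l (𝓝 (formI i s p δ w v₀)) := by
  have hfin := isFiniteMeasure_horizonMeasure hs.2 hp hδ.le
  set ν := horizonMeasure s p δ with hν
  have hpq := Real.HolderConjugate.conjExponent hp
  have hQ : ∀ k, MemLp (dirQuot i δ (v k)) (ENNReal.ofReal p) (volume.prod ν) :=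
    fun k => (hv k).memLp_dirQuot hs hp hδ.le
  obtain ⟨V, hV, hVlim⟩ := exists_weak_limit hpq l hQ hR
  have hae : ∀ᵐ z ∂((volume : Measure (EuclideanSpace ℝ (Fin n))).prod ν), z.2 ≠ 0 ∧ |z.2| ≤ δ :=
    Measure.quasiMeasurePreserving_snd.ae (ae_horizonMeasure hδ)
  have hincr : ∀ f : EuclideanSpace ℝ (Fin n) → ℝ,
      ∀ᵐ z ∂((volume : Measure (EuclideanSpace ℝ (Fin n))).prod ν),
      z.2 * dirQuot i δ f z = incr i f z.1 z.2 := fun f => by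
    filter_upwards [hae] with z hz
    rw [dirQuot, if_neg hδ.ne', mul_div_cancel₀ _ hz.1]
  have hincrLp : MemLp (fun z : EuclideanSpace ℝ (Fin n) × ℝ => incr i v₀ z.1 z.2)
      (ENNReal.ofReal p) (volume.prod ν) := by
    have h1 := (memLp_shear i (ν := ν) 1 hv0).sub (hv0.comp_fst ν)
    refine h1.ae_eq (ae_of_all _ fun z => ?_)
    simp [incr]
  have hsndLp : MemLp (fun z => z.2 * V z) (ENNReal.ofReal p) (volume.prod ν) := by
    refine MemLp.of_le_mul (c := δ) hV
      (measurable_snd.aestronglyMeasurable.mul hV.1) ?_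
    filter_upwards [hae] with z hz
    rw [norm_mul, Real.norm_eq_abs]
    gcongr
    exact hz.2
  have hint : ∀ {f : EuclideanSpace ℝ (Fin n) × ℝ → ℝ},
      MemLp f (ENNReal.ofReal p) (volume.prod ν) →
      ∀ B, MeasurableSet B → (volume.prod ν) B < ⊤ → IntegrableOn f B (volume.prod ν) := by
    intro f hf B _ hB
    have : IsFiniteMeasure ((volume.prod ν).restrict B) := ⟨by simpa using hB⟩
    exact (hf.restrict B).integrable (one_le_ofReal hp)
  -- The weak limit V is identified by testing with z.2 on sets B of finite measure. The factor z.2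
  -- turns quotients into increments, whose set integrals are pairings of the function itself with a
  -- bounded ψ.
  have hident : (fun z => z.2 * V z) =ᵐ[volume.prod ν] fun z => incr i v₀ z.1 z.2 := by
    refine ae_eq_of_forall_setIntegral_eq_of_sigmaFinite (hint hsndLp) (hint hincrLp)
      fun B hB hBfin => ?_
    obtain ⟨ψ, hψm, hψb, hψ⟩ := exists_setIntegral_incr_eq i ν hB
    have h1 : MemLp (B.indicator fun z : EuclideanSpace ℝ (Fin n) × ℝ => z.2)
        (ENNReal.ofReal p.conjExponent) (volume.prod ν) := by
      have h2 : MemLp (B.indicator fun _ : EuclideanSpace ℝ (Fin n) × ℝ => δ)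
          (ENNReal.ofReal p.conjExponent) (volume.prod ν) :=
        memLp_indicator_const _ hB _ (Or.inr hBfin.ne)
      refine h2.of_le (measurable_snd.indicator hB).aestronglyMeasurable ?_
      filter_upwards [hae] with z hz
      by_cases hzB : z ∈ B
      · simpa [hzB, abs_of_pos hδ] using hz.2
      · simp [hzB]
    have h3 := hVlim _ h1
    have h4 : ∀ f : EuclideanSpace ℝ (Fin n) × ℝ → ℝ,
        ∫ z, B.indicator (fun z => z.2) z * f z ∂(volume.prod ν) =
          ∫ z in B, z.2 * f z ∂(volume.prod ν) := fun f => by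
      rw [← integral_indicator hB]
      refine integral_congr_ae (ae_of_all _ fun z => ?_)
      by_cases hzB : z ∈ B <;> simp [hzB]
    rw [h4] at h3
    have h5 := hweak ψ hψm hψb
    rw [← hψ v₀ hv0i] at h5
    refine tendsto_nhds_unique (h3.congr fun k => ?_) h5
    rw [h4, ← hψ (v k) (hvi k)]
    exact setIntegral_congr_ae hB (by filter_upwards [hincr (v k)] with z hz _ using hz)
  have hVeq : V =ᵐ[volume.prod ν] dirQuot i δ v₀ := by
    filter_upwards [hident, hae] with z hz hz'
    rw [dirQuot, if_neg hδ.ne', ← hz, mul_div_cancel_left₀ _ hz'.1]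
  have hmem : MemWi i s p δ v₀ := memWi_of_memLp_dirQuot hs hp hδ hv0 (hV.ae_eq hVeq)
  refine ⟨hmem, fun w hw => ?_⟩
  have h6 := hVlim _ (memLp_signedPow hpq (hw.memLp_dirQuot hs hp hδ.le))
  have h7 : formI i s p δ w v₀ = ∫ z, signedPow p (dirQuot i δ w z) * V z ∂(volume.prod ν) := by
    rw [formI_eq_integral hs hp hδ.le hw hmem]
    refine integral_congr_ae ?_
    filter_upwards [hVeq] with z hz
    rw [hz]
  rw [h7]
  refine h6.congr fun k => ?_
  rw [formI_eq_integral hs hp hδ.le hw (hv k)]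

/-- Discrete integration by parts: the increment moves to φ with the step reversed, and Taylor's
formula with the Lipschitz constant K of the derivative of φ bounds the error by K |h|. -/
lemma exists_abs_integral_incr_add_le (i : Fin n) {φ : EuclideanSpace ℝ (Fin n) → ℝ}
    (hφ : ContDiff ℝ (⊤ : ℕ∞) φ) (hφc : HasCompactSupport φ) :
    ∃ K : ℝ, 0 ≤ K ∧ ∀ f : EuclideanSpace ℝ (Fin n) → ℝ, Integrable f → ∀ h : ℝ, h ≠ 0 →
      |(∫ x, φ x * (incr i f x h / h)) +
        ∫ x, f x * fderiv ℝ φ x (EuclideanSpace.single i (1 : ℝ))| ≤ K * |h| * ∫ x, |f x| := by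
  obtain ⟨K, hK⟩ := ContDiff.lipschitzWith_of_hasCompactSupport (hφc.fderiv ℝ)
    ((contDiff_infty.1 hφ 2).fderiv_right (m := 1) (by norm_num)) one_ne_zero
  set e : EuclideanSpace ℝ (Fin n) := EuclideanSpace.single i (1 : ℝ) with he
  have hen : ‖e‖ = 1 := by simp [he]
  refine ⟨K, K.2, fun f hf h hh => ?_⟩
  have htaylor : ∀ x, |(φ (x - h • e) - φ x) / h + fderiv ℝ φ x e| ≤ K * |h| := fun x => by
    have h1 : ‖x - h • e - x‖ = |h| := by
      rw [sub_sub_cancel_left, norm_neg, norm_smul, hen, mul_one, Real.norm_eq_abs]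
    have h2 := (convex_closedBall x |h|).norm_image_sub_le_of_norm_fderiv_le' (𝕜 := ℝ) (f := φ)
      (φ := fderiv ℝ φ x) (C := K * |h|) (x := x) (y := x - h • e)
      (fun y _ => hφ.differentiable (by simp) y) (fun y hy => by
        refine (hK.norm_sub_le y x).trans ?_
        gcongr
        simpa [dist_eq_norm] using hy)
      (Metric.mem_closedBall_self (abs_nonneg h))
      (by rw [Metric.mem_closedBall, dist_eq_norm, h1])
    rw [h1, sub_sub_cancel_left, map_neg, map_smul, smul_eq_mul, sub_neg_eq_add,
      Real.norm_eq_abs] at h2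
    have h3 : (φ (x - h • e) - φ x) / h + fderiv ℝ φ x e =
        (φ (x - h • e) - φ x + h * fderiv ℝ φ x e) / h := by
      field_simp
    rw [h3, abs_div, div_le_iff₀ (abs_pos.2 hh)]
    exact h2
  have hf' := hf.locallyIntegrable
  have hd := continuous_fderiv_test hφ e
  have hdc := hasCompactSupport_fderiv_test hφc e
  have hsc : HasCompactSupport fun x => φ (x - h • e) :=
    hφc.comp_homeomorph (Homeomorph.subRight (h • e))
  have hsco : Continuous fun x => φ (x - h • e) := hφ.continuous.comp (by fun_prop)
  have i1 : Integrable fun x => f x * φ (x - h • e) := integrable_mul_test hf' hsco hsc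
  have i2 : Integrable fun x => f x * φ x := integrable_mul_test hf' hφ.continuous hφc
  have i3 : Integrable fun x => f x * fderiv ℝ φ x e := integrable_mul_test hf' hd hdc
  have i4 : Integrable fun x => f (x + h • e) * φ x := by
    simpa only [add_sub_cancel_right] using i1.comp_add_right (h • e)
  have h4 : ∫ x, f (x + h • e) * φ x = ∫ x, f x * φ (x - h • e) := by
    rw [← integral_add_right_eq_self (fun x => f x * φ (x - h • e)) (h • e)]
    simp only [add_sub_cancel_right]
  have h5 : ∫ x, φ x * (incr i f x h / h) = ∫ x, f x * ((φ (x - h • e) - φ x) / h) := by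
    calc ∫ x, φ x * (incr i f x h / h)
        = ∫ x, (f (x + h • e) * φ x - f x * φ x) / h := by
          refine integral_congr_ae (ae_of_all _ fun x => ?_)
          simp only [incr, ← he]
          ring
      _ = ∫ x, (f x * φ (x - h • e) - f x * φ x) / h := by
          rw [integral_div, integral_div, integral_sub i4 i2, integral_sub i1 i2, h4]
      _ = _ := by
          refine integral_congr_ae (ae_of_all _ fun x => ?_)
          simp only
          ring
  have i5 : Integrable fun x => f x * ((φ (x - h • e) - φ x) / h) :=
    ((i1.sub i2).div_const h).congr (ae_of_all _ fun x => by simp only [Pi.sub_apply]; ring)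
  rw [h5, ← integral_add i5 i3, ← integral_const_mul]
  refine abs_integral_le_integral_abs.trans (integral_mono (i5.add i3).abs
    (hf.abs.const_mul _) fun x => ?_)
  simp only [← mul_add, abs_mul]
  rw [mul_comm]
  gcongr
  exact htaylor x

lemma integral_abs_rpow_le_of_lintegral_le {α : Type*} [MeasurableSpace α] {μ : Measure α}
    {q : ℝ} (hq : 1 < q) {g : α → ℝ} (hg : MemLp g (ENNReal.ofReal q) μ) {M : ℝ} (hM : 0 ≤ M)
    (h : ∫⁻ x, ‖g x‖ₑ ^ q ∂μ ≤ ENNReal.ofReal M) : ∫ x, |g x| ^ q ∂μ ≤ M := by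
  rwa [← ofReal_integral_abs_rpow hq hg, ENNReal.ofReal_le_ofReal_iff hM] at h

/-- Replacing the difference quotients of a function by its weak derivative. -/
lemma tendsto_integral_signedPow_dirQuot_sub (hs : 0 < s ∧ s < 1) (hp : 1 < p) {d : ℕ → ℝ}
    (hd : ∀ k, 0 < d k) (hd0 : Tendsto d l (𝓝 0)) {w g : EuclideanSpace ℝ (Fin n) → ℝ}
    (hw : MemLp w (ENNReal.ofReal p)) (hg : HasWeakPartial i w g)
    (hgp : MemLp g (ENNReal.ofReal p)) {Q : ℕ → EuclideanSpace ℝ (Fin n) × ℝ → ℝ} {R : ℝ}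
    (hQ : ∀ k, MemLp (Q k) (ENNReal.ofReal p) (volume.prod (horizonMeasure s p (d k))))
    (hR : ∀ᶠ k in l, ∫ z, |Q k z| ^ p ∂(volume.prod (horizonMeasure s p (d k))) ≤ R) :
    Tendsto (fun k =>
      ∫ z, signedPow p (dirQuot i (d k) w z) * Q k z ∂(volume.prod (horizonMeasure s p (d k))) -
      ∫ z, signedPow p (g z.1) * Q k z ∂(volume.prod (horizonMeasure s p (d k)))) l (𝓝 0) := by
  have hfin := fun k => isFiniteMeasure_horizonMeasure hs.2 hp (hd k).le
  set c := 2 / (p * (1 - s)) with hc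
  have hc0 : 0 < c := by
    have : 0 < 1 - s := by linarith [hs.2]
    positivity
  set A := ∫ x, |g x| ^ p with hA
  have hA0 : 0 ≤ A := integral_nonneg fun x => Real.rpow_nonneg (abs_nonneg _) _
  have hAof : ENNReal.ofReal (c * A) = ENNReal.ofReal c * ∫⁻ x, ‖g x‖ₑ ^ p := by
    rw [ENNReal.ofReal_mul hc0.le, ofReal_integral_abs_rpow hp hgp]
  have hw' : ∀ k, MemLp (dirQuot i (d k) w) (ENNReal.ofReal p)
      (volume.prod (horizonMeasure s p (d k))) := fun k => by
    have hmem : MemWi i s p 0 w := ⟨hw, by rw [if_pos rfl]; exact ⟨g, hg, hgp⟩⟩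
    exact (hmem.of_zero hs hp (hd k).le).memLp_dirQuot hs hp (hd k).le
  have hgf : ∀ k, MemLp (fun z : EuclideanSpace ℝ (Fin n) × ℝ => g z.1) (ENNReal.ofReal p)
      (volume.prod (horizonMeasure s p (d k))) := fun k => hgp.comp_fst _
  have hB1 : ∀ k, ∫ z, |dirQuot i (d k) w z| ^ p ∂(volume.prod (horizonMeasure s p (d k))) ≤
      c * A := fun k =>
    integral_abs_rpow_le_of_lintegral_le hp (hw' k) (by positivity)
      (hAof ▸ hg.lintegral_dirQuot_le hs hp (hd k) hw hgp)
  have hB2 : ∀ k, ∫ z : EuclideanSpace ℝ (Fin n) × ℝ, |g z.1| ^ p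
      ∂(volume.prod (horizonMeasure s p (d k))) ≤ c * A := fun k => by
    refine integral_abs_rpow_le_of_lintegral_le hp (hgf k) (by positivity) (le_of_eq ?_)
    rw [hAof, lintegral_prod_symm _ ((hgf k).1.enorm.pow_const p)]
    simp only [lintegral_const]
    rw [horizonMeasure_univ hs.2 hp (hd k).le, mul_comm]
  rw [Metric.tendsto_nhds]
  intro η hη
  have hden : 0 < 2 * (c * A) + |R| + 1 := by positivity
  -- The weight makes the ε-term at most η/2, the three energies being bounded by c A, c A and R.
  -- The number η/(4(C+1)c) makes the remaining term at most η/4.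
  obtain ⟨C, hC, h⟩ := abs_integral_signedPow_sub_le hp
    (show 0 < η / (2 * (2 * (c * A) + |R| + 1)) by positivity)
  have hθ : 0 < η / (4 * (C + 1) * c) := by positivity
  obtain ⟨r, hr, hr'⟩ := hg.exists_lintegral_dirQuot_sub_le hs hp hw hgp (ENNReal.ofReal_pos.2 hθ)
  filter_upwards [hR, hd0.eventually (ge_mem_nhds hr)] with k hk hkr
  have h1 := h _ _ _ _ (hw' k) (hgf k) (hQ k)
  have h2 : ∫ z, |dirQuot i (d k) w z - g z.1| ^ p ∂(volume.prod (horizonMeasure s p (d k))) ≤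
      η / (4 * (C + 1) * c) * c := by
    refine integral_abs_rpow_le_of_lintegral_le hp ((hw' k).sub (hgf k)) (by positivity) ?_
    rw [ENNReal.ofReal_mul hθ.le]
    exact hr' (d k) (hd k) hkr
  have h3 : C * ∫ z, |dirQuot i (d k) w z - g z.1| ^ p
      ∂(volume.prod (horizonMeasure s p (d k))) ≤ η / 4 := by
    calc _ ≤ (C + 1) * (η / (4 * (C + 1) * c) * c) :=
          mul_le_mul (by linarith) h2
            (integral_nonneg fun x => Real.rpow_nonneg (abs_nonneg _) _) (by linarith)
      _ = η / 4 := by field_simp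
  have h4 : η / (2 * (2 * (c * A) + |R| + 1)) *
      (∫ z, |dirQuot i (d k) w z| ^ p ∂(volume.prod (horizonMeasure s p (d k))) +
        ∫ z : EuclideanSpace ℝ (Fin n) × ℝ, |g z.1| ^ p
          ∂(volume.prod (horizonMeasure s p (d k))) +
        ∫ z, |Q k z| ^ p ∂(volume.prod (horizonMeasure s p (d k)))) ≤ η / 2 := by
    calc _ ≤ η / (2 * (2 * (c * A) + |R| + 1)) * (2 * (c * A) + |R| + 1) := by
          refine mul_le_mul_of_nonneg_left ?_ (by positivity)
          linarith [hB1 k, hB2 k, le_abs_self R]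
      _ = η / 2 := by field_simp
  rw [Real.dist_eq, sub_zero]
  linarith

/-- Limit passage in a direction whose horizon tends to zero. -/
lemma tendsto_formI_of_zero (hs : 0 < s ∧ s < 1) (hp : 1 < p) {d : ℕ → ℝ} (hd : ∀ k, 0 < d k)
    (hd0 : Tendsto d l (𝓝 0)) (hv : ∀ k, MemWi i s p (d k) (v k)) (hvi : ∀ k, Integrable (v k))
    {R' : ℝ} (hR' : ∀ᶠ k in l, ∫ x, |v k x| ≤ R') (hv0i : Integrable v₀)
    (hv0 : MemLp v₀ (ENNReal.ofReal p)) {R : ℝ}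
    (hR : ∀ᶠ k in l,
      ∫ z, |dirQuot i (d k) (v k) z| ^ p ∂(volume.prod (horizonMeasure s p (d k))) ≤ R)
    (hweak : ∀ φ : EuclideanSpace ℝ (Fin n) → ℝ, AEStronglyMeasurable φ →
      (∃ M, ∀ x, |φ x| ≤ M) →
      Tendsto (fun k => ∫ x, φ x * v k x) l (𝓝 (∫ x, φ x * v₀ x))) :
    MemWi i s p 0 v₀ ∧ ∀ w, MemWi i s p 0 w →
      Tendsto (fun k => formI i s p (d k) w (v k)) l (𝓝 (formI i s p 0 w v₀)) := by
  have hfin := fun k => isFiniteMeasure_horizonMeasure hs.2 hp (hd k).le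
  have hpq := Real.HolderConjugate.conjExponent hp
  set c := 2 / (p * (1 - s)) with hc
  have hc0 : 0 < c := by
    have : 0 < 1 - s := by linarith [hs.2]
    positivity
  have hmass : ∀ k, (horizonMeasure s p (d k)).real Set.univ = c := fun k => by
    rw [Measure.real, horizonMeasure_univ hs.2 hp (hd k).le, ENNReal.toReal_ofReal hc0.le]
  have hQ : ∀ k, MemLp (dirQuot i (d k) (v k)) (ENNReal.ofReal p)
      (volume.prod (horizonMeasure s p (d k))) := fun k => (hv k).memLp_dirQuot hs hp (hd k).le
  -- The quotients live in spaces that change with k. Their integrals over the steps all lie in one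
  -- `L^p` space, bounded by Jensen's inequality and the constant mass c, so a weak limit G exists
  -- there.
  have hG : ∀ k, MemLp (fun x => ∫ h, dirQuot i (d k) (v k) (x, h) ∂(horizonMeasure s p (d k)))
      (ENNReal.ofReal p) := fun k => memLp_fibre_integral hp (hQ k)
  have hGR : ∀ᶠ k in l, ∫ x, |∫ h, dirQuot i (d k) (v k) (x, h) ∂(horizonMeasure s p (d k))| ^ p ≤
      c ^ (p - 1) * |R| := by
    filter_upwards [hR] with k hk
    refine integral_abs_rpow_le_of_lintegral_le hp (hG k) (by positivity) ?_
    refine (lintegral_fibre_integral_le hp volume _ (hQ k).1).trans ?_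
    rw [horizonMeasure_univ hs.2 hp (hd k).le, ← ofReal_integral_abs_rpow hp (hQ k),
      ENNReal.ofReal_rpow_of_pos hc0, ENNReal.ofReal_mul (by positivity)]
    gcongr
    exact hk.trans (le_abs_self R)
  obtain ⟨G, hGp, hGlim⟩ := exists_weak_limit hpq l hG hGR
  have hfub : ∀ (ψ : EuclideanSpace ℝ (Fin n) → ℝ), MemLp ψ (ENNReal.ofReal p.conjExponent) →
      ∀ k, Integrable (fun z : EuclideanSpace ℝ (Fin n) × ℝ => ψ z.1 * dirQuot i (d k) (v k) z)
        (volume.prod (horizonMeasure s p (d k))) := fun ψ hψ k =>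
    integrable_mul_of_holderConjugate hpq.symm (hψ.comp_fst _) (hQ k)
  have hfub' : ∀ (ψ : EuclideanSpace ℝ (Fin n) → ℝ), MemLp ψ (ENNReal.ofReal p.conjExponent) →
      Tendsto (fun k => ∫ z, ψ z.1 * dirQuot i (d k) (v k) z
        ∂(volume.prod (horizonMeasure s p (d k)))) l (𝓝 (∫ x, ψ x * G x)) := fun ψ hψ => by
    refine (hGlim ψ hψ).congr fun k => ?_
    rw [integral_prod _ (hfub ψ hψ k)]
    simp only [integral_const_mul]
  have hpartial : HasWeakPartial i v₀ fun x => G x / c := by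
    refine ⟨hv0i.locallyIntegrable,
      ((hGp.locallyIntegrable (one_le_ofReal hp)).smul c⁻¹).congr (ae_of_all _ fun x => ?_),
      fun φ hφ hφc => ?_⟩
    · simp [div_eq_inv_mul]
    have hφq : MemLp φ (ENNReal.ofReal p.conjExponent) :=
      hφ.continuous.memLp_of_hasCompactSupport hφc
    set e : EuclideanSpace ℝ (Fin n) := EuclideanSpace.single i (1 : ℝ) with he
    have hdcont := continuous_fderiv_test hφ e
    have hdcomp := hasCompactSupport_fderiv_test hφc e
    obtain ⟨K, hK, hbound⟩ := exists_abs_integral_incr_add_le i hφ hφc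
    have h1 : Tendsto (fun k => ∫ x, v k x * fderiv ℝ φ x e) l
        (𝓝 (∫ x, v₀ x * fderiv ℝ φ x e)) := by
      obtain ⟨M, hM⟩ := hdcomp.exists_bound_of_continuous hdcont
      have := hweak (fun x => fderiv ℝ φ x e) hdcont.aestronglyMeasurable ⟨M, hM⟩
      simpa only [mul_comm] using this
    -- Discrete integration by parts, integrated over the steps |h| ≤ d k: the error is of order d
    -- k, and in the limit G / c satisfies the definition of the weak derivative of v₀.
    have h2 : ∀ᶠ k in l, ‖(∫ z, φ z.1 * dirQuot i (d k) (v k) z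
        ∂(volume.prod (horizonMeasure s p (d k)))) + c * ∫ x, v k x * fderiv ℝ φ x e‖ ≤
        K * d k * R' * c := by
      filter_upwards [hR'] with k hk
      have hswap := (hfub φ hφq k).integral_prod_right
      have e1 : (∫ z, φ z.1 * dirQuot i (d k) (v k) z
          ∂(volume.prod (horizonMeasure s p (d k)))) + c * ∫ x, v k x * fderiv ℝ φ x e =
          ∫ h, ((∫ x, φ x * dirQuot i (d k) (v k) (x, h)) + ∫ x, v k x * fderiv ℝ φ x e)
            ∂(horizonMeasure s p (d k)) := by
        rw [integral_add hswap (integrable_const _), integral_prod_symm _ (hfub φ hφq k),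
          integral_const, hmass, smul_eq_mul]
      rw [e1, ← hmass k]
      refine norm_integral_le_of_norm_le_const ?_
      filter_upwards [ae_horizonMeasure (hd k)] with h hh
      rw [Real.norm_eq_abs]
      simp only [dirQuot, if_neg (hd k).ne']
      refine (hbound (v k) (hvi k) h hh.1).trans ?_
      have := hh.2
      have := (hd k).le
      gcongr
    have h3 : Tendsto (fun k => K * d k * R' * c) l (𝓝 0) := by
      simpa using ((hd0.const_mul K).mul_const R').mul_const c
    have h4 := squeeze_zero_norm' h2 h3
    have h5 := tendsto_nhds_unique h4 ((hfub' φ hφq).add (h1.const_mul c))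
    have h6 : ∫ x, G x / c * φ x = (∫ x, φ x * G x) / c := by
      rw [← integral_div]
      refine integral_congr_ae (ae_of_all _ fun x => ?_)
      simp only
      ring
    rw [h6, eq_neg_iff_add_eq_zero]
    field_simp
    linarith
  have hGc : MemLp (fun x => G x / c) (ENNReal.ofReal p) := by
    simpa only [div_eq_mul_inv] using hGp.mul_const c⁻¹
  refine ⟨⟨hv0, by rw [if_pos rfl]; exact ⟨_, hpartial, hGc⟩⟩, fun w hw => ?_⟩
  obtain ⟨hw1, hw2⟩ := id hw
  rw [if_pos rfl] at hw2
  obtain ⟨g', hg', hgp'⟩ := hw2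
  have hg := hg'.hasWeakPartial_weakPartial
  have hgp : MemLp (weakPartial i w) (ENNReal.ofReal p) := hgp'.ae_eq hg'.weakPartial_ae_eq.symm
  -- Once the quotients of w are replaced by its weak derivative, the first factor no longer depends
  -- on the step and only the fibre integrals of the other factor are seen.
  have h7 := tendsto_integral_signedPow_dirQuot_sub hs hp hd hd0 hw1 hg hgp hQ hR
  have h8 := h7.add (hfub' _ (memLp_signedPow hpq hgp))
  have h9 : formI i s p 0 w v₀ = ∫ x, signedPow p (weakPartial i w x) * G x := by
    rw [formI, if_pos rfl, ← integral_const_mul]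
    refine integral_congr_ae ?_
    filter_upwards [hpartial.weakPartial_ae_eq] with x hx
    rw [hx, signedPow, ← hc]
    field_simp
  rw [h9, ← zero_add (∫ x, signedPow p (weakPartial i w x) * G x)]
  refine h8.congr fun k => ?_
  rw [sub_add_cancel, formI_eq_integral hs hp (hd k).le (hw.of_zero hs hp (hd k).le) (hv k)]

end DirectionLimit

/-! ### Monotonicity and continuity of the directional forms. -/

/-- The scaled energy in the direction `eᵢ`. -/
def dirEnergy {n : ℕ} (i : Fin n) (s p δ : ℝ) (u : EuclideanSpace ℝ (Fin n) → ℝ) : ℝ :=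
  ∫ z, |dirQuot i δ u z| ^ p ∂(volume.prod (horizonMeasure s p δ))

section Direction

variable {n : ℕ} {i : Fin n} {s p δ : ℝ} {u v w : EuclideanSpace ℝ (Fin n) → ℝ}

lemma dirEnergy_nonneg : 0 ≤ dirEnergy i s p δ u :=
  integral_nonneg fun _ => Real.rpow_nonneg (abs_nonneg _) _

lemma MemWi.ofReal_dirEnergy (hu : MemWi i s p δ u) (hs : 0 < s ∧ s < 1) (hp : 1 < p)
    (hδ : 0 ≤ δ) : ENNReal.ofReal (dirEnergy i s p δ u) =
      ∫⁻ z, ‖dirQuot i δ u z‖ₑ ^ p ∂(volume.prod (horizonMeasure s p δ)) :=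
  ofReal_integral_abs_rpow hp (hu.memLp_dirQuot hs hp hδ)

lemma MemWi.formI_self (hu : MemWi i s p δ u) (hs : 0 < s ∧ s < 1) (hp : 1 < p) (hδ : 0 ≤ δ) :
    formI i s p δ u u = dirEnergy i s p δ u := by
  rw [formI_eq_integral hs hp hδ hu hu]
  simp only [signedPow_mul_self hp]
  rfl

lemma MemWi.formI_add_const_mul (hw : MemWi i s p δ w) (hu : MemWi i s p δ u)
    (hv : MemWi i s p δ v) (hs : 0 < s ∧ s < 1) (hp : 1 < p) (hδ : 0 ≤ δ) (c : ℝ) :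
    formI i s p δ w (fun x => u x + c * v x) = formI i s p δ w u + c * formI i s p δ w v := by
  rw [formI_eq_integral hs hp hδ hw hu, formI_eq_integral hs hp hδ hw hv,
    formI_eq_integral hs hp hδ hw (hu.add_const_mul hv hs hp hδ c), ← integral_const_mul,
    ← integral_add]
  · refine integral_congr_ae ?_
    filter_upwards [dirQuot_add_const_mul hs hp hδ hu hv c] with z hz
    rw [hz]
    ring
  · exact integrable_signedPow_mul hp (hw.memLp_dirQuot hs hp hδ) (hu.memLp_dirQuot hs hp hδ)
  · exact (integrable_signedPow_mul hp (hw.memLp_dirQuot hs hp hδ)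
      (hv.memLp_dirQuot hs hp hδ)).const_mul c

lemma MemWi.formI_sub_eq (hw : MemWi i s p δ w) (hu : MemWi i s p δ u)
    (hv : MemWi i s p δ v) (hs : 0 < s ∧ s < 1) (hp : 1 < p) (hδ : 0 ≤ δ) :
    formI i s p δ w (fun x => u x + -1 * v x) =
      ∫ z, signedPow p (dirQuot i δ w z) * (dirQuot i δ u z - dirQuot i δ v z)
        ∂(volume.prod (horizonMeasure s p δ)) := by
  rw [formI_eq_integral hs hp hδ hw (hu.add_const_mul hv hs hp hδ (-1))]
  refine integral_congr_ae ?_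
  filter_upwards [dirQuot_add_const_mul hs hp hδ hu hv (-1)] with z hz
  rw [hz]
  ring

lemma MemWi.formI_monotone (hu : MemWi i s p δ u) (hv : MemWi i s p δ v) (hs : 0 < s ∧ s < 1)
    (hp : 1 < p) (hδ : 0 ≤ δ) :
    0 ≤ formI i s p δ u (fun x => u x + -1 * v x) -
      formI i s p δ v (fun x => u x + -1 * v x) := by
  rw [hu.formI_sub_eq hu hv hs hp hδ, hv.formI_sub_eq hu hv hs hp hδ]
  exact integral_monotonicity_nonneg hp (hu.memLp_dirQuot hs hp hδ) (hv.memLp_dirQuot hs hp hδ)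

/-- The monotonicity of the form controls the energy of the difference, uniformly with respect to
the horizon. -/
lemma exists_dirEnergy_sub_le (i : Fin n) (hs : 0 < s ∧ s < 1) (hp : 1 < p) {ε : ℝ}
    (hε : 0 < ε) :
    ∃ C, 0 ≤ C ∧ ∀ (δ : ℝ) (u v : EuclideanSpace ℝ (Fin n) → ℝ), 0 ≤ δ → MemWi i s p δ u →
      MemWi i s p δ v → dirEnergy i s p δ (fun x => u x + -1 * v x) ≤
        C * (formI i s p δ u (fun x => u x + -1 * v x) -
          formI i s p δ v (fun x => u x + -1 * v x)) +
        ε * (dirEnergy i s p δ u + dirEnergy i s p δ v) := by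
  obtain ⟨C, hC, h⟩ := integral_abs_sub_rpow_le_monotonicity hp hε
  refine ⟨C, hC, fun δ u v hδ hu hv => ?_⟩
  rw [hu.formI_sub_eq hu hv hs hp hδ, hv.formI_sub_eq hu hv hs hp hδ]
  refine le_of_eq_of_le (integral_congr_ae ?_)
    (h _ _ _ (hu.memLp_dirQuot hs hp hδ) (hv.memLp_dirQuot hs hp hδ))
  filter_upwards [dirQuot_add_const_mul hs hp hδ hu hv (-1)] with z hz
  rw [hz]
  ring_nf

/-- Continuity along lines, as Minty's device needs it; for |t| ≤ 1 the integrand is dominated by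
(|a| + |b|)^(p-1) |b|. -/
lemma tendsto_integral_signedPow_add_mul {α : Type*} [MeasurableSpace α] {μ : Measure α}
    (hp : 1 < p) {a b : α → ℝ} (ha : MemLp a (ENNReal.ofReal p) μ)
    (hb : MemLp b (ENNReal.ofReal p) μ) :
    Tendsto (fun t : ℝ => ∫ x, signedPow p (a x + t * b x) * b x ∂μ) (𝓝 0)
      (𝓝 (∫ x, signedPow p (a x) * b x ∂μ)) := by
  have hab : MemLp (fun x => |a x| + |b x|) (ENNReal.ofReal p) μ := ha.abs.add hb.abs
  have hbound := integrable_signedPow_mul hp hab hb.abs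
  refine tendsto_integral_filter_of_dominated_convergence _ (Eventually.of_forall fun t => ?_) ?_
    hbound (ae_of_all _ fun x => ?_)
  · exact (integrable_signedPow_mul hp (ha.add (hb.const_mul t)) hb).1
  · have h1 : ∀ᶠ t : ℝ in 𝓝 0, |t| ≤ 1 := by
      filter_upwards [Metric.closedBall_mem_nhds (0 : ℝ) one_pos] with t ht
      simpa using ht
    filter_upwards [h1] with t ht
    refine ae_of_all _ fun x => ?_
    rw [norm_mul, Real.norm_eq_abs, Real.norm_eq_abs, abs_signedPow hp]
    refine mul_le_mul_of_nonneg_right ?_ (abs_nonneg _)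
    have h2 : |a x + t * b x| ≤ |a x| + |b x| := by
      refine (abs_add_le _ _).trans ?_
      rw [abs_mul]
      have := mul_le_mul_of_nonneg_right ht (abs_nonneg (b x))
      linarith
    refine (Real.rpow_le_rpow (abs_nonneg _) h2 (by linarith)).trans ?_
    have h3 := abs_signedPow hp (|a x| + |b x|)
    rw [abs_of_nonneg (add_nonneg (abs_nonneg (a x)) (abs_nonneg (b x)))] at h3
    rw [← h3]
    refine le_of_eq (abs_of_nonneg ?_)
    rw [signedPow]
    positivity
  · have h1 : Tendsto (fun t : ℝ => a x + t * b x) (𝓝 0) (𝓝 (a x + 0 * b x)) :=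
      (by fun_prop : Continuous fun t : ℝ => a x + t * b x).tendsto 0
    rw [zero_mul, add_zero] at h1
    exact (((continuous_signedPow hp).tendsto _).comp h1).mul_const _

lemma MemWi.tendsto_formI_add_const_mul (hu : MemWi i s p δ u) (hv : MemWi i s p δ v)
    (hs : 0 < s ∧ s < 1) (hp : 1 < p) (hδ : 0 ≤ δ) :
    Tendsto (fun t : ℝ => formI i s p δ (fun x => u x + t * v x) v) (𝓝 0)
      (𝓝 (formI i s p δ u v)) := by
  rw [formI_eq_integral hs hp hδ hu hv]
  refine (tendsto_integral_signedPow_add_mul hp (hu.memLp_dirQuot hs hp hδ)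
    (hv.memLp_dirQuot hs hp hδ)).congr fun t => ?_
  rw [formI_eq_integral hs hp hδ (hu.add_const_mul hv hs hp hδ t) hv]
  refine integral_congr_ae ?_
  filter_upwards [dirQuot_add_const_mul hs hp hδ hu hv t] with z hz
  rw [hz]

end Direction

/-! ### Fixed and vanishing horizons together. -/

section HorizonLimit

/-- Along `l`, the positive horizons `d` either tend to `d₀ = 0` or are constant. -/
def HorizonLimit (l : Filter ℕ) (d : ℕ → ℝ) (d₀ : ℝ) : Prop :=
  (∀ k, 0 < d k) ∧ (d₀ = 0 ∧ Tendsto d l (𝓝 0) ∨ ∀ k, d k = d₀)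

variable {n : ℕ} {i : Fin n} {s p : ℝ} {l : Ultrafilter ℕ} {d : ℕ → ℝ} {d₀ : ℝ}

lemma HorizonLimit.nonneg (hd : HorizonLimit l d d₀) : 0 ≤ d₀ := by
  rcases hd.2 with ⟨h, -⟩ | h
  · exact h.ge
  · exact h 0 ▸ (hd.1 0).le

lemma HorizonLimit.memWi (hd : HorizonLimit l d d₀) {u : EuclideanSpace ℝ (Fin n) → ℝ}
    (hu : MemWi i s p d₀ u) (hs : 0 < s ∧ s < 1) (hp : 1 < p) (k : ℕ) : MemWi i s p (d k) u := by
  rcases hd.2 with ⟨rfl, -⟩ | h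
  · exact hu.of_zero hs hp (hd.1 k).le
  · rwa [h k]

lemma HorizonLimit.tendsto_formI (hd : HorizonLimit l d d₀) (hs : 0 < s ∧ s < 1) (hp : 1 < p)
    {v : ℕ → EuclideanSpace ℝ (Fin n) → ℝ} {v₀ : EuclideanSpace ℝ (Fin n) → ℝ}
    (hv : ∀ k, MemWi i s p (d k) (v k)) (hvi : ∀ k, Integrable (v k))
    {R' : ℝ} (hR' : ∀ᶠ k in l, ∫ x, |v k x| ≤ R') (hv0i : Integrable v₀)
    (hv0 : MemLp v₀ (ENNReal.ofReal p)) {R : ℝ}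
    (hR : ∀ᶠ k in l, dirEnergy i s p (d k) (v k) ≤ R)
    (hweak : ∀ φ : EuclideanSpace ℝ (Fin n) → ℝ, AEStronglyMeasurable φ →
      (∃ M, ∀ x, |φ x| ≤ M) →
      Tendsto (fun k => ∫ x, φ x * v k x) l (𝓝 (∫ x, φ x * v₀ x))) :
    MemWi i s p d₀ v₀ ∧ ∀ w, MemWi i s p d₀ w →
      Tendsto (fun k => formI i s p (d k) w (v k)) l (𝓝 (formI i s p d₀ w v₀)) := by
  obtain ⟨hpos, ⟨rfl, h0⟩ | h⟩ := hd
  · exact tendsto_formI_of_zero hs hp hpos h0 hv hvi hR' hv0i hv0 hR hweak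
  · obtain rfl : d = fun _ => d₀ := funext h
    exact tendsto_formI_of_fixed hs hp (hpos 0) hv hvi hv0i hv0 hR hweak

lemma HorizonLimit.exists_dirEnergy_le (hd : HorizonLimit l d d₀) (hs : 0 < s ∧ s < 1)
    (hp : 1 < p) {u : EuclideanSpace ℝ (Fin n) → ℝ} (hu : MemWi i s p d₀ u) :
    ∃ R, ∀ k, dirEnergy i s p (d k) u ≤ R := by
  obtain ⟨hpos, ⟨rfl, -⟩ | h⟩ := hd
  · obtain ⟨hu1, hu2⟩ := id hu
    rw [if_pos rfl] at hu2
    obtain ⟨g, hg, hgp⟩ := hu2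
    have hc : 0 ≤ 2 / (p * (1 - s)) := by
      have : 0 < 1 - s := by linarith [hs.2]
      positivity
    have hA : 0 ≤ ∫ x, |g x| ^ p := integral_nonneg fun x => Real.rpow_nonneg (abs_nonneg _) _
    refine ⟨2 / (p * (1 - s)) * ∫ x, |g x| ^ p, fun k => ?_⟩
    refine integral_abs_rpow_le_of_lintegral_le hp
      ((hu.of_zero hs hp (hpos k).le).memLp_dirQuot hs hp (hpos k).le) (by positivity) ?_
    rw [ENNReal.ofReal_mul hc, ofReal_integral_abs_rpow hp hgp]
    exact hg.lintegral_dirQuot_le hs hp (hpos k) hu1 hgp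
  · exact ⟨dirEnergy i s p d₀ u, fun k => by rw [h k]⟩

/-- The general limit passage applied to the constant sequence u, whose energies are bounded because
u has the regularity of the limit horizon. -/
lemma HorizonLimit.tendsto_formI_const (hd : HorizonLimit l d d₀) (hs : 0 < s ∧ s < 1)
    (hp : 1 < p) {u w : EuclideanSpace ℝ (Fin n) → ℝ} (hu : MemWi i s p d₀ u)
    (hui : Integrable u) (hw : MemWi i s p d₀ w) :
    Tendsto (fun k => formI i s p (d k) w u) l (𝓝 (formI i s p d₀ w u)) := by
  obtain ⟨R, hR⟩ := hd.exists_dirEnergy_le hs hp hu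
  exact (hd.tendsto_formI hs hp (hd.memWi hu hs hp) (fun _ => hui)
    (R' := ∫ x, |u x|) (Eventually.of_forall fun _ => le_rfl) hui hu.1
    (Eventually.of_forall hR) fun _ _ _ => tendsto_const_nhds).2 w hw

end HorizonLimit

/-! ### Exponents, Sobolev inequality and energy bound on Ω. -/

/-- The standing assumptions on the domain and the exponents. -/
structure Admissible {n : ℕ} (Ω : Set (EuclideanSpace ℝ (Fin n))) (s p : Fin n → ℝ) : Prop where
  dim_pos : 0 < n
  isOpen : IsOpen Ω
  isBounded : Bornology.IsBounded Ω
  order : ∀ i, 0 < s i ∧ s i < 1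
  one_lt : ∀ i, 1 < p i
  meanSP_lt : meanSP s p < n
  lt_pStar : ∀ i, p i < pStar s p

section Global

variable {n : ℕ} {Ω : Set (EuclideanSpace ℝ (Fin n))} {s p δ : Fin n → ℝ}

lemma Admissible.one_lt_pStar (h : Admissible Ω s p) : 1 < pStar s p :=
  (h.one_lt ⟨0, h.dim_pos⟩).trans (h.lt_pStar _)

lemma Admissible.holderConjugate (h : Admissible Ω s p) :
    (pStar s p).HolderConjugate (pStar s p / (pStar s p - 1)) :=
  Real.HolderConjugate.conjExponent h.one_lt_pStar

lemma Admissible.one_lt_sum (h : Admissible Ω s p) : 1 < ∑ i, 1 / (s i * p i) := by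
  have hn : (0 : ℝ) < n := by exact_mod_cast h.dim_pos
  have hne : Nonempty (Fin n) := ⟨⟨0, h.dim_pos⟩⟩
  have hκ : 0 < ∑ i, 1 / (s i * p i) := Finset.sum_pos (fun i _ =>
    one_div_pos.2 (mul_pos (h.order i).1 (zero_lt_one.trans (h.one_lt i)))) Finset.univ_nonempty
  have h1 := h.meanSP_lt
  rw [meanSP, inv_lt_comm₀ (by positivity) hn, inv_eq_one_div] at h1
  have h2 := (mul_lt_mul_iff_right₀ hn).2 h1
  rwa [← mul_assoc, mul_one_div_cancel hn.ne', one_mul] at h2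

/-- The form in which the critical exponent enters the truncation argument: `meanSP` is n/κ and
`meanS` is n/τ. -/
lemma Admissible.pStar_eq (h : Admissible Ω s p) :
    pStar s p = (∑ i, 1 / s i) / (∑ i, 1 / (s i * p i) - 1) := by
  have hn : (0 : ℝ) < n := by exact_mod_cast h.dim_pos
  have hne : Nonempty (Fin n) := ⟨⟨0, h.dim_pos⟩⟩
  have hτ : 0 < ∑ i, 1 / s i := Finset.sum_pos (fun i _ => one_div_pos.2 (h.order i).1)
    Finset.univ_nonempty
  have hκ := h.one_lt_sum
  rw [pStar, meanSP, meanS]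
  set κ := ∑ i, 1 / (s i * p i)
  set τ := ∑ i, 1 / s i
  have h0 : κ - 1 ≠ 0 := by linarith
  have h1 : (n : ℝ) - (1 / n * κ)⁻¹ = n * (κ - 1) / κ := by
    field_simp
  rw [h1]
  field_simp

lemma Admissible.sum_lt (h : Admissible Ω s p) : ∑ i, 1 / (s i * p i) < ∑ i, 1 / s i := by
  have hne : Nonempty (Fin n) := ⟨⟨0, h.dim_pos⟩⟩
  refine Finset.sum_lt_sum_of_nonempty Finset.univ_nonempty fun i _ => ?_
  exact one_div_lt_one_div_of_lt (h.order i).1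
    (lt_mul_of_one_lt_right (h.order i).1 (h.one_lt i))

lemma Admissible.isFiniteMeasure (h : Admissible Ω s p) :
    IsFiniteMeasure (volume.restrict Ω) :=
  ⟨by simpa using h.isBounded.measure_lt_top⟩

lemma MemW0.indicator_ae_eq {u : EuclideanSpace ℝ (Fin n) → ℝ} (hu : MemW0 Ω s p δ u) :
    Ω.indicator u =ᵐ[volume] u := by
  filter_upwards [hu.2] with x hx
  by_cases hxΩ : x ∈ Ω
  · rw [Set.indicator_of_mem hxΩ]
  · rw [Set.indicator_of_notMem hxΩ, hx hxΩ]

lemma MemW0.integrable {u : EuclideanSpace ℝ (Fin n) → ℝ} (hu : MemW0 Ω s p δ u)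
    (h : Admissible Ω s p) : Integrable u := by
  have := h.isFiniteMeasure
  have i₀ : Fin n := ⟨0, h.dim_pos⟩
  have h1 : IntegrableOn u Ω := ((hu.1 i₀).1.restrict Ω).integrable (one_le_ofReal (h.one_lt i₀))
  exact h1.integrable_of_ae_notMem_eq_zero hu.2

lemma MemW0.add_const_mul {u v : EuclideanSpace ℝ (Fin n) → ℝ} (hu : MemW0 Ω s p δ u)
    (hv : MemW0 Ω s p δ v) (h : Admissible Ω s p) (hδ : ∀ i, 0 ≤ δ i) (c : ℝ) :
    MemW0 Ω s p δ fun x => u x + c * v x := by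
  refine ⟨fun i => (hu.1 i).add_const_mul (hv.1 i) (h.order i) (h.one_lt i) (hδ i) c, ?_⟩
  filter_upwards [hu.2, hv.2] with x hx hx' hxΩ
  rw [hx hxΩ, hx' hxΩ, mul_zero, add_zero]

lemma MemW0.form_add_const_mul {u v w : EuclideanSpace ℝ (Fin n) → ℝ} (hw : MemW0 Ω s p δ w)
    (hu : MemW0 Ω s p δ u) (hv : MemW0 Ω s p δ v) (h : Admissible Ω s p) (hδ : ∀ i, 0 ≤ δ i)
    (c : ℝ) : form s p δ w (fun x => u x + c * v x) = form s p δ w u + c * form s p δ w v := by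
  simp only [form]
  rw [Finset.mul_sum, ← Finset.sum_add_distrib]
  exact Finset.sum_congr rfl fun i _ =>
    (hw.1 i).formI_add_const_mul (hu.1 i) (hv.1 i) (h.order i) (h.one_lt i) (hδ i) c

/-- The anisotropic Sobolev inequality, uniformly with respect to bounded horizons. -/
lemma Admissible.exists_sobolev (h : Admissible Ω s p) (D : ℝ) :
    ∃ C : ℝ, 0 ≤ C ∧ ∀ δ : Fin n → ℝ, (∀ i, 0 ≤ δ i) → (∀ i, δ i ≤ D) →
      ∀ u : EuclideanSpace ℝ (Fin n) → ℝ, MemW0 Ω s p δ u → ∀ M : ℝ,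
      (∀ i, dirEnergy i (s i) (p i) (δ i) u ≤ M) →
      MemLp u (ENNReal.ofReal (pStar s p)) ∧
      ∫ x, |u x| ^ pStar s p ≤
        (C * M) ^ ((∑ i, 1 / (s i * p i)) / (∑ i, 1 / (s i * p i) - 1)) := by
  obtain ⟨C, hC, hsob⟩ := exists_lintegral_rpow_le h.dim_pos (fun i => (h.order i).1) h.one_lt
    rfl rfl h.one_lt_sum h.pStar_eq h.one_lt_pStar
  choose K hK hhalf using fun i =>
    exists_halfEnergy_le_dirQuot i h.isBounded (h.order i) (h.one_lt i) D
  have hK0 : 0 ≤ ∑ i, K i := Finset.sum_nonneg fun i _ => hK i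
  refine ⟨C * ∑ i, K i, by positivity, fun δ hδ hδD u hu M hM => ?_⟩
  have i₀ : Fin n := ⟨0, h.dim_pos⟩
  have hM0 : 0 ≤ M := dirEnergy_nonneg.trans (hM i₀)
  have hum := (hu.1 i₀).1.1
  -- The Sobolev inequality asks for a measurable function with support of finite measure, so u is
  -- replaced by a representative that is exactly zero off Ω.
  set u' := Ω.indicator (hum.mk u) with hu'
  have hu'm : Measurable u' := hum.stronglyMeasurable_mk.measurable.indicator h.isOpen.measurableSet
  have hae : u' =ᵐ[volume] u := by
    refine EventuallyEq.trans ?_ hu.indicator_ae_eq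
    filter_upwards [hum.ae_eq_mk] with x hx
    simp only [hu', Set.indicator, hx]
  have hsupp : volume {x | u' x ≠ 0} < ⊤ := by
    refine (measure_mono fun x hx => ?_).trans_lt h.isBounded.measure_lt_top
    by_contra hxΩ
    exact hx (Set.indicator_of_notMem hxΩ _)
  have henergy : ∀ i, halfEnergy i (s i) (p i) u' ≤ ENNReal.ofReal ((∑ i, K i) * M) := fun i => by
    have h1 := (hhalf i (δ i) (hδ i) (hδD i) u (hu.1 i) hu.2).1
    rw [← (hu.1 i).ofReal_dirEnergy (h.order i) (h.one_lt i) (hδ i),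
      ← ENNReal.ofReal_mul (hK i)] at h1
    rw [halfEnergy, incrEnergy_congr i (p i) hae]
    refine h1.trans (ENNReal.ofReal_le_ofReal ?_)
    exact mul_le_mul (Finset.single_le_sum (fun j _ => hK j) (Finset.mem_univ i)) (hM i)
      dirEnergy_nonneg hK0
  have h2 := hsob u' hu'm hsupp _ (by positivity) henergy
  rw [lintegral_congr_ae (hae.mono fun x hx => by rw [hx]), ← mul_assoc] at h2
  have hmem : MemLp u (ENNReal.ofReal (pStar s p)) :=
    (memLp_iff_lintegral_lt_top h.one_lt_pStar hum).2 (h2.trans_lt ENNReal.ofReal_lt_top)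
  exact ⟨hmem, integral_abs_rpow_le_of_lintegral_le h.one_lt_pStar hmem (by positivity) h2⟩

lemma exists_forall_dirEnergy_le (s p δ : Fin n → ℝ) (u : EuclideanSpace ℝ (Fin n) → ℝ) :
    ∃ M, ∀ i, dirEnergy i (s i) (p i) (δ i) u ≤ M :=
  ⟨∑ i, dirEnergy i (s i) (p i) (δ i) u, fun i => Finset.single_le_sum
    (f := fun i => dirEnergy i (s i) (p i) (δ i) u) (fun _ _ => dirEnergy_nonneg)
    (Finset.mem_univ i)⟩

lemma MemW0.memLp_pStar {u : EuclideanSpace ℝ (Fin n) → ℝ} (hu : MemW0 Ω s p δ u)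
    (h : Admissible Ω s p) (hδ : ∀ i, 0 ≤ δ i) : MemLp u (ENNReal.ofReal (pStar s p)) := by
  obtain ⟨M, hM⟩ := exists_forall_dirEnergy_le s p δ u
  obtain ⟨C, -, hC⟩ := h.exists_sobolev (∑ i, δ i)
  exact (hC δ hδ (fun i => Finset.single_le_sum (fun j _ => hδ j) (Finset.mem_univ i)) u hu M hM).1

lemma MemW0.integrable_mul {f u : EuclideanSpace ℝ (Fin n) → ℝ} (hu : MemW0 Ω s p δ u)
    (h : Admissible Ω s p) (hδ : ∀ i, 0 ≤ δ i)
    (hf : MemLp f (ENNReal.ofReal (pStar s p / (pStar s p - 1))) (volume.restrict Ω)) :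
    Integrable (fun x => f x * u x) (volume.restrict Ω) :=
  integrable_mul_of_holderConjugate h.holderConjugate.symm hf
    ((hu.memLp_pStar h hδ).restrict Ω)

lemma MemW0.integral_mul_add_const_mul {f u v : EuclideanSpace ℝ (Fin n) → ℝ}
    (hu : MemW0 Ω s p δ u) (hv : MemW0 Ω s p δ v) (h : Admissible Ω s p) (hδ : ∀ i, 0 ≤ δ i)
    (hf : MemLp f (ENNReal.ofReal (pStar s p / (pStar s p - 1))) (volume.restrict Ω)) (c : ℝ) :
    ∫ x in Ω, f x * (u x + c * v x) = (∫ x in Ω, f x * u x) + c * ∫ x in Ω, f x * v x := by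
  rw [← integral_const_mul, ← integral_add (hu.integrable_mul h hδ hf)
    ((hv.integrable_mul h hδ hf).const_mul c)]
  refine integral_congr_ae (ae_of_all _ fun x => ?_)
  simp only
  ring

lemma le_rpow_of_le_mul_rpow {M A θ : ℝ} (hM : 0 ≤ M) (hA : 0 ≤ A) (hθ : θ < 1)
    (h : M ≤ A * M ^ θ) : M ≤ A ^ (1 - θ)⁻¹ := by
  have hθ' : 0 < 1 - θ := by linarith
  rcases hM.eq_or_lt with rfl | hM'
  · positivity
  · rw [Real.le_rpow_inv_iff_of_pos hM hA hθ', Real.rpow_sub hM', Real.rpow_one,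
      div_le_iff₀ (Real.rpow_pos_of_pos hM' θ)]
    exact h

/-- The energies of the solutions are bounded, uniformly with respect to bounded horizons. -/
lemma Admissible.exists_dirEnergy_le (h : Admissible Ω s p) (D : ℝ)
    {f : EuclideanSpace ℝ (Fin n) → ℝ}
    (hf : MemLp f (ENNReal.ofReal (pStar s p / (pStar s p - 1))) (volume.restrict Ω)) :
    ∃ R : ℝ, ∀ δ : Fin n → ℝ, (∀ i, 0 ≤ δ i) → (∀ i, δ i ≤ D) →
      ∀ u : EuclideanSpace ℝ (Fin n) → ℝ, IsWeakSolution Ω s p δ f u →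
      ∀ i, dirEnergy i (s i) (p i) (δ i) u ≤ R := by
  obtain ⟨C, hC, hsob⟩ := h.exists_sobolev D
  have hpq := h.holderConjugate
  have hP0 := hpq.pos
  have hκ := h.one_lt_sum
  have hκτ := h.sum_lt
  have hPeq := h.pStar_eq
  set κ := ∑ i, 1 / (s i * p i)
  set τ := ∑ i, 1 / s i
  set P := pStar s p
  set q := P / (P - 1)
  set F := (∫ x in Ω, |f x| ^ q) ^ (1 / q) with hF
  have hF0 : 0 ≤ F := Real.rpow_nonneg
    (integral_nonneg fun x => Real.rpow_nonneg (abs_nonneg _) _) _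
  refine ⟨(F * C ^ (κ / τ)) ^ (1 - κ / τ)⁻¹, fun δ hδ hδD u hu i => ?_⟩
  -- Testing the equation with u itself gives M = ∫ f u. Hölder's and Sobolev's inequalities bound
  -- this by F (C M)^(κ/τ), because (κ/(κ-1))/P = κ/τ; every pᵢ > 1 makes this exponent less than 1.
  set M := ∑ i, dirEnergy i (s i) (p i) (δ i) u with hM
  have hM0 : 0 ≤ M := Finset.sum_nonneg fun _ _ => dirEnergy_nonneg
  have hMi : ∀ i, dirEnergy i (s i) (p i) (δ i) u ≤ M := fun i => Finset.single_le_sum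
    (f := fun i => dirEnergy i (s i) (p i) (δ i) u) (fun _ _ => dirEnergy_nonneg)
    (Finset.mem_univ i)
  obtain ⟨hmem, hbound⟩ := hsob δ hδ hδD u hu.1 M hMi
  refine (hMi i).trans (le_rpow_of_le_mul_rpow hM0 (by positivity) ?_ ?_)
  · exact (div_lt_one (by linarith)).2 hκτ
  · have h1 : M = ∫ x in Ω, f x * u x := by
      rw [← hu.2 u hu.1, form]
      exact Finset.sum_congr rfl fun i _ =>
        ((hu.1.1 i).formI_self (h.order i) (h.one_lt i) (hδ i)).symm
    have h2 : ∫ x in Ω, f x * u x ≤ F * (∫ x in Ω, |u x| ^ P) ^ (1 / P) := by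
      refine (le_abs_self _).trans (abs_integral_le_integral_abs.trans ?_)
      simp only [abs_mul]
      exact integral_mul_norm_le_Lp_mul_Lq hpq.symm hf (hmem.restrict Ω)
    have h3 : ∫ x in Ω, |u x| ^ P ≤ (C * M) ^ (κ / (κ - 1)) :=
      (setIntegral_le_integral (integrable_abs_rpow h.one_lt_pStar hmem)
        (ae_of_all _ fun x => Real.rpow_nonneg (abs_nonneg _) _)).trans hbound
    have h4 : (∫ x in Ω, |u x| ^ P) ^ (1 / P) ≤ C ^ (κ / τ) * M ^ (κ / τ) := by
      rw [← Real.mul_rpow hC hM0]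
      refine (Real.rpow_le_rpow (integral_nonneg fun x => Real.rpow_nonneg (abs_nonneg _) _) h3
        (by positivity)).trans (le_of_eq ?_)
      rw [← Real.rpow_mul (by positivity), hPeq]
      congr 1
      have : κ - 1 ≠ 0 := by linarith
      have : τ ≠ 0 := by linarith
      field_simp
    rw [mul_assoc]
    exact h1.le.trans (h2.trans (mul_le_mul_of_nonneg_left h4 hF0))

end Global

/-! ### Compactness, Minty's device, strong convergence and uniqueness. -/

section Limit

variable {n : ℕ} {Ω : Set (EuclideanSpace ℝ (Fin n))} {s p : Fin n → ℝ} {l : Ultrafilter ℕ}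
  {d : ℕ → Fin n → ℝ} {d₀ : Fin n → ℝ} {f : EuclideanSpace ℝ (Fin n) → ℝ}

/-- Compactness along varying horizons. -/
lemma Admissible.exists_limit (h : Admissible Ω s p)
    (hd : ∀ i, HorizonLimit l (fun k => d k i) (d₀ i)) {D : ℝ} (hD : ∀ k i, d k i ≤ D)
    {v : ℕ → EuclideanSpace ℝ (Fin n) → ℝ} (hv : ∀ k, MemW0 Ω s p (d k) (v k)) {R : ℝ}
    (hR : ∀ k i, dirEnergy i (s i) (p i) (d k i) (v k) ≤ R) :
    ∃ v₀, MemW0 Ω s p d₀ v₀ ∧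
      (∀ w, MemW0 Ω s p d₀ w →
        Tendsto (fun k => form s p (d k) w (v k)) l (𝓝 (form s p d₀ w v₀))) ∧
      ∀ ψ, MemLp ψ (ENNReal.ofReal (pStar s p / (pStar s p - 1))) (volume.restrict Ω) →
        Tendsto (fun k => ∫ x in Ω, ψ x * v k x) l (𝓝 (∫ x in Ω, ψ x * v₀ x)) := by
  have hfin := h.isFiniteMeasure
  have hΩ := h.isOpen.measurableSet
  have hP := h.one_lt_pStar
  obtain ⟨C, hC, hsob⟩ := h.exists_sobolev D
  set R₁ := (C * R) ^ ((∑ i, 1 / (s i * p i)) / (∑ i, 1 / (s i * p i) - 1)) with hR₁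
  have hs := fun k => hsob (d k) (fun i => ((hd i).1 k).le) (hD k) (v k) (hv k) R (hR k)
  have hvR : ∀ k, ∫ x in Ω, |v k x| ^ pStar s p ≤ R₁ := fun k =>
    (setIntegral_le_integral (integrable_abs_rpow hP (hs k).1)
      (ae_of_all _ fun x => Real.rpow_nonneg (abs_nonneg _) _)).trans (hs k).2
  obtain ⟨g, hg, hglim⟩ := exists_weak_limit h.holderConjugate l
    (fun k => (hs k).1.restrict Ω) (Eventually.of_forall hvR)
  have hint : ∀ ψ : EuclideanSpace ℝ (Fin n) → ℝ, ∫ x in Ω, ψ x * Ω.indicator g x =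
      ∫ x in Ω, ψ x * g x := fun ψ =>
    setIntegral_congr_fun hΩ fun x hx => by simp only [Set.indicator_of_mem hx]
  have hgi : Integrable (Ω.indicator g) := by
    rw [integrable_indicator_iff hΩ]
    exact hg.integrable (one_le_ofReal hP)
  -- The weak limit is taken in the critical space over Ω and extended by zero. Since Ω has finite
  -- measure and every p i is below the critical exponent, it lies in all the `L^(p i)`.
  have hgp : ∀ i, MemLp (Ω.indicator g) (ENNReal.ofReal (p i)) := fun i =>
    (memLp_indicator_iff_restrict hΩ).2
      (hg.mono_exponent (ENNReal.ofReal_le_ofReal (h.lt_pStar i).le))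
  have hvi := fun k => (hv k).integrable h
  have hset : ∀ k (φ : EuclideanSpace ℝ (Fin n) → ℝ),
      ∫ x in Ω, φ x * v k x = ∫ x, φ x * v k x := fun k φ => by
    refine setIntegral_eq_integral_of_ae_compl_eq_zero ?_
    filter_upwards [(hv k).2] with x hx hxΩ
    rw [hx hxΩ, mul_zero]
  have hvbound : ∀ k, ∫ x, |v k x| ≤ volume.real Ω + R₁ := fun k => by
    have i1 : Integrable (fun x => |v k x| ^ pStar s p) (volume.restrict Ω) :=
      integrable_abs_rpow hP ((hs k).1.restrict Ω)
    calc ∫ x, |v k x| = ∫ x in Ω, |v k x| := by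
          refine (setIntegral_eq_integral_of_ae_compl_eq_zero ?_).symm
          filter_upwards [(hv k).2] with x hx hxΩ
          rw [hx hxΩ, abs_zero]
      _ ≤ ∫ x in Ω, (1 + |v k x| ^ pStar s p) := by
          refine integral_mono (hvi k).abs.restrict ((integrable_const _).add i1) fun x => ?_
          simp only
          rcases le_total |v k x| 1 with h1 | h1
          · linarith [Real.rpow_nonneg (abs_nonneg (v k x)) (pStar s p)]
          · linarith [Real.self_le_rpow_of_one_le h1 hP.le]
      _ ≤ volume.real Ω + R₁ := by
          rw [integral_add (integrable_const _) i1]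
          simpa using hvR k
  have hweak : ∀ φ : EuclideanSpace ℝ (Fin n) → ℝ, AEStronglyMeasurable φ →
      (∃ M, ∀ x, |φ x| ≤ M) →
      Tendsto (fun k => ∫ x, φ x * v k x) l (𝓝 (∫ x, φ x * Ω.indicator g x)) := by
    rintro φ hφ ⟨M, hM⟩
    have h1 := hglim φ (MemLp.of_bound hφ.restrict M (ae_of_all _ hM))
    have h2 : ∫ x, φ x * Ω.indicator g x = ∫ x in Ω, φ x * g x := by
      rw [← hint]
      refine (setIntegral_eq_integral_of_forall_compl_eq_zero fun x hx => ?_).symm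
      rw [Set.indicator_of_notMem hx, mul_zero]
    rw [h2]
    exact h1.congr fun k => hset k φ
  have key := fun i => (hd i).tendsto_formI (h.order i) (h.one_lt i) (fun k => (hv k).1 i) hvi
    (Eventually.of_forall hvbound) hgi (hgp i) (Eventually.of_forall fun k => hR k i) hweak
  refine ⟨Ω.indicator g, ⟨fun i => (key i).1, ae_of_all _ fun x hx =>
    Set.indicator_of_notMem hx g⟩, fun w hw => ?_, fun ψ hψ => ?_⟩
  · exact tendsto_finsetSum _ fun i _ => (key i).2 w (hw.1 i)
  · rw [hint]
    exact hglim ψ hψ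

lemma Admissible.tendsto_form_const (h : Admissible Ω s p)
    (hd : ∀ i, HorizonLimit l (fun k => d k i) (d₀ i)) {u w : EuclideanSpace ℝ (Fin n) → ℝ}
    (hu : MemW0 Ω s p d₀ u) (hw : MemW0 Ω s p d₀ w) :
    Tendsto (fun k => form s p (d k) w u) l (𝓝 (form s p d₀ w u)) :=
  tendsto_finsetSum _ fun i _ => (hd i).tendsto_formI_const (h.order i) (h.one_lt i) (hu.1 i)
    (hu.integrable h) (hw.1 i)

lemma MemW0.of_limit {u : EuclideanSpace ℝ (Fin n) → ℝ} (hu : MemW0 Ω s p d₀ u)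
    (h : Admissible Ω s p) (hd : ∀ i, HorizonLimit l (fun k => d k i) (d₀ i)) (k : ℕ) :
    MemW0 Ω s p (d k) u :=
  ⟨fun i => (hd i).memWi (hu.1 i) (h.order i) (h.one_lt i) k, hu.2⟩

/-- Each direction contributes a nonnegative gap, so the total gap controls every single one. -/
lemma MemW0.form_monotone {δ : Fin n → ℝ} {u v : EuclideanSpace ℝ (Fin n) → ℝ}
    (hu : MemW0 Ω s p δ u) (hv : MemW0 Ω s p δ v) (h : Admissible Ω s p) (hδ : ∀ i, 0 ≤ δ i)
    (i : Fin n) :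
    0 ≤ formI i (s i) (p i) (δ i) u (fun x => u x + -1 * v x) -
        formI i (s i) (p i) (δ i) v (fun x => u x + -1 * v x) ∧
      formI i (s i) (p i) (δ i) u (fun x => u x + -1 * v x) -
        formI i (s i) (p i) (δ i) v (fun x => u x + -1 * v x) ≤
      form s p δ u (fun x => u x + -1 * v x) - form s p δ v (fun x => u x + -1 * v x) := by
  have h1 := fun i => (hu.1 i).formI_monotone (hv.1 i) (h.order i) (h.one_lt i) (hδ i)
  refine ⟨h1 i, ?_⟩
  rw [form, form, ← Finset.sum_sub_distrib]
  exact Finset.single_le_sum (f := fun i => formI i (s i) (p i) (δ i) u (fun x => u x + -1 * v x) -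
    formI i (s i) (p i) (δ i) v (fun x => u x + -1 * v x)) (fun i _ => h1 i) (Finset.mem_univ i)

lemma MemW0.form_sub_form_nonneg {δ : Fin n → ℝ} {u v : EuclideanSpace ℝ (Fin n) → ℝ}
    (hu : MemW0 Ω s p δ u) (hv : MemW0 Ω s p δ v) (h : Admissible Ω s p) (hδ : ∀ i, 0 ≤ δ i) :
    0 ≤ form s p δ u (fun x => u x + -1 * v x) - form s p δ v (fun x => u x + -1 * v x) :=
  (hu.form_monotone hv h hδ ⟨0, h.dim_pos⟩).1.trans (hu.form_monotone hv h hδ _).2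

/-- Minty's device: a solution of the variational inequality is a weak solution. -/
lemma MemW0.isWeakSolution_of_le {δ : Fin n → ℝ} {u : EuclideanSpace ℝ (Fin n) → ℝ}
    (hu : MemW0 Ω s p δ u) (h : Admissible Ω s p) (hδ : ∀ i, 0 ≤ δ i)
    (hf : MemLp f (ENNReal.ofReal (pStar s p / (pStar s p - 1))) (volume.restrict Ω))
    (hle : ∀ w, MemW0 Ω s p δ w → form s p δ w (fun x => u x + -1 * w x) ≤
      ∫ x in Ω, f x * (u x + -1 * w x)) : IsWeakSolution Ω s p δ f u := by
  -- With w = u + t z one has u - w = -t z. Dividing by t of either sign and letting t → 0 gives the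
  -- two opposite inequalities.
  have key : ∀ (z : EuclideanSpace ℝ (Fin n) → ℝ), MemW0 Ω s p δ z →
      ∀ t : ℝ, t * form s p δ (fun x => u x + t * z x) z ≥ t * ∫ x in Ω, f x * z x := by
    intro z hz t
    have hw := hu.add_const_mul hz h hδ t
    have h1 := hle _ hw
    rw [hu.integral_mul_add_const_mul hw h hδ hf, hu.integral_mul_add_const_mul hz h hδ hf,
      hw.form_add_const_mul hu hw h hδ, hw.form_add_const_mul hu hz h hδ] at h1
    linarith
  refine ⟨hu, fun z hz => ?_⟩
  have hcont : Tendsto (fun t : ℝ => form s p δ (fun x => u x + t * z x) z) (𝓝 0)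
      (𝓝 (form s p δ u z)) := tendsto_finsetSum _ fun i _ =>
    (hu.1 i).tendsto_formI_add_const_mul (hz.1 i) (h.order i) (h.one_lt i) (hδ i)
  refine le_antisymm ?_ ?_
  · refine le_of_tendsto (hcont.mono_left (nhdsWithin_le_nhds (s := Set.Iio 0))) ?_
    filter_upwards [self_mem_nhdsWithin] with t ht
    exact (mul_le_mul_left_of_neg ht).1 (key z hz t)
  · refine ge_of_tendsto (hcont.mono_left (nhdsWithin_le_nhds (s := Set.Ioi 0))) ?_
    filter_upwards [self_mem_nhdsWithin] with t ht
    exact le_of_mul_le_mul_left (key z hz t) ht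

lemma IsWeakSolution.form_sub {δ : Fin n → ℝ} {u w : EuclideanSpace ℝ (Fin n) → ℝ}
    (hu : IsWeakSolution Ω s p δ f u) (hw : MemW0 Ω s p δ w) (h : Admissible Ω s p)
    (hδ : ∀ i, 0 ≤ δ i) : form s p δ u (fun x => u x + -1 * w x) =
      ∫ x in Ω, f x * (u x + -1 * w x) :=
  hu.2 _ (hu.1.add_const_mul hw h hδ (-1))

/-- Limits of solutions along an ultrafilter. -/
lemma Admissible.exists_limit_solution (h : Admissible Ω s p)
    (hd : ∀ i, HorizonLimit l (fun k => d k i) (d₀ i)) {D : ℝ} (hD : ∀ k i, d k i ≤ D)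
    (hf : MemLp f (ENNReal.ofReal (pStar s p / (pStar s p - 1))) (volume.restrict Ω))
    {u : ℕ → EuclideanSpace ℝ (Fin n) → ℝ} (hu : ∀ k, IsWeakSolution Ω s p (d k) f (u k)) :
    ∃ u₀, IsWeakSolution Ω s p d₀ f u₀ ∧ ∀ i,
      Tendsto (fun k => dirEnergy i (s i) (p i) (d k i) (fun x => u k x + -1 * u₀ x)) l (𝓝 0) := by
  have hdpos : ∀ k i, 0 ≤ d k i := fun k i => ((hd i).1 k).le
  have hd0 : ∀ i, 0 ≤ d₀ i := fun i => (hd i).nonneg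
  obtain ⟨R, hR⟩ := h.exists_dirEnergy_le D hf
  have hRk := fun k => hR (d k) (hdpos k) (hD k) (u k) (hu k)
  obtain ⟨u₀, hu₀, hform, hlim⟩ := h.exists_limit hd hD (fun k => (hu k).1) hRk
  -- The equation replaces the nonlinear term in u k by ∫ f (u k - w), so only terms linear in u k
  -- remain. The test function w is admissible for every k because regularity for the limit horizon
  -- implies that for d k.
  have hgap : ∀ w, MemW0 Ω s p d₀ w → Tendsto (fun k =>
      form s p (d k) (u k) (fun x => u k x + -1 * w x) -
        form s p (d k) w (fun x => u k x + -1 * w x)) l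
      (𝓝 ((∫ x in Ω, f x * (u₀ x + -1 * w x)) - form s p d₀ w (fun x => u₀ x + -1 * w x))) := by
    intro w hw
    rw [hu₀.integral_mul_add_const_mul hw h hd0 hf, hw.form_add_const_mul hu₀ hw h hd0]
    refine (((hlim f hf).add_const _).sub ((hform w hw).add
      ((h.tendsto_form_const hd hw hw).const_mul (-1)))).congr fun k => ?_
    have hwk := hw.of_limit h hd k
    rw [(hu k).form_sub hwk h (hdpos k), (hu k).1.integral_mul_add_const_mul hwk h (hdpos k) hf,
      hwk.form_add_const_mul (hu k).1 hwk h (hdpos k)]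
  refine ⟨u₀, hu₀.isWeakSolution_of_le h hd0 hf fun w hw => ?_, fun i => ?_⟩
  · exact sub_nonneg.1 (ge_of_tendsto (hgap w hw) (Eventually.of_forall fun k =>
      (hu k).1.form_sub_form_nonneg (hw.of_limit h hd k) h (hdpos k)))
  -- For w = u₀ the gap tends to 0, and uniform monotonicity upgrades weak to strong convergence.
  · have hgap0 := hgap u₀ hu₀
    have hz : (∫ x in Ω, f x * (u₀ x + -1 * u₀ x)) -
        form s p d₀ u₀ (fun x => u₀ x + -1 * u₀ x) = 0 := by
      rw [hu₀.integral_mul_add_const_mul hu₀ h hd0 hf, hu₀.form_add_const_mul hu₀ hu₀ h hd0]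
      ring
    rw [hz] at hgap0
    obtain ⟨R₀, hR₀⟩ := (hd i).exists_dirEnergy_le (h.order i) (h.one_lt i) (hu₀.1 i)
    rw [Metric.tendsto_nhds]
    intro η hη
    have hden : 0 < |R| + |R₀| + 1 := by positivity
    obtain ⟨C, hC, hsub⟩ := exists_dirEnergy_sub_le i (h.order i) (h.one_lt i)
      (show 0 < η / (2 * (|R| + |R₀| + 1)) by positivity)
    have h1 := hgap0.eventually (gt_mem_nhds (show 0 < η / (4 * (C + 1)) by positivity))
    filter_upwards [h1] with k hk
    have hu₀k := hu₀.of_limit h hd k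
    have h2 := (hu k).1.form_monotone hu₀k h (hdpos k) i
    have h3 := hsub (d k i) (u k) u₀ (hdpos k i) ((hu k).1.1 i) (hu₀k.1 i)
    have h4 : C * (formI i (s i) (p i) (d k i) (u k) (fun x => u k x + -1 * u₀ x) -
        formI i (s i) (p i) (d k i) u₀ (fun x => u k x + -1 * u₀ x)) ≤ η / 4 := by
      calc _ ≤ (C + 1) * (η / (4 * (C + 1))) :=
            mul_le_mul (by linarith) (h2.2.trans hk.le) h2.1 (by linarith)
        _ = η / 4 := by field_simp
    have h5 : η / (2 * (|R| + |R₀| + 1)) * (dirEnergy i (s i) (p i) (d k i) (u k) +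
        dirEnergy i (s i) (p i) (d k i) u₀) ≤ η / 2 := by
      calc _ ≤ η / (2 * (|R| + |R₀| + 1)) * (|R| + |R₀| + 1) := by
            refine mul_le_mul_of_nonneg_left ?_ (by positivity)
            linarith [hRk k i, hR₀ k, le_abs_self R, le_abs_self R₀]
        _ = η / 2 := by field_simp
    rw [Real.dist_eq, sub_zero, abs_of_nonneg dirEnergy_nonneg]
    linarith

/-- Uniqueness of weak solutions. -/
lemma IsWeakSolution.ae_eq {δ : Fin n → ℝ} {u w : EuclideanSpace ℝ (Fin n) → ℝ}
    (hu : IsWeakSolution Ω s p δ f u) (hw : IsWeakSolution Ω s p δ f w) (h : Admissible Ω s p)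
    (hδ : ∀ i, 0 ≤ δ i) : u =ᵐ[volume] w := by
  have i : Fin n := ⟨0, h.dim_pos⟩
  have hz := hu.1.add_const_mul hw.1 h hδ (-1)
  have h1 := hu.1.form_monotone hw.1 h hδ i
  rw [hu.form_sub hw.1 h hδ, hw.2 _ hz, sub_self] at h1
  have h2 : dirEnergy i (s i) (p i) (δ i) (fun x => u x + -1 * w x) = 0 := by
    -- The monotonicity gap of two solutions vanishes, so only the error term remains, and its
    -- weight is arbitrary.
    refine le_antisymm (le_of_forall_pos_le_add fun η hη => ?_) dirEnergy_nonneg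
    set A := dirEnergy i (s i) (p i) (δ i) u + dirEnergy i (s i) (p i) (δ i) w with hA
    have hA0 : 0 ≤ A := add_nonneg dirEnergy_nonneg dirEnergy_nonneg
    obtain ⟨C, -, hsub⟩ := exists_dirEnergy_sub_le i (h.order i) (h.one_lt i)
      (show 0 < η / (A + 1) by positivity)
    have h3 := hsub (δ i) u w (hδ i) (hu.1.1 i) (hw.1.1 i)
    rw [le_antisymm h1.2 h1.1, mul_zero, ← hA] at h3
    refine h3.trans (add_le_add_right ?_ 0)
    calc η / (A + 1) * A ≤ η / (A + 1) * (A + 1) := by gcongr; linarith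
      _ = η := by field_simp
  obtain ⟨C, -, hC⟩ := exists_halfEnergy_le_dirQuot i h.isBounded (h.order i) (h.one_lt i) (δ i)
  have h4 := (hC (δ i) (hδ i) le_rfl _ (hz.1 i) hz.2).2
  rw [← (hz.1 i).ofReal_dirEnergy (h.order i) (h.one_lt i) (hδ i), h2, ENNReal.ofReal_zero,
    mul_zero, nonpos_iff_eq_zero, lintegral_eq_zero_iff' ((hz.1 i).1.1.enorm.pow_const _)] at h4
  filter_upwards [h4] with x hx
  have h5 : ‖u x + -1 * w x‖ₑ = 0 :=
    (ENNReal.rpow_eq_zero_iff_of_pos (zero_lt_one.trans (h.one_lt i))).1 hx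
  rw [enorm_eq_zero] at h5
  linarith

/-- The uniform Poincaré inequality is applied to u k - u₀, which belongs to the space of horizon d
k although u₀ solves the limit problem. -/
lemma Admissible.tendsto_eLpNorm (h : Admissible Ω s p)
    (hd : ∀ i, HorizonLimit l (fun k => d k i) (d₀ i)) {D : ℝ} (hD : ∀ k i, d k i ≤ D)
    {u : ℕ → EuclideanSpace ℝ (Fin n) → ℝ} (hu : ∀ k, MemW0 Ω s p (d k) (u k))
    {u₀ : EuclideanSpace ℝ (Fin n) → ℝ} (hu₀ : MemW0 Ω s p d₀ u₀) (i : Fin n)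
    (hlim : Tendsto (fun k => dirEnergy i (s i) (p i) (d k i) (fun x => u k x + -1 * u₀ x)) l
      (𝓝 0)) :
    Tendsto (fun k => eLpNorm (fun x => u k x - u₀ x) (ENNReal.ofReal (p i))
      (volume.restrict Ω)) l (𝓝 0) := by
  have hp0 : 0 < p i := zero_lt_one.trans (h.one_lt i)
  have hdpos : ∀ k i, 0 ≤ d k i := fun k i => ((hd i).1 k).le
  obtain ⟨C, -, hC⟩ := exists_halfEnergy_le_dirQuot i h.isBounded (h.order i) (h.one_lt i) D
  have h1 : Tendsto (fun k => (ENNReal.ofReal C * ENNReal.ofReal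
      (dirEnergy i (s i) (p i) (d k i) (fun x => u k x + -1 * u₀ x))) ^ (p i)⁻¹) l (𝓝 0) := by
    have h2 := ENNReal.Tendsto.const_mul (a := ENNReal.ofReal C)
      (ENNReal.tendsto_ofReal hlim) (Or.inr ENNReal.ofReal_ne_top)
    rw [ENNReal.ofReal_zero, mul_zero] at h2
    have h3 := ((ENNReal.continuous_rpow_const (y := (p i)⁻¹)).tendsto 0).comp h2
    rwa [ENNReal.zero_rpow_of_pos (inv_pos.2 hp0)] at h3
  refine tendsto_of_tendsto_of_tendsto_of_le_of_le tendsto_const_nhds h1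
    (fun _ => zero_le) fun k => ?_
  have hz := (hu k).add_const_mul (hu₀.of_limit h hd k) h (hdpos k) (-1)
  have h4 := (hC (d k i) (hdpos k i) (hD k i) _ (hz.1 i) hz.2).2
  rw [← (hz.1 i).ofReal_dirEnergy (h.order i) (h.one_lt i) (hdpos k i),
    ← eLpNorm_rpow_eq_lintegral (h.one_lt i)] at h4
  refine (eLpNorm_mono_measure _ Measure.restrict_le_self).trans ?_
  rw [ENNReal.le_rpow_inv_iff hp0]
  refine le_of_eq_of_le ?_ h4
  congr 2
  funext x
  ring

end Limit

end Peridynamic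

end

/-! ### From ultrafilters to the whole sequence. -/

theorem mainTheorem8 {n : ℕ} (hn : 0 < n)
    (Ω : Set (EuclideanSpace ℝ (Fin n))) (hΩo : IsOpen Ω) (hΩb : Bornology.IsBounded Ω)
    (s p : Fin n → ℝ)
    (hs : ∀ i, 0 < s i ∧ s i < 1) (hp : ∀ i, 1 < p i)
    (hsp : Peridynamic.meanSP s p < n) (hpmax : ∀ i, p i < Peridynamic.pStar s p)
    (S : Finset (Fin n)) (δ : Fin n → ℝ) (δk : ℕ → Fin n → ℝ)
    (hδpos : ∀ k i, 0 < δk k i)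
    (hδzero : ∀ i ∈ S, Tendsto (fun k => δk k i) atTop (𝓝 0))
    (hδfix : ∀ i ∉ S, ∀ k, δk k i = δ i)
    (f : EuclideanSpace ℝ (Fin n) → ℝ)
    (hf : MemLp f
      (ENNReal.ofReal (Peridynamic.pStar s p / (Peridynamic.pStar s p - 1)))
      (volume.restrict Ω))
    (u : ℕ → EuclideanSpace ℝ (Fin n) → ℝ)
    (hu : ∀ k, Peridynamic.IsWeakSolution Ω s p (δk k) f (u k)) :
    ∃ u₀ : EuclideanSpace ℝ (Fin n) → ℝ,
      Peridynamic.IsWeakSolution Ω s p (Peridynamic.limitHorizon S δ) f u₀ ∧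
      (∀ w, Peridynamic.IsWeakSolution Ω s p (Peridynamic.limitHorizon S δ) f w →
        w =ᵐ[volume] u₀) ∧
      Tendsto (fun k => eLpNorm (fun x => u k x - u₀ x) (ENNReal.ofReal (⨅ i, p i))
        (volume.restrict Ω)) atTop (𝓝 0) := by
  have h : Peridynamic.Admissible Ω s p := ⟨hn, hΩo, hΩb, hs, hp, hsp, hpmax⟩
  have hne : Nonempty (Fin n) := ⟨⟨0, hn⟩⟩
  have hbdd : ∀ i, ∃ D, ∀ k, δk k i ≤ D := fun i => by
    by_cases hi : i ∈ S
    · obtain ⟨D, hD⟩ := (hδzero i hi).bddAbove_range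
      exact ⟨D, fun k => hD ⟨k, rfl⟩⟩
    · exact ⟨δ i, fun k => (hδfix i hi k).le⟩
  choose D hD using hbdd
  have hD' : ∀ k i, δk k i ≤ ∑ j, D j := fun k i => (hD i k).trans
    (Finset.single_le_sum (fun j _ => (hδpos 0 j).le.trans (hD j 0)) (Finset.mem_univ i))
  have hlimit : ∀ l : Ultrafilter ℕ, (l : Filter ℕ) ≤ atTop → ∀ i,
      Peridynamic.HorizonLimit l (fun k => δk k i) (Peridynamic.limitHorizon S δ i) := by
    refine fun l hl i => ⟨fun k => hδpos k i, ?_⟩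
    by_cases hi : i ∈ S
    · exact Or.inl ⟨if_pos hi, (hδzero i hi).mono_left hl⟩
    · exact Or.inr fun k => (hδfix i hi k).trans (if_neg hi).symm
  have hδ0 : ∀ i, 0 ≤ Peridynamic.limitHorizon S δ i := fun i =>
    (hlimit (Ultrafilter.of atTop) (Ultrafilter.of_le _) i).nonneg
  -- Any one ultrafilter finer than `atTop` already provides a solution of the limit problem.
  obtain ⟨u₀, hu₀, -⟩ :=
    h.exists_limit_solution (hlimit (Ultrafilter.of atTop) (Ultrafilter.of_le _)) hD' hf hu
  refine ⟨u₀, hu₀, fun w hw => hw.ae_eq hu₀ h hδ0, ?_⟩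
  obtain ⟨i, hi⟩ := exists_eq_ciInf_of_finite (f := p)
  rw [← hi]
  -- Along each ultrafilter the limit is again a solution, hence equals u₀ almost everywhere by
  -- uniqueness; agreement along all of them is convergence of the whole sequence.
  refine (tendsto_iff_ultrafilter _ _ _).2 fun l hl => ?_
  obtain ⟨v, hv, hlim⟩ := h.exists_limit_solution (hlimit l hl) hD' hf hu
  refine (h.tendsto_eLpNorm (hlimit l hl) hD' (fun k => (hu k).1) hv.1 i (hlim i)).congr
    fun k => eLpNorm_congr_ae (ae_restrict_of_ae ?_)
  filter_upwards [hv.ae_eq hu₀ h hδ0] with x hx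
  rw [hx]
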